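/- Conventions. A partial field is a pair $\mathbb P=(R,G)$, where $R$ is a commutative ring with $1$ and $G$ is a subgroup of the unit group $R^*$ with $-1\in G$; as a set, $\mathbb P=G\cup\{0\}$. A matrix over $R$ is a $\mathbb P$-matrix if the determinant of each of its square submatrices lies in $\mathbb P$. For an $r\times E$ matrix $C$, write $M=M[C]$ if $M$ is the matroid on $E$ whose bases are exactly the sets $B\subseteq E$ with $|B|=r$ and $\det C[B]\neq 0$, where $C[B]$ consists of the columns of $C$ in $B$. A matroid $M$ is $\mathbb P$-representable if $M=M[C]$ for some $\mathbb P$-matrix $C$. Two $X\times Y$ matrices satisfy $A\sim A'$ if $A'$ arises from $A$ by multiplying rows and columns by elements of $G$. All matroids are finite. With $\lambda_M(Z)=r(Z)+r(E-Z)-r(E)$, a $k$-separation of $M$ is a partition $(Z_1,Z_2)$ of the ground set $E$ with $|Z_1|,|Z_2|\ge k$ and $\lambda_M(Z_1)<k$; $M$ is $3$-connected if it has no $k$-separation for $k<3$. Let $N'$ be a minor of $M$. Then $N'$ is a $\mathbb P$-stabilizer for $M$ if the following holds for all disjoint $X,Y$ with $E(M)=X\cup Y$ and $X$ a basis of $M$,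 all $X'\subseteq X$, $Y'\subseteq Y$ such that $E(N')=X'\cup Y'$, $X'$ is a basis of $N'$ and $N'=M/(X\setminus X')\backslash(Y\setminus Y')$, and all $X\times Y$ $\mathbb P$-matrices $A_1,A_2$ with $M=M[I\;A_1]=M[I\;A_2]$: if $A_1[X',Y']\sim A_2[X',Y']$, then $A_1\sim A_2$. For a matroid $N$, we say that $N$ stabilizes $M$ (over $\mathbb P$) if every minor $N'$ of $M$ that is isomorphic to $N$ is a $\mathbb P$-stabilizer for $M$. Theorem (Stabilizer Theorem). Let $\mathbb P$ be a partial field, and let $N$ be a $3$-connected $\mathbb P$-representable matroid with at least two elements. Let $M$ be a $3$-connected $\mathbb P$-representable matroid having a minor isomorphic to $N$. Then at least one of the following is true: 1. $N$ stabilizes $M$; 2. $M$ has a $3$-connected minor $M'$ such that $N$ does not stabilize $M'$ and at least one of the following holds: - $N$ is isomorphic to $M'/x$ for some $x\in E(M')$; - $N$ is isomorphic to $M'\backslash y$ for some $y\in E(M')$; - there are distinct $x,y\in E(M')$ such that $N$ is isomorphic to $M'/x\backslash y$ and at least one of $M'/x$, $M'\backslash y$ is $3$-connected. -/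

import Mathlib

open scoped Matroid

/-- A partial field `(R, G)`: a commutative ring `R` together with a subgroup `G` of the group of
units of `R` such that `-1 ∈ G`. -/
structure PartialField (R : Type*) [CommRing R] where
  /-- the group `G` of nonzero elements of the partial field -/
  group : Subgroup Rˣ
  neg_one_mem : (-1 : Rˣ) ∈ group

namespace PartialField

variable {R : Type*} [CommRing R]

/-- Membership in the partial field, viewed as the set `G ∪ {0}`. -/
def Mem (P : PartialField R) (x : R) : Prop :=
  x = 0 ∨ ∃ u ∈ P.group, (u : R) = x

/-- `A` is a `P`-matrix: every square submatrix has its determinant in `P` (in particular every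
entry is in `P`). As `-1 ∈ G`, the chosen orders of the rows and columns do not matter. -/
def IsPMatrix (P : PartialField R) {m n : Type*} (A : Matrix m n R) : Prop :=
  ∀ (k : ℕ) (f : Fin k → m) (g : Fin k → n), f.Injective → g.Injective →
    P.Mem (A.submatrix f g).det

/-- `A ∼ A'`: the matrix `A'` is obtained from `A` by scaling rows and columns by elements
of `G`. -/
def ScalingEquiv (P : PartialField R) {m n : Type*} (A A' : Matrix m n R) : Prop :=
  ∃ (r : m → P.group) (c : n → P.group), ∀ i j,
    A' i j = ((r i : Rˣ) : R) * A i j * ((c j : Rˣ) : R)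

end PartialField

open Classical in
/-- `M = M[C]` for an `m × E` matrix `C`: the ground set of `M` is `E`, and a set `B ⊆ E` is a basis
of `M` exactly if `|B| = |m|` and the determinant of the submatrix on the columns in `B` is nonzero.
(The bijection `e` orders the columns in `B`; it affects only the sign of the determinant.) -/
def IsMatroidOf {R : Type*} [CommRing R] {α m : Type*} [Fintype m] {E : Set α}
    (C : Matrix m E R) (M : Matroid α) : Prop :=
  M.E = E ∧ ∀ B : Set E, M.IsBase (Subtype.val '' B) ↔
    ∃ e : m ≃ B, (C.submatrix id (fun i => (e i : E))).det ≠ 0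

open Classical in
/-- The `X × (X ∪ Y)` matrix `[I A]`, for an `X × Y` matrix `A` with `X`, `Y` disjoint. -/
noncomputable def idAppend {R : Type*} [CommRing R] {α : Type*} {X Y : Finset α} (A : Matrix X Y R) :
    Matrix X ((X : Set α) ∪ (Y : Set α) : Set α) R :=
  fun x e => if h : (e : α) ∈ Y then A x ⟨e, h⟩ else if (x : α) = e then 1 else 0

namespace Matroid

variable {α β : Type*}

/-- `M` is `P`-representable: `M = M[C]` for some `r × E` `P`-matrix `C`. -/
def IsPRepresentable {R : Type*} [CommRing R] (P : PartialField R) (M : Matroid α) : Prop :=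
  ∃ (r : ℕ) (C : Matrix (Fin r) M.E R), P.IsPMatrix C ∧ IsMatroidOf C M

/-- `(Z₁, Z₂)` is a `k`-separation of `M` (used for matroids of finite rank): a partition of the
ground set with `|Z₁|, |Z₂| ≥ k` and `λ(Z₁) = r(Z₁) + r(Z₂) - r(M) < k`. -/
def IsKSeparation (M : Matroid α) (k : ℕ) (Z₁ Z₂ : Set α) : Prop :=
  Z₁ ∪ Z₂ = M.E ∧ Disjoint Z₁ Z₂ ∧ (k : ℕ∞) ≤ Z₁.encard ∧ (k : ℕ∞) ≤ Z₂.encard ∧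
    M.eRk Z₁ + M.eRk Z₂ < M.eRank + k

/-- `M` is `k`-connected: it has no `k'`-separation for any `k' < k`. -/
def IsKConnected (M : Matroid α) (k : ℕ) : Prop :=
  ∀ k' < k, ∀ Z₁ Z₂ : Set α, ¬ M.IsKSeparation k' Z₁ Z₂

/-- `N` and `M` are isomorphic: some bijection between the ground sets preserves independence in
both directions. -/
def IsIsomorphic (N : Matroid β) (M : Matroid α) : Prop :=
  ∃ e : N.E ≃ M.E, ∀ I : Set N.E,
    N.Indep (Subtype.val '' I) ↔ M.Indep (Subtype.val '' (e '' I))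

/-- `M` has an `N`-minor, i.e. a minor isomorphic to `N`. -/
def HasMinorIso (M : Matroid α) (N : Matroid β) : Prop :=
  ∃ N' : Matroid α, N' ≤m M ∧ N.IsIsomorphic N'

/-- The (labelled) minor `N` of `M` is a `P`-stabilizer for `M`. For all bases `X` of `M` and `X'`
of `N` with cobases `Y`, `Y'`, where `X' ⊆ X`, `Y' ⊆ Y` and `N` is the minor
`M / (X \ X') \ (Y \ Y')`, and for all `X × Y` `P`-matrices `A₁`, `A₂` with
`M = M[I A₁] = M[I A₂]`: if `A₁[X', Y'] ∼ A₂[X', Y']`, then `A₁ ∼ A₂`. -/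
def IsStabilizerFor {R : Type*} [CommRing R] (P : PartialField R) (N M : Matroid α) : Prop :=
  ∀ (X Y X' Y' : Finset α) (hX : X' ⊆ X) (hY : Y' ⊆ Y),
    Disjoint X Y → M.E = (X : Set α) ∪ Y → M.IsBase X →
    N.E = (X' : Set α) ∪ Y' → N.IsBase X' →
    N = M ／ ((X : Set α) \ X') ＼ ((Y : Set α) \ Y') →
    ∀ A₁ A₂ : Matrix X Y R, P.IsPMatrix A₁ → P.IsPMatrix A₂ →
      IsMatroidOf (idAppend A₁) M → IsMatroidOf (idAppend A₂) M →
      P.ScalingEquiv (A₁.submatrix (Set.inclusion hX) (Set.inclusion hY))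
        (A₂.submatrix (Set.inclusion hX) (Set.inclusion hY)) →
      P.ScalingEquiv A₁ A₂

/-- `N` stabilizes `M` over `P`, where `N` is only given up to isomorphism: every minor of `M`
isomorphic to `N` is a `P`-stabilizer for `M`. -/
def Stabilizes {R : Type*} [CommRing R] (P : PartialField R) (N : Matroid β) (M : Matroid α) :
    Prop :=
  ∀ N' : Matroid α, N' ≤m M → N.IsIsomorphic N' → IsStabilizerFor P N' M

end Matroid

/-!
For two representations `[I A₁]`, `[I A₂]` of the same matroid over a partial field, let `w B` be the
quotient of their minors on a basis `B`. The matrices are scaling equivalent exactly if there is a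
function `t` on the elements such that each basis exchange, of `a` for `b`, changes `w` by the factor
`t b / t a`. The three-term Grassmann–Plücker relations for the two representations imply a relation
that mentions nothing but `w`, and this relation alone carries the theorem. So the proof is about
*weighted matroids* (`WeightedMatroid`), matroids with such a function on their bases. They are
closed under duality, deletion and contraction, and are called *good* if a function `t` as above
exists (`WeightedMatroid.Good`). A minor that fails to stabilize gives a bad `3`-connected weighted
matroid with a good minor isomorphic to `N`, and the theorem becomes
`WeightedMatroid.hasSmallObstruction`: such a weighted matroid contains a bad `3`-connected minor
that is larger than `N` by one element, or by two in the way described in the theorem.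

Two facts drive the combinatorial part. If the deletions of `x` and of `y` are both good, and the
deletion of both is connected and leaves the rank unchanged, then the two scalings agree up to a
constant and `Q` is good (`Good.of_delete_delete`; dually `Good.of_contract_contract`). And a connected good
minor of a connected `Q` is a minor, still good, of a connected one of `Q ＼ x` and `Q ／ x`, for each
element `x` outside it (`HasGoodMinor.conn_del_or_con`). Hence in a bad connected `Q` that is minimal
with a good copy of `N`, any two elements outside the copy are, together with a third fixed one, a
triangle or a triad, and this leaves room for at most three such elements (`isCloseMinor_of_minimal`).
If `N` has at least four elements, it follows that the minimal `Q` is itself the desired minor, or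
has a triangle that is also a triad (`exists_isTriangleTriad`).

Such a triangle is one side of a `2`-separation, which is bridged in the original `3`-connected
weighted matroid. Some element `v` already raises the connectivity (`IsMinorVia.exists_bridge`). If
`v` is not spanned by the triangle, the extension by `v` contains the desired minor
(`IsBridgingExtension.hasSmallObstruction`). Otherwise `v` can take the place of an element `t` of the
triangle (`IsBridgingExtension.exists_replace`), and by uncrossing, the separation remains bridged
after the deletion of `t` or of `v`, so that induction applies (`hasSmallObstruction_of_isBridged`).
If `N` has only two or three elements, every minimal bad weighted matroid is a `U₂,₄`, which is an
extension of `N` as required (`ncard_eq_four_of_minimal`).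

For the translation to matrices, `IsRep.quotient` makes a weighted matroid out of two
representations, `IsRepPair.exists_minor` pivots the two representations so that they restrict to
any given minor and basis, and `IsRepPair.good_iff` identifies goodness with scaling equivalence.
-/

/-! ### Ranks of sets as integers -/

section Rank

open Set

namespace Matroid

variable {α : Type*} {M : Matroid α} {X Y : Set α} {x y e : α}

/-- The rank of a set in a finite matroid, as an integer, so that differences of ranks are not
truncated. -/
noncomputable def rk (M : Matroid α) (X : Set α) : ℤ := (M.eRk X).toNat

lemma cast_rk (M : Matroid α) [M.RankFinite] (X : Set α) :
    ((M.eRk X).toNat : ℕ∞) = M.eRk X :=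
  ENat.natCast_toNat ((eRk_ne_top_iff).2 (M.isRkFinite_set X))

lemma rk_nonneg (M : Matroid α) (X : Set α) : 0 ≤ M.rk X := by unfold rk; positivity

@[simp] lemma rk_empty (M : Matroid α) : M.rk ∅ = 0 := by simp [rk]

lemma rk_mono (M : Matroid α) [M.RankFinite] (h : X ⊆ Y) : M.rk X ≤ M.rk Y := by
  have := M.eRk_mono h
  rw [← cast_rk M X, ← cast_rk M Y] at this
  unfold rk; exact_mod_cast this

lemma rk_submod (M : Matroid α) [M.RankFinite] (X Y : Set α) :
    M.rk (X ∩ Y) + M.rk (X ∪ Y) ≤ M.rk X + M.rk Y := by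
  have := M.eRk_inter_add_eRk_union_le X Y
  rw [← cast_rk M X, ← cast_rk M Y, ← cast_rk M (X ∩ Y), ← cast_rk M (X ∪ Y)] at this
  unfold rk; exact_mod_cast this

lemma rk_inter_ground (M : Matroid α) (X : Set α) : M.rk (X ∩ M.E) = M.rk X := by
  simp [rk]

lemma rk_le_ncard (M : Matroid α) (hX : X.Finite) : M.rk X ≤ X.ncard := by
  have h := M.eRk_le_encard X
  rw [← hX.cast_ncard_eq] at h
  unfold rk
  exact_mod_cast ENat.toNat_le_of_le_natCast h

lemma rk_singleton_le (M : Matroid α) (x : α) : M.rk {x} ≤ 1 := by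
  simpa using M.rk_le_ncard (finite_singleton x)

lemma rk_pair_le (M : Matroid α) (x y : α) : M.rk {x, y} ≤ 2 :=
  (M.rk_le_ncard (toFinite _)).trans (by
    have := ncard_insert_le x {y}
    rw [ncard_singleton] at this
    exact_mod_cast this)

lemma rk_union_le (M : Matroid α) [M.RankFinite] (X Y : Set α) :
    M.rk (X ∪ Y) ≤ M.rk X + M.rk Y := by
  have := M.rk_submod X Y
  have := M.rk_nonneg (X ∩ Y)
  lia

lemma rk_insert_le (M : Matroid α) [M.RankFinite] (e : α) (X : Set α) :
    M.rk (insert e X) ≤ M.rk X + 1 := by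
  have := M.rk_union_le {e} X
  have := M.rk_singleton_le e
  rw [singleton_union] at *
  lia

lemma le_rk_insert (M : Matroid α) [M.RankFinite] (e : α) (X : Set α) :
    M.rk X ≤ M.rk (insert e X) := M.rk_mono (subset_insert _ _)

lemma rk_diff_singleton_ge (M : Matroid α) [M.RankFinite] (e : α) (X : Set α) :
    M.rk X ≤ M.rk (X \ {e}) + 1 := by
  have h1 := M.rk_insert_le e (X \ {e})
  have h2 := M.rk_mono (X := X) (Y := insert e (X \ {e})) (by
    intro z hz; by_cases h : z = e <;> simp [h, hz])
  lia

/-- If adding `e` to `X` does not raise the rank then neither does adding it to a superset. -/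
lemma rk_insert_eq_of_subset [M.RankFinite] (hXY : X ⊆ Y) (h : M.rk (insert e X) = M.rk X) :
    M.rk (insert e Y) = M.rk Y := by
  have h1 := M.rk_submod (insert e X) Y
  have h2 := M.rk_mono (X := X) (Y := insert e X ∩ Y)
    (subset_inter (subset_insert _ _) hXY)
  have h3 : insert e X ∪ Y = insert e Y := by rw [insert_union, union_eq_self_of_subset_left hXY]
  have h4 := M.le_rk_insert e Y
  rw [h3] at h1
  lia

lemma rk_le_rk_ground (M : Matroid α) [M.RankFinite] (X : Set α) : M.rk X ≤ M.rk M.E := by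
  rw [← rk_inter_ground]; exact M.rk_mono inter_subset_right

lemma rk_restrict (M : Matroid α) (R X : Set α) : (M ↾ R).rk X = M.rk (X ∩ R) := by
  simp [rk, restrict_eRk_eq']

lemma rk_delete (M : Matroid α) (D X : Set α) : (M ＼ D).rk X = M.rk (X \ D) := by
  rw [delete_eq_restrict, rk_restrict, ← rk_inter_ground M (X \ D)]
  congr 1; ext; simp; tauto

lemma rk_dual (M : Matroid α) [M.Finite] (hX : X ⊆ M.E) :
    M✶.rk X = M.rk (M.E \ X) + X.ncard - M.rk M.E := by
  have h := M.eRk_dual_add_eRank X hX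
  rw [← cast_rk, eRank_def, ← cast_rk M M.E, ← cast_rk M (M.E \ X),
    ← (M.ground_finite.subset hX).cast_ncard_eq] at h
  unfold rk
  have h' : (M✶.eRk X).toNat + (M.eRk M.E).toNat = (M.eRk (M.E \ X)).toNat + X.ncard := by
    exact_mod_cast h
  lia

lemma rk_contract (M : Matroid α) [M.Finite] (C X : Set α) :
    (M ／ C).rk X = M.rk (X ∪ C) - M.rk C := by
  wlog hC : C ⊆ M.E generalizing C with H
  · have := H (C ∩ M.E) inter_subset_right
    rw [contract_inter_ground_eq, rk_inter_ground] at this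
    rw [this, ← rk_inter_ground M (X ∪ C), ← rk_inter_ground M (X ∪ C ∩ M.E)]
    congr 2; ext; simp; tauto
  wlog hX : X ⊆ M.E \ C generalizing X with H
  · have := H (X := X ∩ (M.E \ C)) inter_subset_right
    rw [show M.E \ C = (M ／ C).E from rfl, rk_inter_ground, contract_ground] at this
    rw [this, ← rk_inter_ground M (X ∪ C), ← rk_inter_ground M (X ∩ (M.E \ C) ∪ C)]
    congr 2; ext; simp; tauto
  have hXE : X ⊆ M.E := hX.trans sdiff_subset
  have hfin := M.ground_finite
  rw [← dual_delete_dual, rk_dual _ (by simpa using hX), rk_delete, rk_delete]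
  simp only [delete_ground, dual_ground]
  rw [rk_dual _ (by intro z hz; exact hz.1.1.1), rk_dual _ (by intro z hz; exact hz.1.1)]
  have e1 : M.E \ (((M.E \ C) \ X) \ C) = X ∪ C := by
    ext z; have := @hX z; have := @hC z; simp at *; tauto
  have e2 : M.E \ ((M.E \ C) \ C) = C := by
    ext z; have := @hC z; simp at *; tauto
  have e3 : ((M.E \ C) \ X) \ C = (M.E \ C) \ X := by ext; simp; tauto
  have e4 : (M.E \ C) \ C = M.E \ C := by ext; simp
  rw [e1, e2, e3, e4]
  have := ncard_sdiff_add_ncard_of_subset hX (hfin.subset sdiff_subset)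
  lia

lemma indep_iff_rk [M.RankFinite] (hX : X.Finite) : M.Indep X ↔ M.rk X = X.ncard := by
  rw [indep_iff_eRk_eq_encard_of_finite hX, ← hX.cast_ncard_eq, ← cast_rk, rk]
  norm_cast

lemma isBase_iff_rk [M.Finite] :
    M.IsBase X ↔ X ⊆ M.E ∧ M.rk X = X.ncard ∧ M.rk X = M.rk M.E := by
  constructor
  · intro h
    have hf : X.Finite := M.ground_finite.subset h.subset_ground
    refine ⟨h.subset_ground, (indep_iff_rk hf).1 h.indep, ?_⟩
    rw [rk, rk, h.eRk_eq_eRank, eRk_ground]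
  · rintro ⟨h1, h2, h3⟩
    have hf : X.Finite := M.ground_finite.subset h1
    refine ((indep_iff_rk hf).2 h2).isBase_of_eRk_ge hf ?_
    rw [eRank_def, ← cast_rk M M.E, ← cast_rk M X]
    unfold rk at h3
    exact_mod_cast h3.ge

end Matroid

end Rank

/-! ### Connectivity and the removal of single elements -/

section Connectivity

open Set

namespace Matroid

variable {α : Type*} {M : Matroid α} {X Y : Set α} {x y z e : α}

/-- `x` is not a loop. -/
def NonLoop (M : Matroid α) (x : α) : Prop := M.rk {x} = 1

/-- `x` is not a coloop. -/
def NonColoop (M : Matroid α) (x : α) : Prop := M.rk (M.E \ {x}) = M.rk M.E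

/-- `x` and `y` are distinct, neither is a loop, and they are not parallel. -/
def NonParallel (M : Matroid α) (x y : α) : Prop := M.rk {x, y} = 2

/-- The dual condition of `NonParallel` for two distinct elements: neither is a coloop, and they
are not in series. -/
def NonSeries (M : Matroid α) (x y : α) : Prop := M.rk (M.E \ {x, y}) = M.rk M.E

/-- `M` is connected: every proper nonempty part of the ground set has positive connectivity. -/
def Conn (M : Matroid α) : Prop :=
  ∀ X ⊆ M.E, X.Nonempty → (M.E \ X).Nonempty → M.rk M.E + 1 ≤ M.rk X + M.rk (M.E \ X)

/-- `M` is `3`-connected, in terms of ranks. -/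
def Conn3 (M : Matroid α) : Prop :=
  M.Conn ∧ ∀ X ⊆ M.E, 2 ≤ X.ncard → 2 ≤ (M.E \ X).ncard →
    M.rk M.E + 2 ≤ M.rk X + M.rk (M.E \ X)

lemma ncard_ground_diff [M.Finite] (hX : X ⊆ M.E) :
    ((M.E \ X).ncard : ℤ) = M.E.ncard - X.ncard := by
  have := ncard_sdiff_add_ncard_of_subset hX M.ground_finite
  lia

lemma NonParallel.symm (h : M.NonParallel x y) : M.NonParallel y x := by
  rw [NonParallel, pair_comm]; exact h

lemma NonSeries.symm (h : M.NonSeries x y) : M.NonSeries y x := by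
  rw [NonSeries, pair_comm]; exact h

lemma NonParallel.ne (h : M.NonParallel x y) : x ≠ y := by
  rintro rfl
  have := M.rk_singleton_le x
  rw [NonParallel, pair_eq_singleton] at h
  lia

lemma NonParallel.nonLoop_left [M.Finite] (h : M.NonParallel x y) : M.NonLoop x := by
  have h1 := M.rk_insert_le y {x}
  have h2 := M.rk_singleton_le x
  rw [NonParallel, pair_comm] at h
  rw [NonLoop]
  lia

lemma NonSeries.nonColoop_left [M.Finite] (h : M.NonSeries x y) : M.NonColoop x := by
  have h1 : M.rk (M.E \ {x, y}) ≤ M.rk (M.E \ {x}) := M.rk_mono (by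
    apply sdiff_subset_sdiff_right; simp)
  have := M.rk_le_rk_ground (M.E \ {x})
  rw [NonSeries] at h
  rw [NonColoop]; lia

lemma NonLoop.mem (h : M.NonLoop x) : x ∈ M.E := by
  by_contra hx
  rw [NonLoop, ← rk_inter_ground, singleton_inter_eq_empty.2 hx, rk_empty] at h
  simp at h

lemma nonLoop_dual [M.Finite] (hx : x ∈ M.E) : M✶.NonLoop x ↔ M.NonColoop x := by
  rw [NonLoop, rk_dual M (by simpa), NonColoop, ncard_singleton]
  push_cast; lia

lemma nonColoop_dual [M.Finite] (hx : x ∈ M.E) : M✶.NonColoop x ↔ M.NonLoop x := by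
  rw [← nonLoop_dual (M := M✶) hx, dual_dual]

lemma nonParallel_dual [M.Finite] (hx : x ∈ M.E) (hy : y ∈ M.E) (hxy : x ≠ y) :
    M✶.NonParallel x y ↔ M.NonSeries x y := by
  rw [NonParallel, rk_dual M (by simp [pair_subset_iff, *]), NonSeries, ncard_pair hxy]
  push_cast; lia

lemma nonSeries_dual [M.Finite] (hx : x ∈ M.E) (hy : y ∈ M.E) (hxy : x ≠ y) :
    M✶.NonSeries x y ↔ M.NonParallel x y := by
  rw [← nonParallel_dual (M := M✶) hx hy hxy, dual_dual]

lemma rk_deleteElem (hx : x ∉ X) : (M ＼ {x}).rk X = M.rk X := by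
  rw [rk_delete, sdiff_singleton_eq_self hx]

lemma rk_contractElem [M.Finite] : (M ／ {x}).rk X = M.rk (insert x X) - M.rk {x} := by
  rw [rk_contract, union_singleton]

lemma nonLoop_delete (hxy : x ≠ y) : (M ＼ {x}).NonLoop y ↔ M.NonLoop y := by
  rw [NonLoop, rk_deleteElem (by simpa), NonLoop]

lemma nonParallel_delete (hxy : x ≠ y) (hxz : x ≠ z) :
    (M ＼ {x}).NonParallel y z ↔ M.NonParallel y z := by
  rw [NonParallel, rk_deleteElem (by simp [*]), NonParallel]

lemma nonLoop_contract [M.Finite] (hx : M.NonLoop x) :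
    (M ／ {x}).NonLoop y ↔ M.NonParallel x y := by
  rw [NonLoop, rk_contractElem, NonParallel, hx]; lia

lemma nonParallel_contract [M.Finite] (hx : M.NonLoop x) :
    (M ／ {x}).NonParallel y z ↔ M.rk {x, y, z} = 3 := by
  rw [NonParallel, rk_contractElem, hx]; lia

lemma nonColoop_delete (hx : M.NonColoop x) :
    (M ＼ {x}).NonColoop y ↔ M.NonSeries x y := by
  rw [NonColoop, NonSeries, rk_deleteElem (by simp), rk_deleteElem (by simp), delete_ground, hx,
    show (M.E \ {x}) \ {y} = M.E \ {x, y} by ext; simp; tauto]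

lemma nonColoop_contract [M.Finite] (hx : x ∈ M.E) (hxy : x ≠ y) :
    (M ／ {x}).NonColoop y ↔ M.NonColoop y := by
  rw [NonColoop, NonColoop, rk_contractElem, rk_contractElem, contract_ground,
    show insert x ((M.E \ {x}) \ {y}) = M.E \ {y} by
      ext z; by_cases h : z = x <;> simp [h, hx, hxy],
    insert_sdiff_singleton, insert_eq_of_mem hx]
  lia

lemma nonSeries_contract [M.Finite] (hx : x ∈ M.E) (hxy : x ≠ y) (hxz : x ≠ z) :
    (M ／ {x}).NonSeries y z ↔ M.NonSeries y z := by
  rw [NonSeries, NonSeries, rk_contractElem, rk_contractElem, contract_ground,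
    show insert x ((M.E \ {x}) \ {y, z}) = M.E \ {y, z} by
      ext w; by_cases h : w = x <;> simp [h, hx, hxy, hxz],
    insert_sdiff_singleton, insert_eq_of_mem hx]
  lia

lemma NonColoop.rk_delete_ground (hx : M.NonColoop x) :
    (M ＼ {x}).rk (M ＼ {x}).E = M.rk M.E := by
  rw [delete_ground, rk_deleteElem (by simp), hx]

lemma NonLoop.rk_contract_ground [M.Finite] (hx : M.NonLoop x) :
    (M ／ {x}).rk (M ／ {x}).E = M.rk M.E - 1 := by
  rw [contract_ground, rk_contractElem, insert_sdiff_singleton, insert_eq_of_mem hx.mem, hx]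

lemma Conn.dual [M.Finite] (h : M.Conn) : M✶.Conn := by
  intro X hX h1 h2
  have hX' : X ⊆ M.E := hX
  have := h X hX' h1 h2
  rw [rk_dual M hX', dual_ground, rk_dual M sdiff_subset, rk_dual M subset_rfl]
  rw [sdiff_sdiff_cancel_left hX', sdiff_self, rk_empty, ncard_ground_diff hX']
  lia

lemma conn_dual [M.Finite] : M✶.Conn ↔ M.Conn :=
  ⟨fun h => by simpa using h.dual, fun h => h.dual⟩

lemma Conn3.dual [M.Finite] (h : M.Conn3) : M✶.Conn3 := by
  refine ⟨h.1.dual, fun X hX h1 h2 => ?_⟩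
  have hX' : X ⊆ M.E := hX
  have := h.2 X hX' h1 h2
  rw [rk_dual M hX', dual_ground, rk_dual M sdiff_subset, rk_dual M subset_rfl]
  rw [sdiff_sdiff_cancel_left hX', sdiff_self, rk_empty, ncard_ground_diff hX']
  lia

lemma conn3_dual [M.Finite] : M✶.Conn3 ↔ M.Conn3 :=
  ⟨fun h => by simpa using h.dual, fun h => h.dual⟩

lemma Conn.nonLoop [M.Finite] (h : M.Conn) (hx : x ∈ M.E) (h2 : (M.E \ {x}).Nonempty) :
    M.NonLoop x := by
  have := h {x} (by simpa) (by simp) h2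
  have := M.rk_singleton_le x
  have := M.rk_le_rk_ground (M.E \ {x})
  rw [NonLoop]; lia

lemma Conn.nonColoop [M.Finite] (h : M.Conn) (hx : x ∈ M.E) (h2 : (M.E \ {x}).Nonempty) :
    M.NonColoop x :=
  (nonLoop_dual hx).1 (h.dual.nonLoop hx h2)

/-- Tutte: an element of a connected matroid can be deleted or contracted without losing
connectivity. -/
lemma Conn.delete_or_contract [M.Finite] (h : M.Conn) (hx : x ∈ M.E) :
    (M ＼ {x}).Conn ∨ (M ／ {x}).Conn := by
  by_contra! hcon
  obtain ⟨h1, h2⟩ := hcon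
  unfold Conn at h1 h2
  push Not at h1 h2
  obtain ⟨A, hA, hAn, hAn', hA'⟩ := h1
  obtain ⟨B, hB, hBn, hBn', hB'⟩ := h2
  simp only [delete_ground, contract_ground] at *
  have hxA : x ∉ A := fun h => (hA h).2 rfl
  have hxB : x ∉ B := fun h => (hB h).2 rfl
  rw [rk_deleteElem hxA, rk_deleteElem (by simp), rk_deleteElem (by simp)] at hA'
  rw [rk_contractElem, rk_contractElem, rk_contractElem, insert_sdiff_singleton,
    insert_eq_of_mem hx] at hB'
  have hle := M.rk_le_rk_ground (M.E \ {x})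
  have hs := M.rk_singleton_le x
  set A' := (M.E \ {x}) \ A with hAdef
  set B' := (M.E \ {x}) \ B with hBdef
  have key : ∀ P Q P' Q' : Set α, P ∪ P' = M.E \ {x} → Disjoint P P' → Q ∪ Q' = M.E \ {x} →
      Disjoint Q Q' → M.rk P + M.rk P' ≤ M.rk M.E →
      M.rk (insert x Q) + M.rk (insert x Q') ≤ M.rk M.E + 1 →
      P ∩ Q = ∅ ∨ P' ∩ Q' = ∅ := by
    intro P Q P' Q' hP hPd hQ hQd hr hr'
    by_contra! hne
    have hxP : x ∉ P := fun h => (hP.subset (Or.inl h)).2 rfl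
    have hxP' : x ∉ P' := fun h => (hP.subset (Or.inr h)).2 rfl
    have hxQ : x ∉ Q := fun h => (hQ.subset (Or.inl h)).2 rfl
    have hxQ' : x ∉ Q' := fun h => (hQ.subset (Or.inr h)).2 rfl
    have e1 : M.E \ (P ∩ Q) = P' ∪ insert x Q' := by
      ext z
      have := Set.ext_iff.1 hP z; have := Set.ext_iff.1 hQ z
      have := fun h : z ∈ P => disjoint_left.1 hPd h; have := fun h : z ∈ Q => disjoint_left.1 hQd h
      by_cases hz : z = x
      · subst hz; simp [hx, hxP]
      · simp [hz] at *; tauto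
    have e2 : M.E \ (P' ∩ Q') = P ∪ insert x Q := by
      ext z
      have := Set.ext_iff.1 hP z; have := Set.ext_iff.1 hQ z
      have := fun h : z ∈ P => disjoint_left.1 hPd h; have := fun h : z ∈ Q => disjoint_left.1 hQd h
      by_cases hz : z = x
      · subst hz; simp [hx, hxP']
      · simp [hz] at *; tauto
    have hPE : P ⊆ M.E := (subset_union_left.trans hP.subset).trans sdiff_subset
    have hPE' : P' ⊆ M.E := (subset_union_right.trans hP.subset).trans sdiff_subset
    have f1 := h (P ∩ Q) (inter_subset_left.trans hPE) hne.1 (by rw [e1]; simp)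
    have f2 := h (P' ∩ Q') (inter_subset_left.trans hPE') hne.2 (by rw [e2]; simp)
    rw [e1] at f1
    rw [e2] at f2
    have g1 := M.rk_submod P (insert x Q)
    have g2 := M.rk_submod P' (insert x Q')
    have g3 : M.rk (P ∩ Q) ≤ M.rk (P ∩ insert x Q) := M.rk_mono (by gcongr; simp)
    have g4 : M.rk (P' ∩ Q') ≤ M.rk (P' ∩ insert x Q') := M.rk_mono (by gcongr; simp)
    lia
  have uA : A ∪ A' = M.E \ {x} := union_sdiff_cancel hA
  have uB : B ∪ B' = M.E \ {x} := union_sdiff_cancel hB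
  have k1 := key A B A' B' uA disjoint_sdiff_right uB disjoint_sdiff_right
    (by lia) (by lia)
  have k2 := key A B' A' B uA disjoint_sdiff_right (by rw [union_comm, uB])
    disjoint_sdiff_right.symm (by lia) (by lia)
  simp only [Set.ext_iff, mem_inter_iff, mem_empty_iff_false, iff_false, not_and] at k1 k2
  obtain ⟨a, ha⟩ := hAn
  obtain ⟨a', ha'⟩ := hAn'
  obtain ⟨b, hb⟩ := hBn
  obtain ⟨b', hb'⟩ := hBn'
  have m1 : ∀ z ∈ M.E \ {x}, z ∈ A ∨ z ∈ A' := fun z hz => uA.symm.subset hz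
  have m2 : ∀ z ∈ M.E \ {x}, z ∈ B ∨ z ∈ B' := fun z hz => uB.symm.subset hz
  have := m2 a (hA ha)
  have := m2 a' ha'.1
  have := m1 b (hB hb)
  have := m1 b' hb'.1
  rcases k1 with k1 | k1 <;> rcases k2 with k2 | k2 <;> grind

lemma Conn.of_delete [M.Finite] (h : (M ＼ {x}).Conn) (hx : M.NonLoop x) (hx' : M.NonColoop x) :
    M.Conn := by
  have key : ∀ X ⊆ M.E, x ∈ X → (M.E \ X).Nonempty →
      M.rk M.E + 1 ≤ M.rk X + M.rk (M.E \ X) := by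
    intro X hX hxX hne
    have e1 : (M.E \ {x}) \ (X \ {x}) = M.E \ X := by
      ext z; by_cases hz : z = x
      · subst hz; simp [hxX]
      · simp [hz]
    rcases eq_empty_or_nonempty (X \ {x}) with h0 | h0
    · have : X = {x} := by
        ext z; have := Set.ext_iff.1 h0 z; simp at this ⊢
        exact ⟨this, fun h => h ▸ hxX⟩
      subst this
      rw [hx, hx']; lia
    · have := h (X \ {x}) (by rw [delete_ground]; gcongr) h0 (by rwa [delete_ground, e1])
      rw [delete_ground, e1, rk_deleteElem (by simp), rk_deleteElem (by simp),
        rk_deleteElem (by simp [hxX]), hx'] at this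
      have := M.rk_mono (X := X \ {x}) (Y := X) sdiff_subset
      lia
  intro X hX h1 h2
  by_cases hxX : x ∈ X
  · exact key X hX hxX h2
  · have := key (M.E \ X) sdiff_subset ⟨hx.mem, hxX⟩ (by rwa [sdiff_sdiff_cancel_left hX])
    rw [sdiff_sdiff_cancel_left hX] at this
    lia

lemma Conn.of_contract [M.Finite] (h : (M ／ {x}).Conn) (hx : M.NonLoop x)
    (hx' : M.NonColoop x) : M.Conn := by
  rw [← conn_dual] at h ⊢
  rw [dual_contract] at h
  exact h.of_delete ((nonLoop_dual hx.mem).2 hx') ((nonColoop_dual hx.mem).2 hx)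

lemma Conn.delete_of_parallel [M.Finite] (h : M.Conn) (hx : M.NonLoop x) (hy : M.NonLoop y)
    (hxy : x ≠ y) (hp : ¬ M.NonParallel x y) : (M ＼ {x}).Conn := by
  have hp2 : M.rk (insert x {y}) = M.rk {y} := by
    have := M.rk_insert_le x {y}
    have := M.le_rk_insert x {y}
    rw [NonParallel] at hp
    rw [NonLoop] at hy
    lia
  have key : ∀ X ⊆ M.E \ {x}, y ∈ X → ((M.E \ {x}) \ X).Nonempty →
      M.rk M.E + 1 ≤ M.rk X + M.rk ((M.E \ {x}) \ X) := by
    intro X hX hyX h2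
    have hX' := hX.trans sdiff_subset
    have e : M.E \ insert x X = (M.E \ {x}) \ X := by ext; simp; tauto
    have := h (insert x X) (insert_subset hx.mem hX') (by simp) (by rwa [e])
    rwa [e, rk_insert_eq_of_subset (by simpa) hp2] at this
  have hE := M.rk_le_rk_ground (M.E \ {x})
  intro X hX h1 h2
  rw [delete_ground] at *
  rw [rk_deleteElem (by simp), rk_deleteElem (fun h => (hX h).2 rfl), rk_deleteElem (by simp)]
  by_cases hyX : y ∈ X
  · have := key X hX hyX h2
    lia
  · have := key ((M.E \ {x}) \ X) sdiff_subset ⟨⟨hy.mem, by simpa using hxy.symm⟩, hyX⟩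
      (by rwa [sdiff_sdiff_cancel_left hX])
    rw [sdiff_sdiff_cancel_left hX] at this
    lia

lemma Conn.contract_of_series [M.Finite] (h : M.Conn) (hx : M.NonColoop x) (hy : M.NonColoop y)
    (hxE : x ∈ M.E) (hyE : y ∈ M.E) (hxy : x ≠ y) (hp : ¬ M.NonSeries x y) :
    (M ／ {x}).Conn := by
  rw [← conn_dual, dual_contract]
  exact h.dual.delete_of_parallel ((nonLoop_dual hxE).2 hx) ((nonLoop_dual hyE).2 hy) hxy
    (by rwa [nonParallel_dual hxE hyE hxy])

section ThreeConnected

lemma Conn3.nonParallel [M.Finite] (h : M.Conn3) (h4 : 4 ≤ M.E.ncard) (hx : x ∈ M.E)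
    (hy : y ∈ M.E) (hxy : x ≠ y) : M.NonParallel x y := by
  have hs : ({x, y} : Set α) ⊆ M.E := by simp [pair_subset_iff, *]
  have hc := ncard_ground_diff hs
  rw [ncard_pair hxy] at hc
  have := h.2 {x, y} hs (by rw [ncard_pair hxy]) (by lia)
  have := M.rk_pair_le x y
  have := M.rk_le_rk_ground (M.E \ {x, y})
  rw [NonParallel]; lia

lemma Conn3.nonSeries [M.Finite] (h : M.Conn3) (h4 : 4 ≤ M.E.ncard) (hx : x ∈ M.E)
    (hy : y ∈ M.E) (hxy : x ≠ y) : M.NonSeries x y :=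
  (nonParallel_dual hx hy hxy).1 (h.dual.nonParallel h4 hx hy hxy)

lemma Conn3.diff_nonempty [M.Finite] (h4 : 4 ≤ M.E.ncard) : (M.E \ {x}).Nonempty := by
  rw [nonempty_iff_ne_empty]
  intro h0
  have : M.E ⊆ {x} := by rwa [← sdiff_eq_empty]
  have := ncard_le_ncard this
  simp at this
  lia

lemma Conn3.nonLoop [M.Finite] (h : M.Conn3) (h4 : 4 ≤ M.E.ncard) (hx : x ∈ M.E) :
    M.NonLoop x := h.1.nonLoop hx (Conn3.diff_nonempty h4)

lemma Conn3.nonColoop [M.Finite] (h : M.Conn3) (h4 : 4 ≤ M.E.ncard) (hx : x ∈ M.E) :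
    M.NonColoop x := h.1.nonColoop hx (Conn3.diff_nonempty h4)

lemma Conn3.conn_delete [M.Finite] (h : M.Conn3) (h4 : 4 ≤ M.E.ncard) (hx : x ∈ M.E) :
    (M ＼ {x}).Conn := by
  have key : ∀ X ⊆ M.E \ {x}, 2 ≤ X.ncard → ((M.E \ {x}) \ X).Nonempty →
      M.rk M.E + 1 ≤ M.rk X + M.rk ((M.E \ {x}) \ X) := by
    intro X hX h1 h2
    have hX' := hX.trans sdiff_subset
    have e : M.E \ X = insert x ((M.E \ {x}) \ X) := by
      ext z; by_cases hz : z = x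
      · subst hz; simp [hx]; intro h; exact (hX h).2 rfl
      · simp [hz]
    have hpos := (ncard_pos (M.ground_finite.subset (sdiff_subset.trans sdiff_subset))).2 h2
    have := h.2 X hX' h1 (by
      rw [e, ncard_insert_of_notMem (by simp)
        (M.ground_finite.subset (sdiff_subset.trans sdiff_subset))]; lia)
    rw [e] at this
    have := M.rk_insert_le x ((M.E \ {x}) \ X)
    lia
  have hE := M.rk_le_rk_ground (M.E \ {x})
  intro X hX h1 h2
  rw [delete_ground] at *
  rw [rk_deleteElem (by simp), rk_deleteElem (fun h => (hX h).2 rfl), rk_deleteElem (by simp)]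
  by_cases hc : 2 ≤ X.ncard
  · have := key X hX hc h2
    lia
  · have c1 := ncard_sdiff_add_ncard_of_subset hX (M.ground_finite.subset sdiff_subset)
    have c2 := ncard_ground_diff (M := M) (X := {x}) (by simpa)
    rw [ncard_singleton] at c2
    have := key ((M.E \ {x}) \ X) sdiff_subset (by lia)
      (by rwa [sdiff_sdiff_cancel_left hX])
    rw [sdiff_sdiff_cancel_left hX] at this
    lia

lemma Conn3.conn_contract [M.Finite] (h : M.Conn3) (h4 : 4 ≤ M.E.ncard) (hx : x ∈ M.E) :
    (M ／ {x}).Conn := by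
  rw [← conn_dual, dual_contract]; exact h.dual.conn_delete h4 hx

/-- A one-element extension of a `3`-connected matroid is `3`-connected unless the new element is a
loop, a coloop or parallel to another element. -/
lemma Conn3.of_delete [M.Finite] (h : (M ＼ {x}).Conn3) (h4 : 4 ≤ (M ＼ {x}).E.ncard)
    (hx : M.NonLoop x) (hx' : M.NonColoop x) (hp : ∀ y ∈ M.E, y ≠ x → M.NonParallel x y) :
    M.Conn3 := by
  refine ⟨h.1.of_delete hx hx', ?_⟩
  have key : ∀ X ⊆ M.E, x ∈ X → 2 ≤ X.ncard → 2 ≤ (M.E \ X).ncard →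
      M.rk M.E + 2 ≤ M.rk X + M.rk (M.E \ X) := by
    intro X hX hxX h1 h2
    have e1 : (M.E \ {x}) \ (X \ {x}) = M.E \ X := by
      ext z; by_cases hz : z = x
      · subst hz; simp [hxX]
      · simp [hz]
    have hc := ncard_sdiff_singleton_add_one hxX (M.ground_finite.subset hX)
    rcases h1.eq_or_lt with h0 | h0
    · obtain ⟨y, hy⟩ := ncard_eq_one.1 (show (X \ {x}).ncard = 1 by lia)
      have hyx : y ∈ X \ {x} := hy ▸ rfl
      have hXe : X = {x, y} := by
        rw [← insert_eq_of_mem hxX, ← insert_sdiff_singleton, hy]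
      have hyx' : y ≠ x := hyx.2
      have p := hp y (hX hyx.1) hyx'
      have s := h.nonColoop h4 (x := y) ⟨hX hyx.1, hyx'⟩
      rw [nonColoop_delete hx'] at s
      rw [NonParallel] at p
      rw [NonSeries] at s
      rw [hXe, p, s]
      lia
    · have := h.2 (X \ {x}) (by rw [delete_ground]; gcongr) (by lia) (by rwa [delete_ground, e1])
      rw [delete_ground, e1, rk_deleteElem (by simp), rk_deleteElem (by simp),
        rk_deleteElem (by simp [hxX]), hx'] at this
      have := M.rk_mono (X := X \ {x}) (Y := X) sdiff_subset
      lia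
  intro X hX h1 h2
  by_cases hxX : x ∈ X
  · exact key X hX hxX h1 h2
  · have := key (M.E \ X) sdiff_subset ⟨hx.mem, hxX⟩ h2 (by rwa [sdiff_sdiff_cancel_left hX])
    rw [sdiff_sdiff_cancel_left hX] at this
    lia

lemma Conn3.of_contract [M.Finite] (h : (M ／ {x}).Conn3) (h4 : 4 ≤ (M ／ {x}).E.ncard)
    (hx : M.NonLoop x) (hx' : M.NonColoop x) (hp : ∀ y ∈ M.E, y ≠ x → M.NonSeries x y) :
    M.Conn3 := by
  rw [← conn3_dual] at h ⊢
  rw [dual_contract] at h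
  exact h.of_delete h4 ((nonLoop_dual hx.mem).2 hx') ((nonColoop_dual hx.mem).2 hx)
    fun y hy hyx => (nonParallel_dual hx.mem hy hyx.symm).2 (hp y hy hyx)

end ThreeConnected

end Matroid

end Connectivity

/-! ### Weighted matroids and scalings -/

section Weights

open Set

namespace Matroid

variable {α : Type*} {M : Matroid α} {B : Set α} {x : α}

lemma isBase_delete_iff [M.Finite] (hx : M.NonColoop x) :
    (M ＼ {x}).IsBase B ↔ M.IsBase B ∧ x ∉ B := by
  rw [isBase_iff_rk, isBase_iff_rk, hx.rk_delete_ground, delete_ground, subset_sdiff,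
    disjoint_singleton_right]
  constructor
  · rintro ⟨⟨h1, h2⟩, h3, h4⟩
    rw [rk_deleteElem h2] at h3 h4
    exact ⟨⟨h1, h3, h4⟩, h2⟩
  · rintro ⟨⟨h1, h3, h4⟩, h2⟩
    rw [rk_deleteElem h2]
    exact ⟨⟨h1, h2⟩, h3, h4⟩

lemma isBase_contract_iff [M.Finite] (hx : M.NonLoop x) :
    (M ／ {x}).IsBase B ↔ M.IsBase (insert x B) ∧ x ∉ B := by
  rw [isBase_iff_rk, isBase_iff_rk, hx.rk_contract_ground, contract_ground,
    subset_sdiff, disjoint_singleton_right, insert_subset_iff, rk_contractElem, hx]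
  constructor
  · rintro ⟨⟨h1, h2⟩, h3, h4⟩
    rw [ncard_insert_of_notMem h2 (M.ground_finite.subset h1)]
    push_cast
    exact ⟨⟨⟨hx.mem, h1⟩, by lia, by lia⟩, h2⟩
  · rintro ⟨⟨⟨h0, h1⟩, h3, h4⟩, h2⟩
    rw [ncard_insert_of_notMem h2 (M.ground_finite.subset h1)] at h3
    push_cast at h3
    exact ⟨⟨h1, h2⟩, by lia, by lia⟩

/-- In a connected matroid any function that takes equal values on two elements whenever some basis
exchange swaps them is constant. -/
lemma Conn.const_of_exchange [M.Finite] {G : Type*} [Nonempty G] (h : M.Conn) (u : α → G)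
    (hu : ∀ S a b, a ∉ S → b ∉ S → M.IsBase (insert a S) → M.IsBase (insert b S) → u a = u b) :
    ∃ k, ∀ e ∈ M.E, u e = k := by
  rcases M.E.eq_empty_or_nonempty with h0 | ⟨e₀, he₀⟩
  · exact ⟨Classical.arbitrary G, by simp [h0]⟩
  refine ⟨u e₀, ?_⟩
  by_contra! hne
  obtain ⟨f₀, hf₀, hfu⟩ := hne
  set A := {e ∈ M.E | u e = u e₀} with hA
  have hAE : A ⊆ M.E := fun e he => he.1
  have hr := h A hAE ⟨e₀, he₀, rfl⟩ ⟨f₀, hf₀, fun hf => hfu hf.2⟩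
  obtain ⟨I, hI⟩ := M.exists_isBasis A
  obtain ⟨J, hJ⟩ := M.exists_isBasis (M.E \ A)
  obtain ⟨B, hB, hIB⟩ := hI.indep.exists_isBase_superset
  have hBf : B.Finite := M.ground_finite.subset hB.subset_ground
  have hJf : J.Finite := M.ground_finite.subset hJ.indep.subset_ground
  have hIc : M.rk A = I.ncard := by rw [rk, ← hI.encard_eq_eRk]; rfl
  have hJc : M.rk (M.E \ A) = J.ncard := by rw [rk, ← hJ.encard_eq_eRk]; rfl
  have hBc := (isBase_iff_rk.1 hB).2
  have hBA : (B \ A).encard < J.encard := by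
    rw [← hJf.cast_ncard_eq, ← (hBf.subset sdiff_subset).cast_ncard_eq]
    have c1 := ncard_le_ncard (subset_inter hIB hI.subset) (hBf.subset inter_subset_left)
    have c2 := ncard_inter_add_ncard_sdiff_eq_ncard B A hBf
    norm_cast; lia
  obtain ⟨f, hf, hfi⟩ := (hB.indep.subset sdiff_subset).exists_insert_of_encard_lt hJ.indep hBA
  obtain ⟨B', hB', hsub, hsub'⟩ := hfi.exists_isBase_subset_union_isBase hB
  have hfA : f ∈ M.E \ A := hJ.subset hf.1
  have hfB : f ∉ B := fun h => hf.2 ⟨h, hfA.2⟩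
  have hfB' : f ∈ B' := hsub (mem_insert _ _)
  obtain ⟨e, heB, heB'⟩ : (B \ B').Nonempty := by
    rw [nonempty_iff_ne_empty, Ne, sdiff_eq_empty]
    intro hss
    exact hfB (hB.eq_of_subset_isBase hB' hss ▸ hfB')
  have heA : e ∈ A := by
    by_contra h
    exact heB' (hsub (mem_insert_of_mem _ ⟨heB, h⟩))
  have hss : B' ⊆ insert f (B \ {e}) := by
    intro z hz
    have := hsub' hz
    by_cases hzf : z = f
    · simp [hzf]
    · have hze : z ≠ e := fun h => heB' (h ▸ hz)
      simp [hzf, hze] at this ⊢; tauto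
  have heq : B' = insert f (B \ {e}) := by
    refine eq_of_subset_of_ncard_le hss ?_ ((hBf.subset sdiff_subset).insert _)
    rw [ncard_insert_of_notMem (fun h => hfB h.1) (hBf.subset sdiff_subset),
      ncard_sdiff_singleton_add_one heB hBf]
    have := (isBase_iff_rk.1 hB').2
    lia
  have hins : insert e (B \ {e}) = B := by rw [insert_sdiff_singleton, insert_eq_of_mem heB]
  have := hu (B \ {e}) e f (by simp) (fun h => hfB h.1) (by rwa [hins]) (heq ▸ hB')
  exact hfA.2 ⟨hfA.1, this ▸ heA.2⟩

end Matroid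

open Matroid

/-- A finite matroid whose bases carry weights in a commutative group. The weights satisfy the
condition that three-term Grassmann–Plücker relations impose on the quotient of the maximal minors
of two representations of the same matroid: of the three products of complementary pairs, two that
are the only nonzero ones have equal weights, and two equal weights force the third to be equal.
Sets that are not bases have weight `1`, so that a weighted matroid is determined by its matroid
and the weights of its bases. -/
structure WeightedMatroid (α G : Type*) [CommGroup G] where
  /-- the underlying matroid -/
  M : Matroid α
  finite : M.Finite
  /-- the weight of a set; only its values at bases matter -/
  wt : Set α → G
  wt_off : ∀ B, ¬ M.IsBase B → wt B = 1
  exchange : ∀ (S : Set α) (a b c d : α), a ∉ S → b ∉ S → c ∉ S → d ∉ S →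
    a ≠ b → a ≠ c → a ≠ d → b ≠ c → b ≠ d → c ≠ d →
    M.IsBase (insert a (insert b S)) → M.IsBase (insert c (insert d S)) →
    M.IsBase (insert a (insert d S)) → M.IsBase (insert b (insert c S)) →
    (M.IsBase (insert a (insert c S)) → M.IsBase (insert b (insert d S)) →
      wt (insert a (insert c S)) * wt (insert b (insert d S)) =
        wt (insert a (insert b S)) * wt (insert c (insert d S))) →
    wt (insert a (insert b S)) * wt (insert c (insert d S)) =
      wt (insert a (insert d S)) * wt (insert b (insert c S))

namespace WeightedMatroid

variable {α G : Type*} [CommGroup G] {Q : WeightedMatroid α G} {x y : α}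

instance (Q : WeightedMatroid α G) : Q.M.Finite := Q.finite

lemma ext_base {Q Q' : WeightedMatroid α G} (hM : Q.M = Q'.M)
    (h : ∀ B, Q.M.IsBase B → Q.wt B = Q'.wt B) : Q = Q' := by
  obtain ⟨M, _, w, hw, _⟩ := Q
  obtain ⟨M', _, w', hw', _⟩ := Q'
  obtain rfl : M = M' := hM
  obtain rfl : w = w' := by
    funext B
    by_cases hB : M.IsBase B
    · exact h B hB
    · rw [hw B hB, hw' B hB]
  rfl

open Classical in
/-- Deletion of an element that is not a coloop (for a coloop the weights are irrelevant). -/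
noncomputable def del (Q : WeightedMatroid α G) (x : α) : WeightedMatroid α G where
  M := Q.M ＼ {x}
  finite := inferInstance
  wt B := if (Q.M ＼ {x}).IsBase B then Q.wt B else 1
  wt_off B hB := if_neg hB
  exchange := by
    intro S a b c d ha hb hc hd hab hac had hbc hbd hcd h1 h2 h3 h4 h5
    rw [if_pos h1, if_pos h2, if_pos h3, if_pos h4]
    by_cases hx : Q.M.NonColoop x
    · rw [isBase_delete_iff hx] at h1 h2 h3 h4
      simp only [mem_insert_iff, not_or] at h1 h2 h3 h4
      refine Q.exchange S a b c d ha hb hc hd hab hac had hbc hbd hcd h1.1 h2.1 h3.1 h4.1 ?_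
      intro h6 h7
      have h6' : (Q.M ＼ {x}).IsBase (insert a (insert c S)) :=
        (isBase_delete_iff hx).2 ⟨h6, by simp [*]⟩
      have h7' : (Q.M ＼ {x}).IsBase (insert b (insert d S)) :=
        (isBase_delete_iff hx).2 ⟨h7, by simp [*]⟩
      have := h5 h6' h7'
      rwa [if_pos h6', if_pos h7', if_pos, if_pos] at this
      · exact (isBase_delete_iff hx).2 ⟨h2.1, by simp [*]⟩
      · exact (isBase_delete_iff hx).2 ⟨h1.1, by simp [*]⟩
    · have key : ∀ B, (Q.M ＼ {x}).IsBase B → Q.wt B = 1 := by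
        intro B hB
        refine Q.wt_off B fun hB' => hx ?_
        rw [isBase_iff_rk] at hB hB'
        rw [NonColoop, ← hB'.2.2]
        have h8 : x ∉ B := fun h => (hB.1 h).2 rfl
        have := hB.2.2
        rw [rk_deleteElem h8, delete_ground, rk_deleteElem (by simp)] at this
        exact this.symm
      rw [key _ h1, key _ h2, key _ h3, key _ h4]

/-- The dual matroid; the weight of a cobasis is the weight of the complementary basis. -/
noncomputable def dual (Q : WeightedMatroid α G) : WeightedMatroid α G where
  M := Q.M✶
  finite := inferInstance
  wt B := open Classical in if Q.M✶.IsBase B then Q.wt (Q.M.E \ B) else 1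
  wt_off B hB := if_neg hB
  exchange := by
    intro S a b c d ha hb hc hd hab hac had hbc hbd hcd h1 h2 h3 h4 h5
    have haE : a ∈ Q.M.E := h1.subset_ground (by simp)
    have hbE : b ∈ Q.M.E := h1.subset_ground (by simp)
    have hcE : c ∈ Q.M.E := h2.subset_ground (by simp)
    have hdE : d ∈ Q.M.E := h2.subset_ground (by simp)
    set S' := Q.M.E \ (insert a (insert b (insert c (insert d S)))) with hS'
    have c1 : Q.M.E \ insert a (insert b S) = insert c (insert d S') := by
      ext z; simp only [mem_sdiff, mem_insert_iff, hS']
      grind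
    have c2 : Q.M.E \ insert c (insert d S) = insert a (insert b S') := by
      ext z; simp only [mem_sdiff, mem_insert_iff, hS']
      grind
    have c3 : Q.M.E \ insert a (insert d S) = insert b (insert c S') := by
      ext z; simp only [mem_sdiff, mem_insert_iff, hS']
      grind
    have c4 : Q.M.E \ insert b (insert c S) = insert a (insert d S') := by
      ext z; simp only [mem_sdiff, mem_insert_iff, hS']
      grind
    have c5 : Q.M.E \ insert a (insert c S) = insert b (insert d S') := by
      ext z; simp only [mem_sdiff, mem_insert_iff, hS']
      grind
    have c6 : Q.M.E \ insert b (insert d S) = insert a (insert c S') := by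
      ext z; simp only [mem_sdiff, mem_insert_iff, hS']
      grind
    rw [if_pos h1, if_pos h2, if_pos h3, if_pos h4, c1, c2, c3, c4]
    rw [if_pos h1, if_pos h2, c1, c2, c5, c6] at h5
    have hSE := (subset_insert b S).trans ((subset_insert a _).trans h1.subset_ground)
    have g : ∀ u v, u ∈ Q.M.E → v ∈ Q.M.E → (Q.M✶.IsBase (insert u (insert v S)) ↔
        Q.M.IsBase (Q.M.E \ (insert u (insert v S)))) := fun u v hu hv =>
      dual_isBase_iff (insert_subset hu (insert_subset hv hSE))
    rw [g a b haE hbE, c1] at h1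
    rw [g c d hcE hdE, c2] at h2
    rw [g a d haE hdE, c3] at h3
    rw [g b c hbE hcE, c4] at h4
    rw [g a c haE hcE, g b d hbE hdE, c5, c6] at h5
    have hS'a : ∀ z, z = a ∨ z = b ∨ z = c ∨ z = d → z ∉ S' := by
      intro z hz; simp [hS']; tauto
    have := Q.exchange S' a b c d (hS'a _ (by simp)) (hS'a _ (by simp)) (hS'a _ (by simp))
      (hS'a _ (by simp)) hab hac had hbc hbd hcd h2 h1 h4 h3 (fun h6 h7 => by
        have := h5 h7 h6
        rw [if_pos h7, if_pos h6] at this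
        rw [mul_comm, this, mul_comm])
    rw [mul_comm, this, mul_comm]

lemma dual_wt (Q : WeightedMatroid α G) {B : Set α} (hB : Q.M✶.IsBase B) :
    Q.dual.wt B = Q.wt (Q.M.E \ B) := if_pos hB

/-- Contraction of an element that is not a loop (for a loop the weights are irrelevant). -/
noncomputable def con (Q : WeightedMatroid α G) (x : α) : WeightedMatroid α G :=
  (Q.dual.del x).dual

@[simp] lemma dual_M (Q : WeightedMatroid α G) : Q.dual.M = Q.M✶ := rfl

@[simp] lemma del_M (Q : WeightedMatroid α G) (x : α) : (Q.del x).M = Q.M ＼ {x} := rfl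

@[simp] lemma con_M (Q : WeightedMatroid α G) (x : α) : (Q.con x).M = Q.M ／ {x} := rfl

@[simp] lemma dual_dual (Q : WeightedMatroid α G) : Q.dual.dual = Q := by
  refine ext_base (by simp) fun B hB => ?_
  have hB' : Q.M.IsBase B := by simpa using hB
  rw [dual_wt _ hB, dual_wt _ (by simpa using hB'.compl_isBase_dual)]
  simp [sdiff_sdiff_cancel_left hB'.subset_ground]

lemma del_wt (hx : Q.M.NonColoop x) {B : Set α} (hB : Q.M.IsBase B) (hxB : x ∉ B) :
    (Q.del x).wt B = Q.wt B := if_pos ((isBase_delete_iff hx).2 ⟨hB, hxB⟩)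

lemma con_wt (hx : Q.M.NonLoop x) {B : Set α} (hB : Q.M.IsBase (insert x B)) (hxB : x ∉ B) :
    (Q.con x).wt B = Q.wt (insert x B) := by
  have h1 : (Q.M ／ {x}).IsBase B := (isBase_contract_iff hx).2 ⟨hB, hxB⟩
  have hBE : B ⊆ Q.M.E := (subset_insert _ _).trans hB.subset_ground
  have h1' : (Q.dual.del x).M✶.IsBase B := by
    rw [del_M, dual_M, dual_delete_dual]; exact h1
  have hE : (Q.dual.del x).M.E = Q.M.E \ {x} := rfl
  rw [con, dual_wt _ h1', hE]
  have e : Q.M.E \ ((Q.M.E \ {x}) \ B) = insert x B := by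
    ext z
    have := @hBE z
    by_cases hz : z = x
    · subst hz; simp [hx.mem]
    · simp [hz]; tauto
  have h2 : Q.dual.M.IsBase ((Q.M.E \ {x}) \ B) := by
    rw [dual_M, dual_isBase_iff (sdiff_subset.trans sdiff_subset), e]; exact hB
  have hx2 : Q.dual.M.NonColoop x := (nonColoop_dual hx.mem).2 hx
  rw [del_wt hx2 h2 (by simp), dual_wt _ h2, e]

@[simp] lemma dual_del (Q : WeightedMatroid α G) (x : α) : (Q.del x).dual = Q.dual.con x := by
  rw [con, dual_dual]

@[simp] lemma dual_con (Q : WeightedMatroid α G) (x : α) : (Q.con x).dual = Q.dual.del x := by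
  rw [con, dual_dual]

/-- `t` scales the elements in a way that explains all weights: along each basis exchange the
quotient of the weights is the quotient of the values of `t`. -/
def IsScaling (Q : WeightedMatroid α G) (t : α → G) : Prop :=
  ∀ S a b, a ∉ S → b ∉ S → Q.M.IsBase (insert a S) → Q.M.IsBase (insert b S) →
    Q.wt (insert a S) * t b = Q.wt (insert b S) * t a

/-- A weighted matroid is good if its weights come from a scaling of the elements. For the quotients
of the minors of two representations this says that the representations are scaling equivalent. -/
def Good (Q : WeightedMatroid α G) : Prop := ∃ t, Q.IsScaling t

lemma Good.dual (h : Q.Good) : Q.dual.Good := by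
  obtain ⟨t, ht⟩ := h
  refine ⟨fun e => (t e)⁻¹, fun S a b ha hb h1 h2 => ?_⟩
  by_cases hab : a = b
  · rw [hab]
  rw [dual_wt _ h1, dual_wt _ h2]
  have haE : a ∈ Q.M.E := h1.subset_ground (by simp)
  have hbE : b ∈ Q.M.E := h2.subset_ground (by simp)
  have hSE := (subset_insert a S).trans h1.subset_ground
  rw [dual_M] at h1 h2
  rw [dual_isBase_iff (insert_subset haE hSE)] at h1
  rw [dual_isBase_iff (insert_subset hbE hSE)] at h2
  have e1 : Q.M.E \ insert a S = insert b (Q.M.E \ insert a (insert b S)) := by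
    ext z; simp only [mem_sdiff, mem_insert_iff]; grind
  have e2 : Q.M.E \ insert b S = insert a (Q.M.E \ insert a (insert b S)) := by
    ext z; simp only [mem_sdiff, mem_insert_iff]; grind
  rw [e1] at h1 ⊢
  rw [e2] at h2 ⊢
  have := ht _ b a (by simp) (by simp) h1 h2
  rw [mul_inv_eq_iff_eq_mul, mul_assoc, mul_comm (t a)⁻¹, ← mul_assoc, eq_mul_inv_iff_mul_eq]
  exact this

lemma good_dual : Q.dual.Good ↔ Q.Good :=
  ⟨fun h => by simpa using h.dual, fun h => h.dual⟩

lemma Good.del (h : Q.Good) (hx : Q.M.NonColoop x) : (Q.del x).Good := by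
  obtain ⟨t, ht⟩ := h
  refine ⟨t, fun S a b ha hb h1 h2 => ?_⟩
  rw [del_M, isBase_delete_iff hx] at h1 h2
  rw [del_wt hx h1.1 h1.2, del_wt hx h2.1 h2.2]
  exact ht S a b ha hb h1.1 h2.1

lemma Good.con (h : Q.Good) (hx : Q.M.NonLoop x) : (Q.con x).Good := by
  rw [← good_dual, dual_con]
  exact h.dual.del ((nonColoop_dual hx.mem).2 hx)

/-- A scaling only has to be tested on the exchanges at a single basis `B₀`. By induction on
`|B \ B₀|`, the exchange condition determines the weight of `B` from the weights of bases that are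
closer to `B₀`. -/
lemma isScaling_of_base {B₀ : Set α} (hB₀ : Q.M.IsBase B₀) {t : α → G}
    (h : ∀ S a b, a ∉ S → b ∉ S → insert a S = B₀ → Q.M.IsBase (insert b S) →
      Q.wt B₀ * t b = Q.wt (insert b S) * t a) : Q.IsScaling t := by
  have hfin : ∀ B, Q.M.IsBase B → B.Finite := fun B hB => Q.M.ground_finite.subset hB.subset_ground
  -- a scaling determines the weights up to a constant, as products of its values
  set w : Set α → G := fun B => ∏ᶠ e ∈ B, t e with hw
  have wins : ∀ S a, a ∉ S → S.Finite → w (insert a S) = t a * w S := fun S a ha hS =>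
    finprod_mem_insert _ ha hS
  have key : ∀ n, ∀ B, Q.M.IsBase B → (B \ B₀).ncard = n → Q.wt B * w B₀ = Q.wt B₀ * w B := by
    intro n
    induction n using Nat.strong_induction_on with
    | _ n ih =>
    intro B hB hn
    have hBf := hfin B hB
    rcases Nat.eq_zero_or_pos n with h0 | hpos
    · have : B \ B₀ = ∅ := by
        rw [← ncard_eq_zero (hBf.subset sdiff_subset)]; lia
      rw [hB.eq_of_subset_isBase hB₀ (sdiff_eq_empty.1 this)]
    obtain ⟨c, hc⟩ : (B \ B₀).Nonempty := (ncard_pos (hBf.subset sdiff_subset)).1 (by lia)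
    obtain ⟨a, ha, hB1⟩ := hB.exchange hB₀ hc
    by_cases h1 : n = 1
    · -- `B` is a neighbour of `B₀`
      obtain ⟨c', hc'⟩ := ncard_eq_one.1 (hn.trans h1)
      have hcc : c = c' := by rw [hc'] at hc; exact hc
      subst hcc
      have e : insert a (B \ {c}) = B₀ := by
        refine hB1.eq_of_subset_isBase hB₀ (insert_subset ha.1 fun z hz => ?_)
        by_contra hzB
        have : z ∈ B \ B₀ := ⟨hz.1, hzB⟩
        rw [hc'] at this
        exact hz.2 this
      have e2 : insert c (B \ {c}) = B := by rw [insert_sdiff_singleton, insert_eq_of_mem hc.1]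
      have := h (B \ {c}) a c (fun h => ha.2 h.1) (by simp) e (by rwa [e2])
      rw [e2] at this
      have w1 := wins (B \ {c}) a (fun h => ha.2 h.1) (hBf.subset sdiff_subset)
      have w2 := wins (B \ {c}) c (by simp) (hBf.subset sdiff_subset)
      rw [e] at w1
      rw [e2] at w2
      rw [w1, w2, ← mul_assoc, ← mul_assoc, this]
    · obtain ⟨d, hd, hdc⟩ := exists_ne_of_one_lt_ncard (show 1 < (B \ B₀).ncard by lia) c
      set S := B \ {c, d} with hS
      have hSf : S.Finite := hBf.subset sdiff_subset
      have eB : B = insert c (insert d S) := by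
        ext z; simp only [hS, mem_insert_iff, mem_sdiff, mem_singleton_iff]
        have := hc.1; have := hd.1
        grind
      have e1 : insert a (B \ {c}) = insert a (insert d S) := by
        congr 1; ext z; simp only [hS, mem_insert_iff, mem_sdiff, mem_singleton_iff]
        have := hd.1
        grind
      rw [e1] at hB1
      have had : a ≠ d := fun h => ha.2 (h ▸ hd.1)
      have hac : a ≠ c := fun h => ha.2 (h ▸ hc.1)
      have haS : a ∉ S := fun h => ha.2 h.1
      have hcS : c ∉ S := by simp [hS]
      have hdS : d ∉ S := by simp [hS]
      obtain ⟨b, hb, hB2⟩ := hB1.exchange hB₀ (e := d) ⟨by simp, hd.2⟩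
      have hbn := hb.2
      simp only [mem_insert_iff, not_or] at hbn
      obtain ⟨hba, hbd, hbS⟩ := hbn
      change b ≠ a at hba
      change b ≠ d at hbd
      have hbc : b ≠ c := fun h => hc.2 (h ▸ hb.1)
      have e2 : insert b (insert a (insert d S) \ {d}) = insert a (insert b S) := by
        ext z; simp only [mem_insert_iff, mem_sdiff, mem_singleton_iff]
        grind
      rw [e2] at hB2
      rw [eB] at hB
      -- as `a` and `b` lie in `B₀` but `c` and `d` do not, all bases below but `B` are closer to `B₀`
      have hdist : ∀ u v, u ∈ B₀ → Q.M.IsBase (insert u (insert v S)) → (v = c ∨ v = d ∨ v ∈ B₀) →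
          Q.wt (insert u (insert v S)) * w B₀ = Q.wt B₀ * w (insert u (insert v S)) := by
        intro u v hu hbase hv
        refine ih _ ?_ _ hbase rfl
        have hss : insert u (insert v S) \ B₀ ⊂ B \ B₀ := by
          refine ⟨?_, ?_⟩
          · rintro z ⟨hz, hz0⟩
            refine ⟨?_, hz0⟩
            rcases hz with rfl | rfl | hz
            · exact absurd hu hz0
            · rcases hv with rfl | rfl | hv
              · exact hc.1
              · exact hd.1
              · exact absurd hv hz0
            · exact hz.1
          · intro hss
            rcases hv with rfl | rfl | hv
            · have := (hss hd).1
              rcases this with rfl | rfl | h'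
              · exact hd.2 hu
              · exact hdc rfl
              · exact hdS h'
            · have := (hss hc).1
              rcases this with rfl | rfl | h'
              · exact hc.2 hu
              · exact hdc rfl
              · exact hcS h'
            · have := (hss hc).1
              rcases this with rfl | rfl | h'
              · exact hc.2 hu
              · exact hc.2 hv
              · exact hcS h'
        have := ncard_lt_ncard hss (hBf.subset sdiff_subset)
        lia
      have dab := hdist a b ha.1 hB2 (by simp [hb.1])
      have dad := hdist a d ha.1 hB1 (by simp)
      have w2 : ∀ u v, u ≠ v → u ∉ S → v ∉ S → w (insert u (insert v S)) = t u * (t v * w S) := by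
        intro u v huv hu hv
        rw [wins _ _ (by simp [huv, hu]) (hSf.insert _), wins _ _ hv hSf]
      rw [w2 a b hba.symm haS hbS] at dab
      rw [w2 a d had haS hdS] at dad
      have goal : ∀ {p q r s : G}, p * q = r * s →
          p * w B₀ = Q.wt B₀ * (t a * (t b * w S)) →
          r * w B₀ * (s * w B₀) = Q.wt B₀ * Q.wt B₀ * (t a * t b * t c * t d * w S * w S) →
          q * w B₀ = Q.wt B₀ * (t c * (t d * w S)) := by
        intro p q r s h1 h2 h3
        have h4 : (p * w B₀) * (q * w B₀) = (r * w B₀) * (s * w B₀) := by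
          rw [mul_mul_mul_comm, h1, mul_mul_mul_comm]
        rw [h2, h3] at h4
        have h5 : (Q.wt B₀ * (t a * (t b * w S))) * (q * w B₀) =
            (Q.wt B₀ * (t a * (t b * w S))) * (Q.wt B₀ * (t c * (t d * w S))) := by
          rw [h4]
          simp only [mul_assoc, mul_comm, mul_left_comm]
        exact mul_left_cancel h5
      rw [eB, w2 c d hdc.symm hcS hdS]
      by_cases hbcB : Q.M.IsBase (insert b (insert c S))
      · have dbc := hdist b c hb.1 hbcB (by simp)
        rw [w2 b c hbc hbS hcS] at dbc
        have ex := Q.exchange S a d c b haS hdS hcS hbS had hac hba.symm hdc hbd.symm hbc.symm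
          hB1 (by rwa [insert_comm]) hB2 (by rwa [insert_comm]) (by
            intro h6 h7
            have dac := hdist a c ha.1 h6 (by simp)
            have dbd := hdist b d hb.1 (by rwa [insert_comm]) (by simp)
            rw [w2 a c hac haS hcS] at dac
            rw [w2 b d hbd hbS hdS] at dbd
            rw [insert_comm d b, insert_comm c b]
            have h8 : (Q.wt (insert a (insert c S)) * w B₀) *
                (Q.wt (insert b (insert d S)) * w B₀) =
                (Q.wt (insert a (insert d S)) * w B₀) *
                (Q.wt (insert b (insert c S)) * w B₀) := by
              rw [dac, dbd, dad, dbc]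
              simp only [mul_comm, mul_left_comm]
            rw [mul_mul_mul_comm, mul_mul_mul_comm _ (w B₀)] at h8
            exact mul_right_cancel h8)
        rw [insert_comm d c, insert_comm c b] at ex
        refine goal ex.symm dab ?_
        rw [dad, dbc]
        simp only [mul_assoc, mul_comm, mul_left_comm]
      · have hacB : Q.M.IsBase (insert a (insert c S)) := by
          obtain ⟨f, hf, hfB⟩ := hB.exchange hB2 (e := d) ⟨by simp, by
            simp only [mem_insert_iff, not_or]; exact ⟨had.symm, hbd.symm, hdS⟩⟩
          have e3 : insert c (insert d S) \ {d} = insert c S := by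
            ext z; simp only [mem_insert_iff, mem_sdiff, mem_singleton_iff]; grind
          rw [e3] at hfB
          rcases hf.1 with rfl | rfl | h'
          · exact hfB
          · exact absurd hfB hbcB
          · exact absurd (Or.inr (Or.inr h')) hf.2
        have hbdB : Q.M.IsBase (insert b (insert d S)) := by
          obtain ⟨f, hf, hfB⟩ := hB2.exchange hB (e := a) ⟨by simp, by
            simp only [mem_insert_iff, not_or]; exact ⟨hac, had, haS⟩⟩
          have e3 : insert a (insert b S) \ {a} = insert b S := by
            ext z; simp only [mem_insert_iff, mem_sdiff, mem_singleton_iff]; grind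
          rw [e3] at hfB
          rcases hf.1 with rfl | rfl | h'
          · exact absurd (by rwa [insert_comm]) hbcB
          · rwa [insert_comm]
          · exact absurd (Or.inr (Or.inr h')) hf.2
        have dac := hdist a c ha.1 hacB (by simp)
        have dbd := hdist b d hb.1 hbdB (by simp)
        rw [w2 a c hac haS hcS] at dac
        rw [w2 b d hbd hbS hdS] at dbd
        have ex := Q.exchange S a c d b haS hcS hdS hbS hac had hba.symm hdc.symm hbc.symm
          hbd.symm hacB (by rwa [insert_comm]) hB2 hB
          (fun _ h7 => absurd (by rwa [insert_comm]) hbcB)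
        rw [insert_comm d b] at ex
        refine goal ex.symm dab ?_
        rw [dac, dbd]
        simp only [mul_assoc, mul_comm, mul_left_comm]
  intro S a b ha hb h1 h2
  have k1 := key _ _ h1 rfl
  have k2 := key _ _ h2 rfl
  have hSf : S.Finite := (hfin _ h1).subset (subset_insert _ _)
  rw [wins S a ha hSf] at k1
  rw [wins S b hb hSf] at k2
  have : (Q.wt (insert a S) * t b) * (w B₀ * (Q.wt B₀ * w S)) =
      (Q.wt (insert b S) * t a) * (w B₀ * (Q.wt B₀ * w S)) := by
    calc _ = (Q.wt (insert a S) * w B₀) * (Q.wt B₀ * (t b * w S)) := by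
          simp only [mul_assoc, mul_comm, mul_left_comm]
      _ = (Q.wt (insert b S) * w B₀) * (Q.wt B₀ * (t a * w S)) := by
          rw [k1, ← k2]; simp only [mul_assoc, mul_comm, mul_left_comm]
      _ = _ := by simp only [mul_assoc, mul_comm, mul_left_comm]
  exact mul_right_cancel this

/-- If the deletions of `x` and of `y` are good, and `Q` without `x` and `y` is connected, then the
two scalings agree up to a constant factor and fit together. -/
lemma Good.of_delete_delete (hxy : x ≠ y) (hc : (Q.M ＼ {x} ＼ {y}).Conn)
    (hs : Q.M.NonSeries x y) (h1 : (Q.del x).Good) (h2 : (Q.del y).Good) : Q.Good := by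
  obtain ⟨t, ht⟩ := h1
  obtain ⟨t', ht'⟩ := h2
  have hx := hs.nonColoop_left
  have hy := hs.symm.nonColoop_left
  have hbase : ∀ B, (Q.M ＼ {x} ＼ {y}).IsBase B ↔ Q.M.IsBase B ∧ x ∉ B ∧ y ∉ B := by
    intro B
    rw [isBase_delete_iff ((nonColoop_delete hx).2 hs), isBase_delete_iff hx]; tauto
  -- the quotient of the two scalings does not change along the exchanges that avoid `x` and `y`
  obtain ⟨k, hk⟩ := hc.const_of_exchange (fun e => t e * (t' e)⁻¹) (by
    intro S a b ha hb h1 h2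
    rw [hbase] at h1 h2
    have r1 := ht S a b ha hb ((isBase_delete_iff hx).2 ⟨h1.1, h1.2.1⟩)
      ((isBase_delete_iff hx).2 ⟨h2.1, h2.2.1⟩)
    have r2 := ht' S a b ha hb ((isBase_delete_iff hy).2 ⟨h1.1, h1.2.2⟩)
      ((isBase_delete_iff hy).2 ⟨h2.1, h2.2.2⟩)
    rw [del_wt hx h1.1 h1.2.1, del_wt hx h2.1 h2.2.1] at r1
    rw [del_wt hy h1.1 h1.2.2, del_wt hy h2.1 h2.2.2] at r2
    rw [mul_inv_eq_iff_eq_mul, mul_assoc, mul_comm (t' b)⁻¹, ← mul_assoc, eq_mul_inv_iff_mul_eq]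
    have : (t a * t' b) * (Q.wt (insert b S) * Q.wt (insert a S)) =
        (t b * t' a) * (Q.wt (insert b S) * Q.wt (insert a S)) := by
      calc _ = (Q.wt (insert b S) * t a) * (Q.wt (insert a S) * t' b) := by
            simp only [mul_assoc, mul_comm, mul_left_comm]
        _ = (Q.wt (insert a S) * t b) * (Q.wt (insert b S) * t' a) := by rw [r1, r2]
        _ = _ := by simp only [mul_assoc, mul_comm, mul_left_comm]
    exact mul_right_cancel this)
  obtain ⟨B₀, hB₀⟩ := (Q.M ＼ {x} ＼ {y}).exists_isBase
  have hB₀E := hB₀.subset_ground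
  rw [hbase] at hB₀
  classical
  refine ⟨fun e => if e = x then t' x * k else t e, isScaling_of_base hB₀.1 ?_⟩
  rintro S a b ha hb rfl hbS
  have hax : a ≠ x := fun h => hB₀.2.1 (by simp [h])
  have hSx : x ∉ S := fun h => hB₀.2.1 (by simp [h])
  have hSy : y ∉ S := fun h => hB₀.2.2 (by simp [h])
  by_cases hbx : b = x
  · subst hbx
    simp only [if_true, if_neg hax]
    have hb2 : y ∉ insert b S := by simp [hSy, hxy.symm]
    have r := ht' S a b ha hb ((isBase_delete_iff hy).2 ⟨hB₀.1, hB₀.2.2⟩)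
      ((isBase_delete_iff hy).2 ⟨hbS, hb2⟩)
    rw [del_wt hy hB₀.1 hB₀.2.2, del_wt hy hbS hb2] at r
    have hka := hk a (hB₀E (mem_insert _ _))
    rw [mul_inv_eq_iff_eq_mul] at hka
    rw [hka, mul_comm k, ← mul_assoc, ← mul_assoc, r]
  · simp only [if_neg hbx, if_neg hax]
    have hb2 : x ∉ insert b S := by simp [hSx, Ne.symm hbx]
    have r := ht S a b ha hb ((isBase_delete_iff hx).2 ⟨hB₀.1, hB₀.2.1⟩)
      ((isBase_delete_iff hx).2 ⟨hbS, hb2⟩)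
    rwa [del_wt hx hB₀.1 hB₀.2.1, del_wt hx hbS hb2] at r

lemma Good.of_contract_contract (hxy : x ≠ y) (hx : x ∈ Q.M.E) (hy : y ∈ Q.M.E)
    (hc : (Q.M ／ {x} ／ {y}).Conn) (hs : Q.M.NonParallel x y) (h1 : (Q.con x).Good)
    (h2 : (Q.con y).Good) : Q.Good := by
  rw [← good_dual] at h1 h2 ⊢
  rw [dual_con] at h1 h2
  refine Good.of_delete_delete hxy ?_ ((nonSeries_dual hx hy hxy).2 hs) h1 h2
  rw [← conn_dual] at hc
  simpa [dual_contract] using hc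

lemma NonColoop.of_parallel {M : Matroid α} [M.Finite] (hy : M.NonLoop y)
    (hxy : x ≠ y) (hp : ¬ M.NonParallel x y) : M.NonColoop x := by
  by_cases hx : x ∈ M.E
  · rw [NonColoop]
    have h1 : M.rk (insert x {y}) = M.rk {y} := by
      have := M.rk_insert_le x {y}
      have := M.le_rk_insert x {y}
      rw [NonParallel] at hp; rw [NonLoop] at hy; lia
    have := rk_insert_eq_of_subset (M := M) (X := {y}) (Y := M.E \ {x})
      (by simpa using ⟨hy.mem, hxy.symm⟩) h1
    rwa [insert_sdiff_singleton, insert_eq_of_mem hx, eq_comm] at this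
  · rw [NonColoop, sdiff_singleton_eq_self hx]

/-- A scaling extends to an element `x` parallel to `y`: the bases containing `x` arise from those
containing `y`, with a constant quotient of the weights. -/
lemma Good.of_delete_parallel (hx : Q.M.NonLoop x) (hy : Q.M.NonLoop y) (hxy : x ≠ y)
    (hp : ¬ Q.M.NonParallel x y) (h : (Q.del x).Good) : Q.Good := by
  obtain ⟨t, ht⟩ := h
  have hxc : Q.M.NonColoop x := NonColoop.of_parallel hy hxy hp
  have hyi : Q.M.Indep {y} := (indep_iff_rk (finite_singleton y)).2 (by rw [hy]; simp)
  have hdep : ∀ B, Q.M.IsBase B → x ∈ B → y ∈ B → False := by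
    intro B hB h1 h2
    have := (indep_iff_rk (toFinite _)).1 (hB.indep.subset (pair_subset h1 h2))
    rw [ncard_pair hxy] at this
    exact hp this
  obtain ⟨B₀, hB₀, hyB⟩ := hyi.exists_isBase_superset
  rw [singleton_subset_iff] at hyB
  have hxB : x ∉ B₀ := fun h => hdep B₀ hB₀ h hyB
  classical
  -- the value at `x` is dictated by the exchange of `y` for `x` in `B₀`
  refine ⟨fun e => if e = x then Q.wt (insert x (B₀ \ {y})) * t y * (Q.wt B₀)⁻¹ else t e,
    isScaling_of_base hB₀ ?_⟩
  rintro S a b ha hb rfl hbS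
  have hax : a ≠ x := fun h => hxB (by simp [h])
  have hSx : x ∉ S := fun h => hxB (by simp [h])
  by_cases hbx : b = x
  · subst hbx
    have hyS : y ∉ S := fun h => hdep _ hbS (by simp) (by simp [h])
    have hya : y = a := by simpa [hyS] using hyB
    subst hya
    have e : insert y S \ {y} = S := by simp [hyS]
    simp only [if_true, if_neg hax, e]
    rw [mul_comm, inv_mul_cancel_right]
  · simp only [if_neg hbx, if_neg hax]
    have hb2 : x ∉ insert b S := by simp [hSx, Ne.symm hbx]
    have r := ht S a b ha hb ((isBase_delete_iff hxc).2 ⟨hB₀, hxB⟩)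
      ((isBase_delete_iff hxc).2 ⟨hbS, hb2⟩)
    rwa [del_wt hxc hB₀ hxB, del_wt hxc hbS hb2] at r

lemma Good.of_contract_series (hx : Q.M.NonColoop x) (hy : Q.M.NonColoop y) (hxE : x ∈ Q.M.E)
    (hyE : y ∈ Q.M.E) (hxy : x ≠ y) (hp : ¬ Q.M.NonSeries x y) (h : (Q.con x).Good) : Q.Good := by
  rw [← good_dual] at h ⊢
  rw [dual_con] at h
  exact h.of_delete_parallel ((nonLoop_dual hxE).2 hx) ((nonLoop_dual hyE).2 hy) hxy
    (by rwa [dual_M, nonParallel_dual hxE hyE hxy])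

lemma del_con_comm (Q : WeightedMatroid α G) (hx : Q.M.NonColoop x) (hy : Q.M.NonLoop y)
    (hxy : x ≠ y) : (Q.del x).con y = (Q.con y).del x := by
  refine ext_base ?_ fun B hB => ?_
  · simp only [con_M, del_M]
    exact (contract_delete_comm _ (by simpa using hxy.symm)).symm
  · have hy' : (Q.M ＼ {x}).NonLoop y := (nonLoop_delete hxy).2 hy
    rw [con_M, del_M, isBase_contract_iff hy', isBase_delete_iff hx] at hB
    obtain ⟨⟨h1, h2⟩, h3⟩ := hB
    have h4 : x ∉ B := fun h => h2 (by simp [h])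
    rw [con_wt (Q := Q.del x) hy' ((isBase_delete_iff hx).2 ⟨h1, h2⟩) h3, del_wt hx h1 h2,
      del_wt (Q := Q.con y) ((nonColoop_contract hy.mem hxy.symm).2 hx)
      ((isBase_contract_iff hy).2 ⟨h1, h3⟩) h4, con_wt hy h1 h3]

lemma del_del_comm (Q : WeightedMatroid α G) (hs : Q.M.NonSeries x y) :
    (Q.del x).del y = (Q.del y).del x := by
  have hx := hs.nonColoop_left
  have hy := hs.symm.nonColoop_left
  refine ext_base ?_ fun B hB => ?_
  · simp only [del_M]
    exact delete_comm _ _ _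
  · have hy' : (Q.M ＼ {x}).NonColoop y := (nonColoop_delete hx).2 hs
    have hx' : (Q.M ＼ {y}).NonColoop x := (nonColoop_delete hy).2 hs.symm
    rw [del_M, del_M, isBase_delete_iff hy', isBase_delete_iff hx] at hB
    obtain ⟨⟨h1, h2⟩, h3⟩ := hB
    rw [del_wt (Q := Q.del x) hy' ((isBase_delete_iff hx).2 ⟨h1, h2⟩) h3, del_wt hx h1 h2,
      del_wt (Q := Q.del y) hx' ((isBase_delete_iff hy).2 ⟨h1, h3⟩) h2, del_wt hy h1 h3]

lemma con_con_comm (Q : WeightedMatroid α G) (hx : x ∈ Q.M.E) (hy : y ∈ Q.M.E)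
    (hs : Q.M.NonParallel x y) : (Q.con x).con y = (Q.con y).con x := by
  have := Q.dual.del_del_comm ((nonSeries_dual hx hy hs.ne).2 hs)
  rw [← dual_con, ← dual_con, ← dual_con, ← dual_con] at this
  rw [← dual_dual ((Q.con x).con y), this, dual_dual]

end WeightedMatroid

end Weights

/-! ### Minors of weighted matroids -/

section WeightedMinors

open Set

namespace Matroid

variable {α : Type*} {M M' : Matroid α} {U I : Set α} {x : α}

lemma ext_rk [M.Finite] [M'.Finite] (hE : M.E = M'.E) (h : ∀ X ⊆ M.E, M.rk X = M'.rk X) :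
    M = M' := by
  refine ext_indep hE fun I hI => ?_
  have hf := M.ground_finite.subset hI
  rw [indep_iff_rk hf, indep_iff_rk hf, h I hI]

lemma rk_eq_of_subset_indep [M.RankFinite] {J : Set α} (hI : I.Finite) (hJ : J ⊆ I)
    (h : M.rk (U ∪ I) = M.rk U + I.ncard) : M.rk (U ∪ J) = M.rk U + J.ncard := by
  have h1 := M.rk_union_le U J
  have h2 := M.rk_le_ncard (hI.subset hJ)
  have h3 := M.rk_union_le (U ∪ J) (I \ J)
  have h4 := M.rk_le_ncard (hI.subset (sdiff_subset (t := J)))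
  have h5 := ncard_sdiff_add_ncard_of_subset hJ hI
  rw [union_assoc, union_sdiff_cancel hJ] at h3
  lia

/-- If `x` lies in the span of `U` together with a set `I` independent over `U`, but not in the
span of `U`, then some element of `I` is needed to span `x`. -/
lemma exists_rk_insert_of_rk_insert_eq [M.RankFinite] (hI : I.Finite)
    (h : M.rk (U ∪ I) = M.rk U + I.ncard) (hxU : M.rk (insert x U) = M.rk U + 1) :
    M.rk (insert x (U ∪ I)) = M.rk (U ∪ I) + 1 ∨
    ∃ v ∈ I, M.rk (insert x (U ∪ (I \ {v}))) = M.rk (U ∪ (I \ {v})) + 1 := by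
  by_contra! hcon
  obtain ⟨h0, h1⟩ := hcon
  have hle := fun X => M.rk_insert_le x X
  have hge := fun X => M.le_rk_insert x X
  have key : ∀ K ⊆ I, M.rk (insert x (U ∪ (I \ K))) = M.rk (U ∪ (I \ K)) := by
    intro K hK
    have hKf := hI.subset hK
    induction K, hKf using Set.Finite.induction_on with
    | empty =>
      rw [sdiff_empty]
      have := hle (U ∪ I); have := hge (U ∪ I)
      lia
    | @insert v K' hv hKf ih =>
      rw [insert_subset_iff] at hK
      have ih' := ih hK.2
      have hb : M.rk (insert x (U ∪ (I \ {v}))) = M.rk (U ∪ (I \ {v})) := by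
        have := hle (U ∪ (I \ {v})); have := hge (U ∪ (I \ {v})); have := h1 v hK.1
        lia
      have s := M.rk_submod (insert x (U ∪ (I \ K'))) (insert x (U ∪ (I \ {v})))
      have s1 := M.rk_mono (X := insert x (U ∪ (I \ insert v K')))
        (Y := insert x (U ∪ (I \ K')) ∩ insert x (U ∪ (I \ {v}))) (by
          intro z; simp only [mem_insert_iff, mem_union, mem_sdiff, mem_inter_iff]; grind)
      have s2 := M.rk_mono (X := U ∪ I)
        (Y := insert x (U ∪ (I \ K')) ∪ insert x (U ∪ (I \ {v}))) (by
          intro z; simp only [mem_insert_iff, mem_union, mem_sdiff]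
          by_cases z = v <;> simp_all)
      rw [ih', hb, rk_eq_of_subset_indep hI sdiff_subset h,
        rk_eq_of_subset_indep hI sdiff_subset h] at s
      have t := rk_eq_of_subset_indep (M := M) hI (sdiff_subset (t := insert v K')) h
      have c1 := ncard_sdiff_add_ncard_of_subset (insert_subset hK.1 hK.2) hI
      have c2 := ncard_sdiff_add_ncard_of_subset hK.2 hI
      have c3 := ncard_sdiff_singleton_add_one hK.1 hI
      rw [ncard_insert_of_notMem hv hKf] at c1
      have := hge (U ∪ (I \ insert v K'))
      lia
  have := key I subset_rfl
  rw [sdiff_self, union_empty] at this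
  lia

end Matroid

open Matroid

namespace WeightedMatroid

variable {α G : Type*} [CommGroup G] {Q Q' Q'' : WeightedMatroid α G} {x y v : α} {C : Set α}
  {N : Matroid α}

/-- `Q'` is the weighted minor of `Q` obtained by contracting the independent set `C` and deleting
the remaining elements, which must form a coindependent set. -/
structure IsMinorVia (Q' Q : WeightedMatroid α G) (C : Set α) : Prop where
  ground : Q'.M.E ⊆ Q.M.E
  sub : C ⊆ Q.M.E
  disj : Disjoint C Q'.M.E
  indep : Q.M.rk C = C.ncard
  span : Q.M.rk (Q'.M.E ∪ C) = Q.M.rk Q.M.E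
  rk : ∀ X ⊆ Q'.M.E, Q'.M.rk X = Q.M.rk (X ∪ C) - C.ncard
  wt : ∀ B, Q'.M.IsBase B → Q'.wt B = Q.wt (B ∪ C)

/-- `Q'` is a weighted minor of `Q`. -/
def IsMinor (Q' Q : WeightedMatroid α G) : Prop := ∃ C, Q'.IsMinorVia Q C

/-- `N` is the matroid of a weighted minor of `Q` whose weights come from a scaling. -/
def HasGoodMinor (Q : WeightedMatroid α G) (N : Matroid α) : Prop :=
  ∃ Q' : WeightedMatroid α G, Q'.M = N ∧ Q'.IsMinor Q ∧ Q'.Good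

namespace IsMinorVia

lemma finite (h : Q'.IsMinorVia Q C) : C.Finite := Q.M.ground_finite.subset h.sub

lemma isBase_iff (h : Q'.IsMinorVia Q C) {B : Set α} :
    Q'.M.IsBase B ↔ B ⊆ Q'.M.E ∧ Q.M.IsBase (B ∪ C) := by
  rw [isBase_iff_rk, isBase_iff_rk]
  have key : B ⊆ Q'.M.E → (B ∪ C).ncard = B.ncard + C.ncard := fun hB =>
    ncard_union_eq (h.disj.mono_right hB).symm (Q'.M.ground_finite.subset hB) h.finite
  constructor
  · rintro ⟨h1, h2, h3⟩
    rw [h.rk B h1] at h2 h3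
    rw [h.rk _ subset_rfl, h.span] at h3
    refine ⟨h1, union_subset (h1.trans h.ground) h.sub, ?_, ?_⟩
    · rw [key h1]; push_cast; lia
    · lia
  · rintro ⟨h1, h2, h3, h4⟩
    rw [key h1] at h3
    push_cast at h3
    rw [h.rk B h1, h.rk _ subset_rfl, h.span]
    exact ⟨h1, by lia, by lia⟩

lemma refl (Q : WeightedMatroid α G) : Q.IsMinorVia Q ∅ where
  ground := subset_rfl
  sub := empty_subset _
  disj := by simp
  indep := by simp
  span := by simp
  rk X _ := by simp
  wt B _ := by simp

lemma trans {C' : Set α} (h : Q''.IsMinorVia Q' C') (h' : Q'.IsMinorVia Q C) :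
    Q''.IsMinorVia Q (C' ∪ C) := by
  have hc : (C' ∪ C).ncard = C'.ncard + C.ncard :=
    ncard_union_eq (h'.disj.mono_right h.sub).symm h.finite h'.finite
  refine ⟨h.ground.trans h'.ground, union_subset (h.sub.trans h'.ground) h'.sub, ?_, ?_, ?_,
    fun X hX => ?_, fun B hB => ?_⟩
  · exact disjoint_union_left.2 ⟨h.disj, h'.disj.mono_right h.ground⟩
  · have := h'.rk C' h.sub
    rw [h.indep] at this
    rw [hc]; push_cast; lia
  · have h1 := h'.rk _ (union_subset h.ground h.sub)
    have h2 := h'.rk _ subset_rfl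
    rw [h.span, h2, h'.span, union_assoc] at h1
    lia
  · rw [h.rk X hX, h'.rk _ (union_subset (hX.trans h.ground) h.sub), union_assoc, hc]
    push_cast; lia
  · rw [h.wt B hB, h'.wt _ (h.isBase_iff.1 hB).2, union_assoc]

lemma delete (hx : Q.M.NonColoop x) : (Q.del x).IsMinorVia Q ∅ where
  ground := sdiff_subset
  sub := empty_subset _
  disj := by simp
  indep := by simp
  span := by rw [union_empty, del_M, delete_ground, hx]
  rk X hX := by
    rw [del_M, rk_deleteElem (fun h => (hX h).2 rfl)]; simp
  wt B hB := by
    rw [del_M, isBase_delete_iff hx] at hB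
    rw [del_wt hx hB.1 hB.2, union_empty]

lemma contract (hx : Q.M.NonLoop x) : (Q.con x).IsMinorVia Q {x} where
  ground := sdiff_subset
  sub := by simpa using hx.mem
  disj := by simp
  indep := by rw [hx]; simp
  span := by rw [con_M, contract_ground, union_singleton, insert_sdiff_singleton,
    insert_eq_of_mem hx.mem]
  rk X hX := by
    rw [con_M, rk_contractElem, hx, union_singleton]; simp
  wt B hB := by
    rw [con_M, isBase_contract_iff hx] at hB
    rw [con_wt hx hB.1 hB.2, union_singleton]

lemma of_notMem (h : Q'.IsMinorVia Q C) (hxE : x ∉ Q'.M.E) (hxC : x ∉ C) :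
    Q.M.NonColoop x ∧ Q'.IsMinorVia (Q.del x) C := by
  have hss : Q'.M.E ∪ C ⊆ Q.M.E \ {x} := by
    rintro z (hz | hz)
    · exact ⟨h.ground hz, by rintro rfl; exact hxE hz⟩
    · exact ⟨h.sub hz, by rintro rfl; exact hxC hz⟩
  have hx : Q.M.NonColoop x := by
    have h1 := Q.M.rk_mono hss
    have h2 := Q.M.rk_le_rk_ground (Q.M.E \ {x})
    rw [h.span] at h1
    rw [NonColoop]; lia
  refine ⟨hx, subset_union_left.trans hss, subset_union_right.trans hss, h.disj, ?_, ?_, ?_, ?_⟩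
  · rw [del_M, rk_deleteElem hxC, h.indep]
  · rw [del_M, hx.rk_delete_ground, rk_deleteElem (by simp [*]), h.span]
  · intro X hX
    rw [del_M, rk_deleteElem, h.rk X hX]
    rintro (hz | hz)
    · exact hxE (hX hz)
    · exact hxC hz
  · intro B hB
    have hB' := (h.isBase_iff.1 hB)
    rw [h.wt B hB, del_wt hx hB'.2]
    rintro (hz | hz)
    · exact hxE (hB'.1 hz)
    · exact hxC hz

lemma of_mem (h : Q'.IsMinorVia Q C) (hxC : x ∈ C) :
    Q.M.NonLoop x ∧ Q'.IsMinorVia (Q.con x) (C \ {x}) := by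
  have hCf := h.finite
  have hc := ncard_sdiff_singleton_add_one hxC hCf
  have hi : insert x (C \ {x}) = C := by rw [insert_sdiff_singleton, insert_eq_of_mem hxC]
  have hu : ∀ X, insert x (X ∪ C \ {x}) = X ∪ C := fun X => by
    rw [← union_insert, hi]
  have hx : Q.M.NonLoop x := by
    have h1 := Q.M.rk_union_le {x} (C \ {x})
    have h2 := Q.M.rk_le_ncard (hCf.subset (sdiff_subset (t := {x})))
    have h3 := Q.M.rk_singleton_le x
    rw [singleton_union, hi, h.indep] at h1
    rw [NonLoop]; lia
  have hxE : x ∉ Q'.M.E := fun hz => disjoint_left.1 h.disj hxC hz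
  refine ⟨hx, ?_, ?_, h.disj.mono_left sdiff_subset, ?_, ?_, ?_, ?_⟩
  · exact subset_sdiff.2 ⟨h.ground, by simpa⟩
  · exact subset_sdiff.2 ⟨sdiff_subset.trans h.sub, disjoint_sdiff_left⟩
  · rw [con_M, rk_contractElem, hi, hx, h.indep]; lia
  · rw [con_M, hx.rk_contract_ground, rk_contractElem, hu, h.span, hx]
  · intro X hX
    rw [con_M, rk_contractElem, hu, h.rk X hX, hx]; lia
  · intro B hB
    have hB' := (h.isBase_iff.1 hB)
    rw [h.wt B hB, con_wt hx (by rw [hu]; exact hB'.2), hu]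
    rintro (hz | hz)
    · exact hxE (hB'.1 hz)
    · exact hz.2 rfl

lemma eq_of_ground_eq (h : Q'.IsMinorVia Q C) (h' : Q''.IsMinorVia Q C)
    (hE : Q'.M.E = Q''.M.E) : Q' = Q'' := by
  have hM : Q'.M = Q''.M := ext_rk hE fun X hX => by
    rw [h.rk X hX, h'.rk X (hE ▸ hX)]
  exact ext_base hM fun B hB => by rw [h.wt B hB, h'.wt B (hM ▸ hB)]

/-- Every minor of the underlying matroid is the matroid of a weighted minor: an independent set to be
contracted with spanning complement of the deleted set can be removed element by element. -/
lemma exists_via {E' : Set α} (hE : E' ⊆ Q.M.E) (hC : C ⊆ Q.M.E) (hd : Disjoint C E')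
    (hi : Q.M.rk C = C.ncard) (hs : Q.M.rk (E' ∪ C) = Q.M.rk Q.M.E) :
    ∃ Q' : WeightedMatroid α G, Q'.M.E = E' ∧ Q'.IsMinorVia Q C := by
  suffices H : ∀ n, ∀ (Q : WeightedMatroid α G) (C : Set α), (Q.M.E \ E').ncard = n →
      E' ⊆ Q.M.E → C ⊆ Q.M.E → Disjoint C E' → Q.M.rk C = C.ncard →
      Q.M.rk (E' ∪ C) = Q.M.rk Q.M.E →
      ∃ Q' : WeightedMatroid α G, Q'.M.E = E' ∧ Q'.IsMinorVia Q C from H _ Q C rfl hE hC hd hi hs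
  intro n
  induction n with
  | zero =>
    intro Q C hn hE hC hd hi hs
    have h0 : Q.M.E \ E' = ∅ := by
      rwa [ncard_eq_zero (Q.M.ground_finite.subset sdiff_subset)] at hn
    have hEE : Q.M.E = E' := (sdiff_eq_empty.1 h0).antisymm hE
    have hC0 : C = ∅ :=
       disjoint_self.1 (hd.mono_right (hEE ▸ hC))
    exact ⟨Q, hEE, hC0 ▸ refl Q⟩
  | succ n ih =>
    intro Q C hn hE hC hd hi hs
    obtain ⟨x, hx⟩ : (Q.M.E \ E').Nonempty := by
      rw [← ncard_pos (Q.M.ground_finite.subset sdiff_subset)]; lia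
    have hcard := ncard_sdiff_singleton_add_one hx (Q.M.ground_finite.subset sdiff_subset)
    have e1 : (Q.M.E \ {x}) \ E' = (Q.M.E \ E') \ {x} := by ext; simp; tauto
    have hEx : E' ⊆ Q.M.E \ {x} := subset_sdiff.2 ⟨hE, by simpa using hx.2⟩
    by_cases hxC : x ∈ C
    · have hCf := Q.M.ground_finite.subset hC
      have hc := ncard_sdiff_singleton_add_one hxC hCf
      have hie : insert x (C \ {x}) = C := by rw [insert_sdiff_singleton, insert_eq_of_mem hxC]
      have hxL : Q.M.NonLoop x := by
        have h1 := Q.M.rk_union_le {x} (C \ {x})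
        have h2 := Q.M.rk_le_ncard (hCf.subset (sdiff_subset (t := {x})))
        have h3 := Q.M.rk_singleton_le x
        rw [singleton_union, hie, hi] at h1
        rw [NonLoop]; lia
      obtain ⟨Q', h1, h2⟩ := ih (Q.con x) (C \ {x})
        (by rw [con_M, contract_ground, e1]; lia) hEx
        (subset_sdiff.2 ⟨sdiff_subset.trans hC, disjoint_sdiff_left⟩) (hd.mono_left sdiff_subset)
        (by rw [con_M, rk_contractElem, hie, hxL, hi]; lia)
        (by rw [con_M, hxL.rk_contract_ground, rk_contractElem, ← union_insert, hie, hs, hxL])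
      have := h2.trans (contract hxL)
      rw [sdiff_union_self, union_singleton, insert_eq_of_mem hxC] at this
      exact ⟨Q', h1, this⟩
    · have hCx : C ⊆ Q.M.E \ {x} := subset_sdiff.2 ⟨hC, by simpa using hxC⟩
      have hxC' : Q.M.NonColoop x := by
        have h1 := Q.M.rk_mono (union_subset hEx hCx)
        have h2 := Q.M.rk_le_rk_ground (Q.M.E \ {x})
        rw [NonColoop]; lia
      obtain ⟨Q', h1, h2⟩ := ih (Q.del x) C
        (by rw [del_M, delete_ground, e1]; lia) hEx hCx hd
        (by rw [del_M, rk_deleteElem hxC, hi])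
        (by
          rw [del_M, hxC'.rk_delete_ground, rk_deleteElem, hs]
          rintro (h | h)
          · exact hx.2 h
          · exact hxC h)
      have := h2.trans (delete hxC')
      rw [union_empty] at this
      exact ⟨Q', h1, this⟩

lemma dual (h : Q'.IsMinorVia Q C) :
    Q'.dual.IsMinorVia Q.dual ((Q.M.E \ Q'.M.E) \ C) := by
  set C' := (Q.M.E \ Q'.M.E) \ C with hC'
  have hC'E : C' ⊆ Q.M.E := sdiff_subset.trans sdiff_subset
  have hE := h.ground
  have key : ∀ X ⊆ Q'.M.E, Q.M.E \ (X ∪ C') = (Q'.M.E \ X) ∪ C := by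
    intro X hX
    ext z
    have := @hX z; have := @hE z; have := @h.sub z
    have := fun h1 : z ∈ C => disjoint_left.1 h.disj h1
    simp only [hC', mem_sdiff, mem_union]
    tauto
  have hcd : ∀ X ⊆ Q'.M.E, (X ∪ C').ncard = X.ncard + C'.ncard := fun X hX =>
    ncard_union_eq (disjoint_left.2 fun z hz hz' => hz'.1.2 (hX hz))
      (Q'.M.ground_finite.subset hX) (Q.M.ground_finite.subset hC'E)
  have hr : ∀ X ⊆ Q'.M.E, Q.M✶.rk (X ∪ C') =
      Q.M.rk ((Q'.M.E \ X) ∪ C) + X.ncard + C'.ncard - Q.M.rk Q.M.E := by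
    intro X hX
    rw [rk_dual _ (union_subset (hX.trans hE) hC'E), key X hX, hcd X hX]
    push_cast; lia
  refine ⟨hE, hC'E, disjoint_left.2 fun z hz hz' => hz.1.2 hz', ?_, ?_, ?_, ?_⟩
  · have := hr ∅ (empty_subset _)
    rw [empty_union, sdiff_empty, h.span, ncard_empty] at this
    rw [dual_M, this]; push_cast; lia
  · have := hr Q'.M.E subset_rfl
    rw [dual_M, dual_M, dual_ground, dual_ground, this, sdiff_self, empty_union,
      h.indep, rk_dual _ subset_rfl, sdiff_self, rk_empty]
    have c1 := ncard_sdiff_add_ncard_of_subset hE Q.M.ground_finite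
    have c2 := ncard_sdiff_add_ncard_of_subset
      (subset_sdiff.2 ⟨h.sub, h.disj⟩) (Q.M.ground_finite.subset (sdiff_subset (t := Q'.M.E)))
    lia
  · intro X hX
    have hX' : X ⊆ Q'.M.E := hX
    rw [dual_M, dual_M, hr X hX', rk_dual _ hX', h.rk _ sdiff_subset, h.rk _ subset_rfl, h.span]
    lia
  · intro B hB
    have hBE : B ⊆ Q'.M.E := hB.subset_ground
    have h1 : Q'.M.IsBase (Q'.M.E \ B) := (dual_isBase_iff hBE).1 hB
    have h2 := (h.isBase_iff.1 h1).2
    rw [dual_wt _ hB, dual_wt, key B hBE, h.wt _ h1]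
    rw [dual_isBase_iff (union_subset (hBE.trans hE) hC'E), key B hBE]
    exact h2

end IsMinorVia

lemma IsMinor.refl (Q : WeightedMatroid α G) : Q.IsMinor Q := ⟨∅, .refl Q⟩

lemma IsMinor.trans (h : Q''.IsMinor Q') (h' : Q'.IsMinor Q) : Q''.IsMinor Q :=
  ⟨_, h.choose_spec.trans h'.choose_spec⟩

lemma IsMinor.dual (h : Q'.IsMinor Q) : Q'.dual.IsMinor Q.dual := ⟨_, h.choose_spec.dual⟩

lemma isMinor_del (hx : Q.M.NonColoop x) : (Q.del x).IsMinor Q := ⟨_, .delete hx⟩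

lemma isMinor_con (hx : Q.M.NonLoop x) : (Q.con x).IsMinor Q := ⟨_, .contract hx⟩

lemma IsMinor.ground (h : Q'.IsMinor Q) : Q'.M.E ⊆ Q.M.E := h.choose_spec.ground

lemma IsMinor.eq_of_ground_eq (h : Q'.IsMinor Q) (hE : Q'.M.E = Q.M.E) : Q' = Q := by
  obtain ⟨C, hC⟩ := h
  have : C = ∅ := by
    exact disjoint_self.1 (hC.disj.mono_right (hE ▸ hC.sub))
  subst this
  exact hC.eq_of_ground_eq (.refl Q) hE

lemma IsMinor.isMinor (h : Q'.IsMinor Q) : Q'.M ≤m Q.M := by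
  obtain ⟨C, hC⟩ := h
  have hf : (Q.M ／ C ↾ Q'.M.E).Finite := ⟨Q'.M.ground_finite⟩
  have : Q'.M = Q.M ／ C ↾ Q'.M.E := ext_rk rfl fun X hX => by
    rw [rk_restrict, inter_eq_self_of_subset_left hX, rk_contract, hC.indep, hC.rk X hX]
  rw [this, ← delete_compl (subset_sdiff.2 ⟨hC.ground, hC.disj.symm⟩)]
  exact contract_delete_isMinor _ _ _

lemma HasGoodMinor.of_isMinor (h : Q'.HasGoodMinor N) (h' : Q'.IsMinor Q) : Q.HasGoodMinor N := by
  obtain ⟨P, h1, h2, h3⟩ := h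
  exact ⟨P, h1, h2.trans h', h3⟩

lemma HasGoodMinor.dual (h : Q.HasGoodMinor N) : Q.dual.HasGoodMinor N✶ := by
  obtain ⟨P, h1, h2, h3⟩ := h
  exact ⟨P.dual, by rw [dual_M, h1], h2.dual, h3.dual⟩

lemma HasGoodMinor.ground (h : Q.HasGoodMinor N) : N.E ⊆ Q.M.E := by
  obtain ⟨P, rfl, h2, -⟩ := h
  exact h2.ground

/-- Contracting `x` instead of `v` yields the same minor with the same scaling, if the two
contractions have the same ranks and the three-term relations comparing their weights are all
degenerate, because one of the three products is always absent. -/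
lemma IsMinorVia.swap (h : Q'.IsMinorVia Q C) (hg : Q'.Good) (hv : v ∈ C) (hxC : x ∉ C)
    (hx : x ∈ Q.M.E) (hxE : x ∉ Q'.M.E)
    (hr : ∀ X ⊆ Q'.M.E, Q.M.rk (X ∪ insert x (C \ {v})) = Q.M.rk (X ∪ C))
    (hdeg : (∀ T ⊆ Q'.M.E, ¬ Q.M.IsBase (T ∪ (C \ {v}))) ∨
      ∀ T ⊆ Q'.M.E, ¬ Q.M.IsBase (T ∪ insert x C)) :
    ∃ Q'' : WeightedMatroid α G, Q''.M = Q'.M ∧ Q''.IsMinorVia Q (insert x (C \ {v})) ∧ Q''.Good := by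
  have hCf := h.finite
  have hcard : (insert x (C \ {v})).ncard = C.ncard := by
    rw [ncard_insert_of_notMem (fun h => hxC h.1) (hCf.subset sdiff_subset),
      ncard_sdiff_singleton_add_one hv hCf]
  have hvE : v ∉ Q'.M.E := fun hz => disjoint_left.1 h.disj hv hz
  have hxv : x ≠ v := by rintro rfl; exact hxC hv
  obtain ⟨P, hPE, hP⟩ := IsMinorVia.exists_via (Q := Q) (C := insert x (C \ {v})) h.ground
    (insert_subset hx (sdiff_subset.trans h.sub))
    (disjoint_insert_left.2 ⟨hxE, h.disj.mono_left sdiff_subset⟩)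
    (by
      have := hr ∅ (empty_subset _)
      rw [empty_union, empty_union, h.indep] at this
      rw [this, hcard])
    (by rw [hr _ subset_rfl, h.span])
  have hPM : P.M = Q'.M := ext_rk hPE fun X hX => by
    rw [hP.rk X hX, h.rk X (hPE ▸ hX), hr X (hPE ▸ hX), hcard]
  refine ⟨P, hPM, hP, ?_⟩
  obtain ⟨t, ht⟩ := hg
  refine ⟨t, fun S a b ha hb h1 h2 => ?_⟩
  by_cases hab : a = b
  · rw [hab]
  have h1' := h1
  have h2' := h2
  rw [hPM] at h1' h2'
  have r := ht S a b ha hb h1' h2'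
  rw [h.wt _ h1', h.wt _ h2'] at r
  rw [hP.wt _ h1, hP.wt _ h2]
  have b1 := (h.isBase_iff.1 h1').2
  have b2 := (h.isBase_iff.1 h2').2
  have b3 := (hP.isBase_iff.1 h1).2
  have b4 := (hP.isBase_iff.1 h2).2
  set T := S ∪ (C \ {v}) with hT
  have haE : a ∈ Q'.M.E := h1'.subset_ground (mem_insert _ _)
  have hbE : b ∈ Q'.M.E := h2'.subset_ground (mem_insert _ _)
  have hSE : S ⊆ Q'.M.E := (subset_insert _ _).trans h1'.subset_ground
  have hCa : ∀ z, z ∈ Q'.M.E → z ∉ C := fun z hz hz' => disjoint_left.1 h.disj hz' hz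
  have hi : insert v (C \ {v}) = C := by rw [insert_sdiff_singleton, insert_eq_of_mem hv]
  have e1 : ∀ a, insert a S ∪ C = insert a (insert v T) := fun a => by
    rw [hT, ← union_insert, hi, insert_union]
  have e2 : ∀ a, insert a S ∪ insert x (C \ {v}) = insert a (insert x T) := fun a => by
    rw [hT, union_insert, insert_union, insert_comm]
  rw [e1] at b1 b2 r
  rw [e1] at r
  rw [e2] at b3 b4 ⊢
  rw [e2]
  have haT : a ∉ T := by rintro (h | h); exacts [ha h, hCa a haE h.1]
  have hbT : b ∉ T := by rintro (h | h); exacts [hb h, hCa b hbE h.1]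
  have hvT : v ∉ T := by rintro (h | h); exacts [hvE (hSE h), h.2 rfl]
  have hxT : x ∉ T := by rintro (h | h); exacts [hxE (hSE h), hxC h.1]
  have hav : a ≠ v := by rintro rfl; exact hvE haE
  have hbv : b ≠ v := by rintro rfl; exact hvE hbE
  have hax : a ≠ x := by rintro rfl; exact hxE haE
  have hbx : b ≠ x := by rintro rfl; exact hxE hbE
  have ex := Q.exchange T a v b x haT hvT hbT hxT hav hab hax hbv.symm hxv.symm hbx b1 b4 b3
    (by rwa [insert_comm]) (fun h6 h7 => by
      exfalso
      rcases hdeg with hd | hd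
      · refine hd (insert a (insert b S)) (insert_subset haE (insert_subset hbE hSE)) ?_
        rwa [insert_union, insert_union]
      · refine hd S hSE ?_
        rwa [← hi, union_insert, union_insert, insert_comm])
  rw [insert_comm v b] at ex
  have : (Q.wt (insert a (insert x T)) * t b) *
        (Q.wt (insert b (insert v T)) * Q.wt (insert a (insert v T))) =
      (Q.wt (insert b (insert x T)) * t a) *
        (Q.wt (insert b (insert v T)) * Q.wt (insert a (insert v T))) := by
    calc _ = (Q.wt (insert a (insert x T)) * Q.wt (insert b (insert v T))) *
          (Q.wt (insert a (insert v T)) * t b) := by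
            simp only [mul_assoc, mul_comm, mul_left_comm]
      _ = (Q.wt (insert a (insert v T)) * Q.wt (insert b (insert x T))) *
          (Q.wt (insert b (insert v T)) * t a) := by rw [ex, r]
      _ = _ := by simp only [mul_assoc, mul_comm, mul_left_comm]
  exact mul_right_cancel this

/-- The connectivity between two sets does not increase when passing to a minor. -/
lemma IsMinorVia.rk_add_le {U V : Set α} (h : Q'.IsMinorVia Q C)
    (hC : C ⊆ U ∪ V) :
    Q'.M.rk (U ∩ Q'.M.E) + Q'.M.rk (V ∩ Q'.M.E) - Q'.M.rk Q'.M.E ≤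
      Q.M.rk U + Q.M.rk V - Q.M.rk Q.M.E := by
  rw [h.rk _ inter_subset_right, h.rk _ inter_subset_right, h.rk _ subset_rfl, h.span]
  have h1 := Q.M.rk_mono (X := U ∩ Q'.M.E ∪ C) (Y := U ∪ (C \ U)) (by
    intro z; simp only [mem_inter_iff, mem_union, mem_sdiff]; tauto)
  have h2 := Q.M.rk_mono (X := V ∩ Q'.M.E ∪ C) (Y := V ∪ (C ∩ U)) (by
    intro z; have := @hC z
    simp only [mem_inter_iff, mem_union] at this ⊢; tauto)
  have h3 := Q.M.rk_union_le U (C \ U)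
  have h4 := Q.M.rk_union_le V (C ∩ U)
  have h5 := Q.M.rk_le_ncard (h.finite.subset (sdiff_subset (t := U)))
  have h6 := Q.M.rk_le_ncard (h.finite.subset (inter_subset_left (t := U)))
  have h7 := ncard_inter_add_ncard_sdiff_eq_ncard C U h.finite
  lia

lemma IsMinorVia.conn_le (h : Q'.IsMinorVia Q C) (X : Set α) :
    Q'.M.rk (X ∩ Q'.M.E) + Q'.M.rk (Q'.M.E \ X) - Q'.M.rk Q'.M.E ≤
      Q.M.rk X + Q.M.rk (Q.M.E \ X) - Q.M.rk Q.M.E := by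
  have e : (Q.M.E \ X) ∩ Q'.M.E = Q'.M.E \ X := by
    rw [inter_comm, ← inter_sdiff_assoc, inter_eq_self_of_subset_left h.ground]
  rw [← e]
  exact h.rk_add_le (h.sub.trans (by rw [union_sdiff_self]; exact subset_union_right))

/-- A connected good minor of a connected weighted matroid is a good minor of a connected deletion
or contraction of any element outside it. -/
lemma HasGoodMinor.conn_del_or_con (hQ : Q.M.Conn) (hN : N.Conn) (hNe : N.E.Nonempty)
    (h : Q.HasGoodMinor N) (hx : x ∈ Q.M.E) (hxN : x ∉ N.E) :
    ((Q.M ＼ {x}).Conn ∧ (Q.del x).HasGoodMinor N) ∨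
      ((Q.M ／ {x}).Conn ∧ (Q.con x).HasGoodMinor N) := by
  -- the case in which `x` is deleted; if this disconnects `Q`, an element of `C` is replaced by `x`
  have main : ∀ (Q : WeightedMatroid α G) (N : Matroid α) (P : WeightedMatroid α G) (C : Set α),
      Q.M.Conn → N.Conn → N.E.Nonempty → P.M = N → P.IsMinorVia Q C → P.Good → x ∈ Q.M.E →
      x ∉ N.E → x ∉ C → ((Q.M ＼ {x}).Conn ∧ (Q.del x).HasGoodMinor N) ∨
      ((Q.M ／ {x}).Conn ∧ (Q.con x).HasGoodMinor N) := by
    rintro Q N P C hQ hN hNe rfl hC hP hx hxN hxC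
    obtain ⟨hxc, hdel⟩ := hC.of_notMem hxN hxC
    by_cases hc : (Q.M ＼ {x}).Conn
    · exact Or.inl ⟨hc, P, rfl, ⟨C, hdel⟩, hP⟩
    refine Or.inr ⟨(hQ.delete_or_contract hx).resolve_left hc, ?_⟩
    have hsep : ∃ U V : Set α, U ∪ V = Q.M.E \ {x} ∧ Disjoint U V ∧ V.Nonempty ∧
        P.M.E ⊆ U ∧ Q.M.rk U + Q.M.rk V ≤ Q.M.rk Q.M.E := by
      unfold Conn at hc
      push Not at hc
      obtain ⟨U, hU, hU1, hU2, hU3⟩ := hc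
      have hmon := hdel.conn_le U
      rw [delete_ground] at hU hU2 hU3
      rw [del_M, delete_ground] at hmon
      have hr : Q.M.rk U + Q.M.rk ((Q.M.E \ {x}) \ U) ≤ Q.M.rk Q.M.E := by
        rw [rk_deleteElem (fun h => (hU h).2 rfl), rk_deleteElem (by simp),
          rk_deleteElem (by simp), hxc] at hU3
        lia
      have hPE : P.M.E ⊆ Q.M.E \ {x} := hdel.ground
      have hcases : P.M.E ∩ U = ∅ ∨ P.M.E \ U = ∅ := by
        by_contra! hne
        have e : P.M.E \ (P.M.E ∩ U) = P.M.E \ U := by ext; simp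
        have := hN (P.M.E ∩ U) inter_subset_left hne.1 (by rw [e]; exact hne.2)
        rw [e, inter_comm] at this
        lia
      rcases hcases with h0 | h0
      · refine ⟨(Q.M.E \ {x}) \ U, U, sdiff_union_of_subset hU, disjoint_sdiff_left, hU1, ?_, ?_⟩
        · exact subset_sdiff.2 ⟨hPE, disjoint_iff_inter_eq_empty.2 h0⟩
        · lia
      · exact ⟨U, _, union_sdiff_cancel hU, disjoint_sdiff_right, hU2, sdiff_eq_empty.1 h0, hr⟩
    obtain ⟨U, V, hUV, hd, hVn, hPU, hr⟩ := hsep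
    have hUE : U ⊆ Q.M.E := (subset_union_left.trans hUV.subset).trans sdiff_subset
    have hVE : V ⊆ Q.M.E := (subset_union_right.trans hUV.subset).trans sdiff_subset
    have hCUV : C ⊆ U ∪ V := by
      rw [hUV]; exact subset_sdiff.2 ⟨hC.sub, by simpa⟩
    have hCf := hC.finite
    -- `x` is not spanned by the side of the minor
    have hxU : Q.M.rk (insert x U) = Q.M.rk U + 1 := by
      have e : Q.M.E \ insert x U = V := by
        ext z
        have h1 := Set.ext_iff.1 hUV z
        have h2 := fun h : z ∈ U => disjoint_left.1 hd h
        have h3 := @hVE z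
        simp only [mem_union, mem_sdiff, mem_singleton_iff, mem_insert_iff] at h1 ⊢
        tauto
      have := hQ (insert x U) (insert_subset hx hUE) (by simp) (by rwa [e])
      rw [e] at this
      have := Q.M.rk_insert_le x U
      lia
    have hCV : Q.M.rk (C ∩ V) = (C ∩ V).ncard := by
      have h1 := rk_eq_of_subset_indep (M := Q.M) (U := ∅) hCf (inter_subset_left (t := V))
        (by rw [empty_union, hC.indep]; simp)
      simpa using h1
    have hspan : Q.M.rk (U ∪ (C ∩ V)) = Q.M.rk Q.M.E := by
      have h1 := Q.M.rk_mono (X := P.M.E ∪ C) (Y := U ∪ (C ∩ V)) (by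
        rintro z (hz | hz)
        · exact Or.inl (hPU hz)
        · rcases hCUV hz with h | h
          · exact Or.inl h
          · exact Or.inr ⟨hz, h⟩)
      have h2 := Q.M.rk_le_rk_ground (U ∪ (C ∩ V))
      rw [hC.span] at h1
      lia
    have hind : Q.M.rk (U ∪ (C ∩ V)) = Q.M.rk U + (C ∩ V).ncard := by
      have h1 := Q.M.rk_union_le U (C ∩ V)
      have h2 := Q.M.rk_mono (inter_subset_right (s := C) (t := V))
      lia
    have hfin := hCf.subset (inter_subset_left (t := V))
    rcases exists_rk_insert_of_rk_insert_eq hfin hind hxU with h0 | ⟨v, hv, hvr⟩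
    · have := Q.M.rk_le_rk_ground (insert x (U ∪ (C ∩ V)))
      lia
    set H := U ∪ (C ∩ V) \ {v} with hH
    have hHr : Q.M.rk H = Q.M.rk Q.M.E - 1 := by
      have h1 := rk_eq_of_subset_indep (M := Q.M) hfin (sdiff_subset (t := {v})) hind
      have h2 := ncard_sdiff_singleton_add_one hv hfin
      lia
    have hvH : Q.M.rk (insert v H) = Q.M.rk H + 1 := by
      rw [hH, ← union_insert, insert_sdiff_singleton, insert_eq_of_mem hv, hspan, ← hH]
      lia
    have hsub : ∀ X ⊆ P.M.E, X ∪ (C \ {v}) ⊆ H := by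
      rintro X hX z (hz | hz)
      · exact Or.inl (hPU (hX hz))
      · rcases hCUV hz.1 with h | h
        · exact Or.inl h
        · exact Or.inr ⟨⟨hz.1, h⟩, hz.2⟩
    have hraise : ∀ w, Q.M.rk (insert w H) = Q.M.rk H + 1 → ∀ X ⊆ P.M.E,
        Q.M.rk (insert w (X ∪ (C \ {v}))) = Q.M.rk (X ∪ (C \ {v})) + 1 := by
      intro w hw X hX
      have h1 := Q.M.rk_insert_le w (X ∪ (C \ {v}))
      have h2 := Q.M.le_rk_insert w (X ∪ (C \ {v}))
      by_contra hne
      have := rk_insert_eq_of_subset (M := Q.M) (e := w) (hsub X hX) (by lia)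
      lia
    obtain ⟨P', hP', hm, hg⟩ := hC.swap (v := v) (x := x) hP hv.1 hxC hx hxN (fun X hX => by
        rw [union_insert, hraise x hvr X hX]
        have := hraise v hvH X hX
        rwa [← union_insert, insert_sdiff_singleton, insert_eq_of_mem hv.1, eq_comm] at this)
      (Or.inl fun T hT hB => by
        have h1 := Q.M.rk_mono (hsub T hT)
        have h2 := (isBase_iff_rk.1 hB).2.2
        lia)
    exact ⟨P', hP', ⟨_, (hm.of_mem (mem_insert _ _)).2⟩, hg⟩
  obtain ⟨P, hPN, ⟨C, hC⟩, hP⟩ := h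
  by_cases hxC : x ∈ C
  · have := main Q.dual N✶ P.dual _ hQ.dual (by
        have : N.Finite := hPN ▸ P.finite
        exact hN.dual) hNe (by rw [dual_M, hPN]) hC.dual hP.dual hx hxN (fun h => h.2 hxC)
    rcases this with ⟨h1, h2⟩ | ⟨h1, h2⟩
    · refine Or.inr ⟨?_, ?_⟩
      · rw [← conn_dual, dual_contract]; exact h1
      · have := h2.dual
        rwa [dual_del, dual_dual, Matroid.dual_dual] at this
    · refine Or.inl ⟨?_, ?_⟩
      · rw [← conn_dual, dual_delete]; exact h1
      · have := h2.dual
        rwa [dual_con, dual_dual, Matroid.dual_dual] at this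
  · exact main Q N P C hQ hN hNe hPN hC hP hx hxN hxC

end WeightedMatroid

end WeightedMinors

/-! ### Good minors of bad weighted matroids -/

section CloseMinors

open Set Matroid

namespace WeightedMatroid

variable {α G : Type*} [CommGroup G] {Q Q' Q'' : WeightedMatroid α G} {x y z e v : α} {C : Set α}
  {N : Matroid α}

lemma HasGoodMinor.eq_of_ground_eq (h : Q.HasGoodMinor N) (hE : N.E = Q.M.E) :
    N = Q.M ∧ Q.Good := by
  obtain ⟨P, rfl, h2, h3⟩ := h
  obtain rfl := h2.eq_of_ground_eq hE
  exact ⟨rfl, h3⟩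

/-- An element outside a loopless minor that is parallel to another element can be deleted. -/
lemma HasGoodMinor.del_of_parallel (h : Q.HasGoodMinor N) (hN : ∀ e ∈ N.E, N.NonLoop e)
    (hxN : x ∉ N.E) (hx : Q.M.NonLoop x) (he : Q.M.NonLoop e) (hxe : x ≠ e)
    (hp : ¬ Q.M.NonParallel x e) : (Q.del x).HasGoodMinor N := by
  obtain ⟨P, rfl, ⟨C, hC⟩, h3⟩ := h
  by_cases hxC : x ∈ C
  swap
  · exact ⟨P, rfl, ⟨_, (hC.of_notMem hxN hxC).2⟩, h3⟩
  have h1 : Q.M.rk (insert e {x}) = Q.M.rk {x} := by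
    have := Q.M.rk_insert_le e {x}
    have := Q.M.le_rk_insert e {x}
    rw [NonParallel, pair_comm] at hp; rw [NonLoop] at hx; lia
  have h2 : Q.M.rk (insert x {e}) = Q.M.rk {e} := by
    rw [pair_comm] at h1; rw [he, h1, hx]
  have hins : ∀ X, e ∈ X → Q.M.rk (insert x X) = Q.M.rk X := fun X hX =>
    rk_insert_eq_of_subset (singleton_subset_iff.2 hX) h2
  have hins' : ∀ X, x ∈ X → Q.M.rk (insert e X) = Q.M.rk X := fun X hX =>
    rk_insert_eq_of_subset (singleton_subset_iff.2 hX) h1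
  have heE : e ∉ P.M.E := by
    intro heE
    have := hN e heE
    rw [NonLoop, hC.rk _ (by simpa using heE), singleton_union, hins' _ hxC, hC.indep] at this
    lia
  have hdep : ∀ I : Set α, I.Finite → x ∈ I → e ∈ I → ¬ Q.M.Indep I := by
    intro I _ hxI heI hI
    have := (indep_iff_rk (toFinite _)).1 (hI.subset (pair_subset hxI heI))
    rw [h2, he, ncard_pair hxe] at this
    norm_num at this
  have heC : e ∉ C := fun heC => hdep C hC.finite hxC heC ((indep_iff_rk hC.finite).2 hC.indep)
  have hi : insert x (C \ {x}) = C := by rw [insert_sdiff_singleton, insert_eq_of_mem hxC]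
  obtain ⟨P', hP', hm, hg⟩ := hC.swap (v := x) (x := e) h3 hxC heC he.mem heE (fun X hX => by
      have e1 := hins (X ∪ insert e (C \ {x})) (by simp)
      have e2 := hins' (X ∪ C) (Or.inr hxC)
      rw [← e1, ← e2, ← union_insert, insert_comm, hi, union_insert])
    (Or.inr fun T hT hB => hdep _ (Q.M.ground_finite.subset hB.subset_ground)
      (Or.inr (mem_insert_of_mem _ hxC)) (Or.inr (mem_insert _ _)) hB.indep)
  exact ⟨P', hP', ⟨_, (hm.of_notMem (hP' ▸ hxN) (by simp [hxe])).2⟩, hg⟩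

/-- The ways in which a good minor `N` can arise from a minimal bad connected weighted matroid, up to
duality. -/
def IsCloseMinor (Q : WeightedMatroid α G) (N : Matroid α) : Prop :=
  (∃ x ∈ Q.M.E, N = Q.M ＼ {x} ∧ (Q.del x).Good) ∨
  (∃ x ∈ Q.M.E, ∃ y ∈ Q.M.E, x ≠ y ∧ (Q.M ＼ {x}).Conn ∧ (Q.M ／ {y}).Conn ∧
    N = Q.M ＼ {x} ／ {y} ∧ ((Q.del x).con y).Good) ∨
  (∃ x ∈ Q.M.E, ∃ y ∈ Q.M.E, ∃ z ∈ Q.M.E, x ≠ y ∧ x ≠ z ∧ y ≠ z ∧ (Q.M ＼ {x}).Conn ∧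
    Q.M.rk {x, y, z} = 2 ∧ N = Q.M ＼ {x} ／ {y} ／ {z} ∧ (((Q.del x).con y).con z).Good)

/-- In a minimal bad `Q`, two deletions that together keep the matroid connected and the good minor
are impossible: by minimality each of them leaves a good weighted matroid, so that `Q` is good. -/
lemma not_conn_del_del (hbad : ¬ Q.Good) (hs : Q.M.NonSeries x y) (hx : Q.M.NonLoop x)
    (hy : Q.M.NonLoop y)
    (hdx : (Q.M ＼ {x}).Conn → (Q.del x).HasGoodMinor N → (Q.del x).Good)
    (hdy : (Q.M ＼ {y}).Conn → (Q.del y).HasGoodMinor N → (Q.del y).Good) (hxy : x ≠ y)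
    (hc : (Q.M ＼ {x} ＼ {y}).Conn) (hg : ((Q.del x).del y).HasGoodMinor N) : False := by
  have key : ∀ x y, x ≠ y → Q.M.NonSeries x y → Q.M.NonLoop y → (Q.M ＼ {x} ＼ {y}).Conn →
      ((Q.del x).del y).HasGoodMinor N → (Q.M ＼ {x}).Conn ∧ (Q.del x).HasGoodMinor N := by
    intro x y hxy hs hy hc hg
    have hyc : (Q.M ＼ {x}).NonColoop y := (nonColoop_delete hs.nonColoop_left).2 hs
    exact ⟨hc.of_delete ((nonLoop_delete hxy).2 hy) hyc, hg.of_isMinor (isMinor_del hyc)⟩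
  have h1 := key x y hxy hs hy hc hg
  have h2 := key y x hxy.symm hs.symm hx (by rwa [delete_comm]) (by rwa [← Q.del_del_comm hs])
  exact hbad (Good.of_delete_delete hxy hc hs (hdx h1.1 h1.2) (hdy h2.1 h2.2))

lemma not_conn_con_con (hbad : ¬ Q.Good) (hs : Q.M.NonParallel x y) (hx : Q.M.NonColoop x)
    (hy : Q.M.NonColoop y)
    (hdx : (Q.M ／ {x}).Conn → (Q.con x).HasGoodMinor N → (Q.con x).Good)
    (hdy : (Q.M ／ {y}).Conn → (Q.con y).HasGoodMinor N → (Q.con y).Good)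
    (hc : (Q.M ／ {x} ／ {y}).Conn) (hg : ((Q.con x).con y).HasGoodMinor N) : False := by
  have hxE := hs.nonLoop_left.mem
  have hyE := hs.symm.nonLoop_left.mem
  have key : ∀ x, ((Q.M ／ {x}).Conn → (Q.con x).HasGoodMinor N → (Q.con x).Good) →
      (Q.dual.M ＼ {x}).Conn → (Q.dual.del x).HasGoodMinor N✶ → (Q.dual.del x).Good := by
    intro x h h1 h2
    have := h2.dual
    rw [Matroid.dual_dual] at this
    rw [← good_dual]
    refine h ?_ this
    rw [← conn_dual, dual_contract]; exact h1
  refine not_conn_del_del (Q := Q.dual) (x := x) (y := y) (N := N✶) (by rwa [good_dual])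
    ((nonSeries_dual hxE hyE hs.ne).2 hs) ((nonLoop_dual hxE).2 hx) ((nonLoop_dual hyE).2 hy)
    (key x hdx) (key y hdy) hs.ne ?_ ?_
  · rw [← conn_dual] at hc
    simpa [dual_contract] using hc
  · simpa using hg.dual

/-- The pairs of elements of `{y, z, w}` cannot all form a triangle or a triad with `x` whose third
elements are in general position. -/
lemma not_pairwise_triangle_or_triad {M : Matroid α} [M.Finite] {x y z w : α} (hyz : y ≠ z)
    (hyw : y ≠ w) (hzw : z ≠ w)
    (hpy : M.NonParallel x y) (hpz : M.NonParallel x z) (hpw : M.NonParallel x w)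
    (hsy : M.NonSeries x y) (hsz : M.NonSeries x z) (hsw : M.NonSeries x w)
    (p1 : (M.rk {x, y, z} = 2 ∧ M.rk {y, z, w} = 3) ∨
      (M.rk (M.E \ {x, y, z}) = M.rk M.E - 1 ∧ M.rk (M.E \ {x, z, w}) = M.rk M.E))
    (p2 : (M.rk {x, y, w} = 2 ∧ M.rk {y, w, z} = 3) ∨
      (M.rk (M.E \ {x, y, w}) = M.rk M.E - 1 ∧ M.rk (M.E \ {x, w, z}) = M.rk M.E))
    (p3 : (M.rk {x, z, w} = 2 ∧ M.rk {z, w, y} = 3) ∨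
      (M.rk (M.E \ {x, z, w}) = M.rk M.E - 1 ∧ M.rk (M.E \ {x, w, y}) = M.rk M.E)) : False := by
  -- two triangles sharing two elements lie on a line
  have hA : ∀ y z w, M.NonParallel x y → M.rk {x, y, z} = 2 → M.rk {x, y, w} = 2 →
      M.rk {y, z, w} = 3 → False := by
    intro y z w r0 h1 h2 h3
    rw [NonParallel] at r0
    have := rk_insert_eq_of_subset (M := M) (X := {x, y}) (Y := {x, y, w}) (e := z)
      (by intro; simp; tauto) (by rw [r0, ← h1]; congr 1; ext; simp; tauto)
    have r1 := M.rk_mono (X := {y, z, w}) (Y := insert z {x, y, w}) (by intro; simp; tauto)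
    lia
  have hB : ∀ y z w u v, M.NonSeries x y → M.rk (M.E \ {x, y, z}) = M.rk M.E - 1 →
      M.rk (M.E \ {x, y, w}) = M.rk M.E - 1 → z ≠ w →
      (∃ p, ({x, y, z, w} : Set α) \ {x, u, v} ⊆ {p}) →
      M.rk (M.E \ {x, u, v}) = M.rk M.E → False := by
    rintro y z w u v r0 h1 h2 hzw ⟨p, hp⟩ h3
    rw [NonSeries] at r0
    have s := M.rk_submod (M.E \ {x, y, z}) (M.E \ {x, y, w})
    have e1 : (M.E \ {x, y, z}) ∩ (M.E \ {x, y, w}) = M.E \ {x, y, z, w} := by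
      ext; simp; tauto
    have e2 : (M.E \ {x, y, z}) ∪ (M.E \ {x, y, w}) = M.E \ {x, y} := by
      ext t; simp; by_cases t = z <;> by_cases t = w <;> grind
    rw [e1, e2] at s
    have r1 := M.rk_insert_le p (M.E \ {x, y, z, w})
    have r2 := M.rk_mono (X := M.E \ {x, u, v}) (Y := insert p (M.E \ {x, y, z, w})) (by
      intro t ht
      by_cases h : t ∈ ({x, y, z, w} : Set α)
      · exact Or.inl (hp ⟨h, ht.2⟩)
      · exact Or.inr ⟨ht.1, h⟩)
    lia
  rcases p1 with p1 | p1 <;> rcases p2 with p2 | p2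
  · exact hA y z w hpy p1.1 p2.1 p1.2
  · rcases p3 with p3 | p3
    · exact hA z y w hpz (by rw [pair_comm, p1.1]) p3.1 (by rw [insert_comm, p1.2])
    · exact hB w y z w y hsw (by rw [pair_comm, p2.1]) (by rw [pair_comm, p3.1]) hyz
        ⟨z, by intro; simp; tauto⟩ p3.2
  · rcases p3 with p3 | p3
    · refine hA w y z hpw (by rw [pair_comm, p2.1]) (by rw [pair_comm, p3.1]) ?_
      rw [← p2.2]; congr 1; ext; simp; tauto
    · exact hB z y w w y hsz (by rw [pair_comm, p1.1]) p3.1 hyw ⟨z, by intro; simp; tauto⟩ p3.2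
  · exact hB y z w z w hsy p1.1 p2.1 hzw ⟨y, by intro; simp; tauto⟩ p1.2

/-- If `Q` is bad, but every connected deletion or contraction that keeps the good minor `N` is good,
then `N` is obtained by removing at most three elements. -/
lemma isCloseMinor_of_minimal (hQ : Q.M.Conn) (hN : N.Conn) (hNe : N.E.Nonempty)
    (hg : Q.HasGoodMinor N) (hbad : ¬ Q.Good)
    (hdel : ∀ x ∈ Q.M.E \ N.E, (Q.M ＼ {x}).Conn → (Q.del x).HasGoodMinor N → (Q.del x).Good)
    (hcon : ∀ x ∈ Q.M.E \ N.E, (Q.M ／ {x}).Conn → (Q.con x).HasGoodMinor N → (Q.con x).Good)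
    (hpar : ∀ x ∈ Q.M.E \ N.E, ∀ e ∈ Q.M.E, x ≠ e → Q.M.NonParallel x e)
    (hser : ∀ x ∈ Q.M.E \ N.E, ∀ e ∈ Q.M.E, x ≠ e → Q.M.NonSeries x e) :
    Q.IsCloseMinor N ∨ Q.dual.IsCloseMinor N✶ := by
  -- the case in which the deletion of some element `x` is connected and keeps `N`
  have main : ∀ (Q : WeightedMatroid α G) (N : Matroid α), Q.M.Conn → N.Conn → N.E.Nonempty →
      Q.HasGoodMinor N → ¬ Q.Good →
      (∀ x ∈ Q.M.E \ N.E, (Q.M ＼ {x}).Conn → (Q.del x).HasGoodMinor N → (Q.del x).Good) →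
      (∀ x ∈ Q.M.E \ N.E, (Q.M ／ {x}).Conn → (Q.con x).HasGoodMinor N → (Q.con x).Good) →
      (∀ x ∈ Q.M.E \ N.E, ∀ e ∈ Q.M.E, x ≠ e → Q.M.NonParallel x e) →
      (∀ x ∈ Q.M.E \ N.E, ∀ e ∈ Q.M.E, x ≠ e → Q.M.NonSeries x e) →
      ∀ x ∈ Q.M.E \ N.E, (Q.M ＼ {x}).Conn → (Q.del x).HasGoodMinor N →
      Q.IsCloseMinor N ∨ Q.dual.IsCloseMinor N✶ := by
    intro Q N hQ hN hNe hg hbad hdel hcon hpar hser x hx hxc hxg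
    have hNQ := hg.ground
    by_cases h1 : Q.M.E \ N.E = {x}
    · have hE : N.E = (Q.del x).M.E := by
        rw [del_M, delete_ground, ← h1, sdiff_sdiff_cancel_left hNQ]
      obtain ⟨h2, h3⟩ := hxg.eq_of_ground_eq hE
      exact Or.inl (Or.inl ⟨x, hx.1, h2, h3⟩)
    obtain ⟨n, hn⟩ := hNe
    have hnx : n ≠ x := by rintro rfl; exact hx.2 hn
    have hxL := (hpar x hx n (hNQ hn) hnx.symm).nonLoop_left
    have hxC := (hser x hx n (hNQ hn) hnx.symm).nonColoop_left
    have hL : ∀ y ∈ Q.M.E \ N.E, Q.M.NonLoop y := fun y hy =>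
      (hpar y hy n (hNQ hn) (by rintro rfl; exact hy.2 hn)).nonLoop_left
    have hC : ∀ y ∈ Q.M.E \ N.E, Q.M.NonColoop y := fun y hy =>
      (hser y hy n (hNQ hn) (by rintro rfl; exact hy.2 hn)).nonColoop_left
    have F1 : ∀ y ∈ Q.M.E \ N.E, ∀ z ∈ Q.M.E \ N.E, y ≠ z → (Q.M ＼ {y} ＼ {z}).Conn →
        ((Q.del y).del z).HasGoodMinor N → False := fun y hy z hz hyz hc hg =>
      not_conn_del_del hbad (hser y hy z hz.1 hyz) (hL y hy) (hL z hz) (hdel y hy) (hdel z hz)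
        hyz hc hg
    have F1' : ∀ y ∈ Q.M.E \ N.E, ∀ z ∈ Q.M.E \ N.E, y ≠ z → (Q.M ／ {y} ／ {z}).Conn →
        ((Q.con y).con z).HasGoodMinor N → False := fun y hy z hz hyz hc hg =>
      not_conn_con_con hbad (hpar y hy z hz.1 hyz) (hC y hy) (hC z hz) (hcon y hy) (hcon z hz)
        hc hg
    have hy1 : ∀ y ∈ Q.M.E \ N.E, x ≠ y → (Q.M ＼ {x} ／ {y}).Conn ∧
        ((Q.del x).con y).HasGoodMinor N := fun y hy hxy =>
      (hxg.conn_del_or_con hxc hN ⟨n, hn⟩ ⟨hy.1, hxy.symm⟩ hy.2).resolve_left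
        fun h => F1 x hx y hy hxy h.1 h.2
    obtain ⟨y, hy, hxy⟩ : ∃ y ∈ Q.M.E \ N.E, x ≠ y := by
      by_contra! hall
      exact h1 (subset_antisymm (fun z hz => (hall z hz).symm) (by simpa using hx))
    by_cases h2 : Q.M.E \ N.E = {x, y}
    · have hE : N.E = ((Q.del x).con y).M.E := by
        rw [con_M, contract_ground, del_M, delete_ground, sdiff_sdiff, singleton_union, ← h2,
          sdiff_sdiff_cancel_left hNQ]
      obtain ⟨h3, h4⟩ := hy1 y hy hxy
      obtain ⟨h5, h6⟩ := h4.eq_of_ground_eq hE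
      refine Or.inl (Or.inr (Or.inl ⟨x, hx.1, y, hy.1, hxy, hxc, ?_, h5, h6⟩))
      rw [← contract_delete_comm _ (by simpa using hxy.symm)] at h3
      exact h3.of_delete ((nonLoop_contract (hL y hy)).2 (hpar y hy x hx.1 hxy.symm))
        ((nonColoop_contract hy.1 hxy.symm).2 hxC)
    obtain ⟨z, hz, hxz, hyz⟩ : ∃ z ∈ Q.M.E \ N.E, x ≠ z ∧ y ≠ z := by
      by_contra! hall
      refine h2 (subset_antisymm (fun z hz => ?_) (pair_subset hx hy))
      by_cases hxz : x = z
      · simp [hxz]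
      · simp [hall z hz hxz]
    -- removing three elements, `x` among them, there is a choice between deletion and contraction;
    -- unless `x` forms a triangle or a triad with the other two, it leads to one of the excluded pairs
    have hpair : ∀ y ∈ Q.M.E \ N.E, ∀ z ∈ Q.M.E \ N.E, x ≠ y → x ≠ z → y ≠ z →
        (Q.M.rk {x, y, z} = 2 ∧ (Q.M ＼ {x} ／ {y} ／ {z}).Conn ∧
          (((Q.del x).con y).con z).HasGoodMinor N) ∨
        (Q.M.rk (Q.M.E \ {x, y, z}) = Q.M.rk Q.M.E - 1 ∧ (Q.M ＼ {x} ＼ {z} ／ {y}).Conn ∧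
          (((Q.del x).del z).con y).HasGoodMinor N) := by
      intro y hy z hz hxy hxz hyz
      obtain ⟨h3, h4⟩ := hy1 y hy hxy
      have hyx : (Q.M ＼ {x}).NonLoop y := (nonLoop_delete hxy).2 (hL y hy)
      rcases h4.conn_del_or_con h3 hN ⟨n, hn⟩ (x := z) ⟨⟨hz.1, hxz.symm⟩, hyz.symm⟩ hz.2 with h | h
      · right
        have hzx : (Q.M ＼ {x}).NonColoop z :=
          (nonColoop_delete hxC).2 (hser x hx z hz.1 hxz)
        have e1 : ((Q.del x).con y).M ＼ {z} = Q.M ＼ {x} ＼ {z} ／ {y} := by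
          rw [con_M, del_M, contract_delete_comm _ (by simpa using hyz)]
        have e2 : ((Q.del x).con y).del z = ((Q.del x).del z).con y :=
          ((Q.del x).del_con_comm hzx hyx hyz.symm).symm
        rw [e1, e2] at h
        refine ⟨?_, h⟩
        by_contra hne
        have hsub : Q.M.E \ {x, y, z} = (Q.M.E \ {x, z}) \ {y} := by ext; simp; tauto
        have r1 := Q.M.rk_diff_singleton_ge y (Q.M.E \ {x, z})
        have r2 : Q.M.rk (Q.M.E \ {x, z}) = _ := hser x hx z hz.1 hxz
        have r3 := Q.M.rk_le_rk_ground (Q.M.E \ {x, y, z})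
        rw [← hsub] at r1
        have e3 : (Q.M ＼ {x} ＼ {z}).E \ {y} = Q.M.E \ {x, y, z} := by
          ext; simp; tauto
        have hyc : (Q.M ＼ {x} ＼ {z}).NonColoop y := by
          rw [NonColoop, hzx.rk_delete_ground, hxC.rk_delete_ground, e3,
            rk_deleteElem (by simp), rk_deleteElem (by simp)]
          lia
        have hyl : (Q.M ＼ {x} ＼ {z}).NonLoop y := (nonLoop_delete hyz.symm).2 hyx
        exact F1 x hx z hz hxz (h.1.of_contract hyl hyc) (h.2.of_isMinor (isMinor_con hyl))
      · left
        refine ⟨?_, h⟩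
        by_contra hne
        have hyz' := hpar y hy z hz.1 hyz
        have r1 := Q.M.rk_insert_le x {y, z}
        have r2 := Q.M.le_rk_insert x {y, z}
        rw [hyz'] at r1 r2
        have hxc' : (Q.M ／ {y}).NonColoop x := (nonColoop_contract hy.1 hxy.symm).2 hxC
        have hzl : (Q.M ／ {y}).NonLoop z := (nonLoop_contract (hL y hy)).2 hyz'
        have hxl'' : (Q.M ／ {y} ／ {z}).NonLoop x := by
          rw [nonLoop_contract hzl, nonParallel_contract (hL y hy),
            show ({y, z, x} : Set α) = {x, y, z} by ext; simp; tauto]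
          lia
        have hxc'' : (Q.M ／ {y} ／ {z}).NonColoop x :=
          (nonColoop_contract (M := Q.M ／ {y}) ⟨hz.1, hyz.symm⟩ hxz.symm).2 hxc'
        have e1 : ((Q.del x).con y).M ／ {z} = Q.M ／ {y} ／ {z} ＼ {x} := by
          rw [con_M, del_M,
            ← contract_delete_comm Q.M (disjoint_singleton.2 hxy.symm),
            ← contract_delete_comm (Q.M ／ {y}) (disjoint_singleton.2 hxz.symm)]
        have e2 : ((Q.del x).con y).con z = ((Q.con y).con z).del x := by
          rw [Q.del_con_comm hxC (hL y hy) hxy, (Q.con y).del_con_comm hxc' hzl hxz]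
        rw [e1, e2] at h
        exact F1' y hy z hz hyz (h.1.of_delete hxl'' hxc'') (h.2.of_isMinor (isMinor_del hxc''))
    by_cases h3 : Q.M.E \ N.E = {x, y, z}
    · have hE : N.E = ((Q.M.E \ {x}) \ {y}) \ {z} := by
        rw [sdiff_sdiff, sdiff_sdiff, ← sdiff_sdiff_cancel_left hNQ, h3]; congr 1
      rcases hpair y hy z hz hxy hxz hyz with ⟨r, h4, h5⟩ | ⟨r, h4, h5⟩
      · obtain ⟨h6, h7⟩ := h5.eq_of_ground_eq hE
        exact Or.inl (Or.inr (Or.inr ⟨x, hx.1, y, hy.1, z, hz.1, hxy, hxz, hyz, hxc, r, h6, h7⟩))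
      · have hzx : (Q.M ＼ {x}).NonColoop z := (nonColoop_delete hxC).2 (hser x hx z hz.1 hxz)
        have hyx : (Q.M ＼ {x}).NonLoop y := (nonLoop_delete hxy).2 (hL y hy)
        have hxc' : (Q.M ／ {y}).NonColoop x := (nonColoop_contract hy.1 hxy.symm).2 hxC
        have e2 : ((Q.del x).del z).con y = ((Q.con y).del x).del z := by
          rw [(Q.del x).del_con_comm hzx hyx hyz.symm, Q.del_con_comm hxC (hL y hy) hxy]
        rw [e2] at h5
        obtain ⟨h6, h7⟩ := h5.eq_of_ground_eq (by rw [hE]; simp [sdiff_sdiff]; congr 1; grind)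
        refine Or.inr (Or.inr (Or.inr ⟨y, hy.1, x, hx.1, z, hz.1, hxy.symm, hyz, hxz, ?_, ?_, ?_, ?_⟩))
        · rw [dual_M, ← conn_dual, dual_delete, Matroid.dual_dual]
          have := (hy1 y hy hxy).1
          rw [← contract_delete_comm _ (by simpa using hxy.symm)] at this
          exact this.of_delete ((nonLoop_contract (hL y hy)).2 (hpar y hy x hx.1 hxy.symm)) hxc'
        · rw [dual_M, rk_dual _ (by simp [insert_subset_iff, hx.1, hy.1, hz.1]), insert_comm y, r,
            ncard_insert_of_notMem (by simp [hxy, hxz]), ncard_pair hyz]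
          push_cast; lia
        · rw [h6]; simp [dual_delete]
        · rw [← good_dual]
          simpa using h7
    obtain ⟨w, hw, hxw, hyw, hzw⟩ : ∃ w ∈ Q.M.E \ N.E, x ≠ w ∧ y ≠ w ∧ z ≠ w := by
      by_contra! hall
      refine h3 (subset_antisymm (fun w hw => ?_) ?_)
      · by_cases hxw : x = w
        · simp [hxw]
        by_cases hyw : y = w
        · simp [hyw]
        simp [hall w hw hxw hyw]
      · simp [insert_subset_iff, hx, hy, hz]
    exfalso
    -- the remaining minor is connected, so that a further element `w` is neither a loop nor a coloop
    have hpair' : ∀ y ∈ Q.M.E \ N.E, ∀ z ∈ Q.M.E \ N.E, ∀ w ∈ Q.M.E \ N.E, x ≠ y → x ≠ z →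
        x ≠ w → y ≠ z → y ≠ w → z ≠ w →
        (Q.M.rk {x, y, z} = 2 ∧ Q.M.rk {y, z, w} = 3) ∨
        (Q.M.rk (Q.M.E \ {x, y, z}) = Q.M.rk Q.M.E - 1 ∧
          Q.M.rk (Q.M.E \ {x, z, w}) = Q.M.rk Q.M.E) := by
      intro y hy z hz w hw hxy hxz hxw hyz hyw hzw
      have hyx : (Q.M ＼ {x}).NonLoop y := (nonLoop_delete hxy).2 (hL y hy)
      have hzx : (Q.M ＼ {x}).NonColoop z := (nonColoop_delete hxC).2 (hser x hx z hz.1 hxz)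
      rcases hpair y hy z hz hxy hxz hyz with ⟨r, h4, -⟩ | ⟨r, h4, -⟩
      · refine Or.inl ⟨r, ?_⟩
        have hwl := h4.nonLoop (x := w) (by simp [hw.1, hxw.symm, hyw.symm, hzw.symm])
          ⟨n, ⟨⟨⟨hNQ hn, hnx⟩, by rintro rfl; exact hy.2 hn⟩, by rintro rfl; exact hz.2 hn⟩,
            by rintro rfl; exact hw.2 hn⟩
        have hzl : (Q.M ＼ {x} ／ {y}).NonLoop z := by
          rw [nonLoop_contract hyx, nonParallel_delete hxy hxz]
          exact hpar y hy z hz.1 hyz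
        rw [nonLoop_contract hzl, nonParallel_contract hyx, rk_deleteElem] at hwl
        · exact hwl
        · simp [*]
      · refine Or.inr ⟨r, ?_⟩
        have hwc := h4.nonColoop (x := w) (by simp [hw.1, hxw.symm, hyw.symm, hzw.symm])
          ⟨n, ⟨⟨⟨hNQ hn, hnx⟩, by rintro rfl; exact hz.2 hn⟩, by rintro rfl; exact hy.2 hn⟩,
            by rintro rfl; exact hw.2 hn⟩
        rw [nonColoop_contract (by simp [hy.1, hxy.symm, hyz]) hyw, NonColoop, hzx.rk_delete_ground,
          hxC.rk_delete_ground, rk_deleteElem (by simp), rk_deleteElem (by simp)] at hwc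
        rw [← hwc]
        congr 1
        ext; simp; tauto
    exact not_pairwise_triangle_or_triad hyz hyw hzw (hpar x hx y hy.1 hxy) (hpar x hx z hz.1 hxz)
      (hpar x hx w hw.1 hxw) (hser x hx y hy.1 hxy) (hser x hx z hz.1 hxz) (hser x hx w hw.1 hxw)
      (hpair' y hy z hz w hw hxy hxz hxw hyz hyw hzw)
      (hpair' y hy w hw z hz hxy hxw hxz hyw hyz hzw.symm)
      (hpair' z hz w hw y hy hxz hxw hxy hzw hyz.symm hyw.symm)
  obtain ⟨x, hx⟩ : (Q.M.E \ N.E).Nonempty := by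
    rw [nonempty_iff_ne_empty, Ne, sdiff_eq_empty]
    exact fun h => hbad (hg.eq_of_ground_eq (hg.ground.antisymm h)).2
  rcases hg.conn_del_or_con hQ hN hNe hx.1 hx.2 with h | h
  · exact main Q N hQ hN hNe hg hbad hdel hcon hpar hser x hx h.1 h.2
  · have hf : N.Finite := by obtain ⟨P, rfl, -⟩ := hg; infer_instance
    have := main Q.dual N✶ hQ.dual hN.dual hNe hg.dual (by rwa [good_dual])
      (fun x hx h1 h2 => by
        rw [← good_dual]
        have := h2.dual
        rw [Matroid.dual_dual] at this
        refine hcon x hx ?_ this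
        rw [← conn_dual, dual_contract]; exact h1)
      (fun x hx h1 h2 => by
        rw [← good_dual, dual_con, dual_dual]
        have := h2.dual
        rw [Matroid.dual_dual, dual_con, dual_dual] at this
        refine hdel x hx ?_ this
        rw [← conn_dual, dual_delete]; exact h1)
      (fun x hx e he hxe => (nonParallel_dual (M := Q.M) hx.1 he hxe).2 (hser x hx e he hxe))
      (fun x hx e he hxe => (nonSeries_dual (M := Q.M) hx.1 he hxe).2 (hpar x hx e he hxe))
      x hx (by rw [dual_M, ← dual_contract, conn_dual]; exact h.1)
      (by simpa using h.2.dual)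
    simpa [or_comm] using this

end WeightedMatroid

end CloseMinors

/-! ### Isomorphic copies and small obstructions -/

section Isomorphism

open Set

namespace Matroid

variable {α β : Type*} {N : Matroid β} {M M' : Matroid α} {b c x : α}

lemma IsIsomorphic.refl (M : Matroid α) : M.IsIsomorphic M :=
  ⟨Equiv.refl _, fun I => by rw [Equiv.coe_refl, image_id]⟩

lemma isIsomorphic_map (N : Matroid β) {f : β → α} (hf : InjOn f N.E) :
    N.IsIsomorphic (N.map f hf) := by
  have hb : BijOn f N.E (N.map f hf).E := hf.bijOn_image
  refine ⟨hb.equiv f, fun I => ?_⟩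
  have e : (Subtype.val '' (hb.equiv f '' I) : Set α) = f '' (Subtype.val '' I) := by
    simp only [image_image]; rfl
  have hI : (Subtype.val '' I : Set β) ⊆ N.E := by rintro _ ⟨z, -, rfl⟩; exact z.2
  rw [e, map_image_indep_iff hI]

lemma IsIsomorphic.exists_map (h : N.IsIsomorphic M) (hne : N.E.Nonempty) :
    ∃ f : β → α, ∃ hf : InjOn f N.E, M = N.map f hf := by
  classical
  obtain ⟨e, he⟩ := h
  obtain ⟨n, hn⟩ := hne
  set f : β → α := fun z => if hz : z ∈ N.E then e ⟨z, hz⟩ else e ⟨n, hn⟩ with hfdef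
  have hfe : ∀ z (hz : z ∈ N.E), f z = e ⟨z, hz⟩ := fun z hz => dif_pos hz
  have hf : InjOn f N.E := by
    intro z hz w hw hzw
    rw [hfe z hz, hfe w hw] at hzw
    simpa using e.injective (Subtype.ext hzw)
  have him : ∀ I : Set N.E, (Subtype.val '' (e '' I) : Set α) = f '' (Subtype.val '' I) := by
    intro I
    simp only [image_image]
    exact image_congr fun z _ => (hfe z z.2).symm
  refine ⟨f, hf, ext_indep ?_ ?_⟩
  · have := him univ
    simpa using this
  · intro I hI
    have e1 : I = Subtype.val '' (e '' (e.symm '' (Subtype.val ⁻¹' I))) := by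
      rw [Equiv.image_symm_image, Subtype.image_preimage_coe, inter_eq_self_of_subset_right hI]
    have hJ : (Subtype.val '' (e.symm '' (Subtype.val ⁻¹' I)) : Set β) ⊆ N.E := by
      rintro _ ⟨z, -, rfl⟩; exact z.2
    rw [e1, ← he, him, map_image_indep_iff hJ]

lemma IsIsomorphic.nonempty (h : N.IsIsomorphic M) (hne : N.E.Nonempty) : M.E.Nonempty := by
  obtain ⟨f, hf, rfl⟩ := h.exists_map hne
  simpa using hne

lemma IsIsomorphic.ncard_eq (h : N.IsIsomorphic M) : M.E.ncard = N.E.ncard := by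
  obtain ⟨e, -⟩ := h
  rw [← Nat.card_coe_set_eq, ← Nat.card_coe_set_eq, Nat.card_congr e]

lemma IsIsomorphic.dual (h : N.IsIsomorphic M) (hne : N.E.Nonempty) : N✶.IsIsomorphic M✶ := by
  obtain ⟨f, hf, rfl⟩ := h.exists_map hne
  rw [map_dual]
  exact isIsomorphic_map N✶ hf

lemma rk_map (N : Matroid β) {f : β → α} (hf : InjOn f N.E) {X : Set β} (hX : X ⊆ N.E) :
    (N.map f hf).rk (f '' X) = N.rk X := by
  rw [rk, rk, eRk_map N hf hX]

lemma IsIsomorphic.conn3 (h : N.IsIsomorphic M) (hne : N.E.Nonempty) (hN : N.Conn3) :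
    M.Conn3 := by
  obtain ⟨f, hf, rfl⟩ := h.exists_map hne
  have key : ∀ X ⊆ N.E, (N.map f hf).E \ f '' X = f '' (N.E \ X) := fun X hX => by
    rw [map_ground, hf.image_sdiff_subset hX]
  refine ⟨?_, ?_⟩
  · intro X hX h1 h2
    obtain ⟨Y, hY, rfl⟩ := subset_image_iff.1 hX
    rw [key Y hY] at h2 ⊢
    rw [map_ground, rk_map N hf hY, rk_map N hf sdiff_subset, rk_map N hf subset_rfl]
    exact hN.1 Y hY (by simpa using h1) (by simpa using h2)
  · intro X hX h1 h2
    obtain ⟨Y, hY, rfl⟩ := subset_image_iff.1 hX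
    rw [key Y hY] at h2 ⊢
    rw [(hf.mono sdiff_subset).ncard_image] at h2
    rw [(hf.mono hY).ncard_image] at h1
    rw [map_ground, rk_map N hf hY, rk_map N hf sdiff_subset, rk_map N hf subset_rfl]
    exact hN.2 Y hY h1 h2

lemma IsIsomorphic.of_map (h : N.IsIsomorphic M) (σ : Equiv.Perm α)
    (hE : M'.E = σ '' M.E) (hi : ∀ I ⊆ M.E, M.Indep I ↔ M'.Indep (σ '' I)) :
    N.IsIsomorphic M' := by
  obtain ⟨e, he⟩ := h
  have hM : M.IsIsomorphic M' := by
    have : M' = M.map σ σ.injective.injOn := by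
      refine ext_indep (by simp [hE]) fun I hI => ?_
      rw [hE] at hI
      obtain ⟨J, hJ, rfl⟩ := subset_image_iff.1 hI
      rw [map_image_indep_iff hJ, hi J hJ]
    rw [this]
    exact isIsomorphic_map _ _
  obtain ⟨e', he'⟩ := hM
  have ht : ∀ I, e.trans e' '' I = e' '' (e '' I) := fun I => by rw [← image_comp]; rfl
  exact ⟨e.trans e', fun I => by rw [ht, he, he']⟩

lemma indep_swap_iff [M.Finite] [DecidableEq α] (hp : ∀ X : Set α, M.rk (insert b X) = M.rk (insert c X))
    {I : Set α} (hI : I ⊆ M.E) (hb : b ∉ I) (hbE : b ∈ M.E) :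
    M.Indep I ↔ M.Indep (Equiv.swap b c '' I) := by
  have hf := M.ground_finite.subset hI
  rw [indep_iff_rk hf, indep_iff_rk (hf.image _),
    ncard_image_of_injective _ (Equiv.swap b c).injective]
  by_cases hc : c ∈ I
  · have e1 : Equiv.swap b c '' I = insert b (I \ {c}) := by
      ext z
      simp only [mem_image, mem_insert_iff, mem_sdiff, mem_singleton_iff]
      constructor
      · rintro ⟨w, hw, rfl⟩
        by_cases hwc : w = c
        · simp [hwc]
        · have hwb : w ≠ b := by rintro rfl; exact hb hw
          rw [Equiv.swap_apply_of_ne_of_ne hwb hwc]; tauto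
      · rintro (rfl | ⟨h1, h2⟩)
        · exact ⟨c, hc, by simp⟩
        · exact ⟨z, h1, Equiv.swap_apply_of_ne_of_ne (by rintro rfl; exact hb h1) h2⟩
    rw [e1, hp, insert_sdiff_singleton, insert_eq_of_mem hc]
  · have e1 : Equiv.swap b c '' I = I := by
      have : ∀ w ∈ I, Equiv.swap b c w = w := fun w hw =>
        Equiv.swap_apply_of_ne_of_ne (by rintro rfl; exact hb hw) (by rintro rfl; exact hc hw)
      rw [image_congr this]; simp
    rw [e1]

/-- Interchanging two parallel elements is an automorphism. -/
lemma IsIsomorphic.delete_swap [M.Finite] (h : N.IsIsomorphic (M ＼ {b})) (hb : M.NonLoop b)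
    (hc : M.NonLoop c) (hbc : b ≠ c) (hp : ¬ M.NonParallel b c) : N.IsIsomorphic (M ＼ {c}) := by
  classical
  have hr : ∀ X : Set α, M.rk (insert b X) = M.rk (insert c X) := by
    intro X
    have h0 := M.rk_pair_le b c
    have h1 := M.rk_mono (X := {b}) (Y := {b, c}) (by simp)
    rw [hb] at h1
    rw [NonParallel] at hp
    have h2 := rk_insert_eq_of_subset (M := M) (X := {c}) (Y := insert c X) (e := b) (by simp)
      (by rw [hc]; lia)
    have h3 := rk_insert_eq_of_subset (M := M) (X := {b}) (Y := insert b X) (e := c) (by simp)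
      (by rw [hb, pair_comm]; lia)
    rw [← h2, ← h3, insert_comm]
  refine h.of_map (Equiv.swap b c) ?_ fun I hI => ?_
  · ext z
    simp only [delete_ground, mem_image, mem_sdiff, mem_singleton_iff]
    constructor
    · rintro ⟨h1, h2⟩
      by_cases hzb : z = b
      · exact ⟨c, ⟨hc.mem, hbc.symm⟩, by simp [hzb]⟩
      · exact ⟨z, ⟨h1, hzb⟩, Equiv.swap_apply_of_ne_of_ne hzb h2⟩
    · rintro ⟨w, ⟨h1, h2⟩, rfl⟩
      by_cases hwc : w = c
      · simpa [hwc] using ⟨hb.mem, hbc⟩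
      · rw [Equiv.swap_apply_of_ne_of_ne h2 hwc]; exact ⟨h1, hwc⟩
  · rw [delete_ground, subset_sdiff, disjoint_singleton_right] at hI
    have hc' : c ∉ Equiv.swap b c '' I := by
      rintro ⟨w, hw, hwc⟩
      have : w = b := by
        have := congrArg (Equiv.swap b c) hwc
        simpa using this
      exact hI.2 (this ▸ hw)
    rw [delete_indep_iff, delete_indep_iff, disjoint_singleton_right, disjoint_singleton_right,
      indep_swap_iff hr hI.1 hI.2 hb.mem]
    simp [hI.2]

/-- Interchanging two elements in series is an automorphism. -/
lemma IsIsomorphic.contract_swap [M.Finite] (h : N.IsIsomorphic (M ／ {b})) (hne : N.E.Nonempty)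
    (hb : M.NonColoop b) (hc : M.NonColoop c) (hbE : b ∈ M.E) (hcE : c ∈ M.E) (hbc : b ≠ c)
    (hp : ¬ M.NonSeries b c) : N.IsIsomorphic (M ／ {c}) := by
  have h1 := h.dual hne
  rw [dual_contract] at h1
  have := (h1.delete_swap ((nonLoop_dual hbE).2 hb) ((nonLoop_dual hcE).2 hc) hbc
    (by rwa [nonParallel_dual hbE hcE hbc])).dual (by simpa)
  rwa [Matroid.dual_dual, dual_delete, Matroid.dual_dual] at this

lemma contract_delete_of_parallel [M.Finite] (hb : M.NonLoop b) (hc : M.NonLoop c)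
    (hbc : b ≠ c) (hp : ¬ M.NonParallel b c) : M ＼ {b} ／ {c} = M ＼ {c} ／ {b} := by
  have h0 := M.rk_pair_le b c
  have h1 := M.rk_mono (X := {b}) (Y := {b, c}) (by simp)
  rw [hb] at h1
  rw [NonParallel] at hp
  have hc' : (M ＼ {b}).NonLoop c := (nonLoop_delete hbc).2 hc
  have hb' : (M ＼ {c}).NonLoop b := (nonLoop_delete hbc.symm).2 hb
  refine ext_rk (by simp only [contract_ground, delete_ground]; ext; simp; tauto) fun X hX => ?_
  simp only [contract_ground, delete_ground] at hX
  rw [rk_contractElem, rk_contractElem, hc', hb', rk_deleteElem, rk_deleteElem]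
  · have h2 := rk_insert_eq_of_subset (M := M) (X := {c}) (Y := insert c X) (e := b) (by simp)
      (by rw [hc]; lia)
    have h3 := rk_insert_eq_of_subset (M := M) (X := {b}) (Y := insert b X) (e := c) (by simp)
      (by rw [hb, pair_comm]; lia)
    rw [← h2, ← h3, insert_comm]
  · rintro (h | h)
    · exact hbc h.symm
    · exact (hX h).2 rfl
  · rintro (h | h)
    · exact hbc h
    · exact (hX h).1.2 rfl

end Matroid

open Matroid

namespace WeightedMatroid

variable {α β G : Type*} [CommGroup G] {Q Q' P : WeightedMatroid α G} {x y z a b c e : α}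
  {N : Matroid β} {N' : Matroid α}

/-- Some minor isomorphic to `N` is good. -/
def HasGoodCopy (Q : WeightedMatroid α G) (N : Matroid β) : Prop :=
  ∃ N' : Matroid α, N.IsIsomorphic N' ∧ Q.HasGoodMinor N'

lemma HasGoodCopy.dual (h : Q.HasGoodCopy N) (hne : N.E.Nonempty) : Q.dual.HasGoodCopy N✶ := by
  obtain ⟨N', h1, h2⟩ := h
  exact ⟨_, h1.dual hne, h2.dual⟩

/-- The second alternative of the stabilizer theorem: a bad `3`-connected weighted minor that
exceeds `N` by one element, or by two elements in the specified way. -/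
def HasSmallObstruction (Q : WeightedMatroid α G) (N : Matroid β) : Prop :=
  ∃ P : WeightedMatroid α G, P.IsMinor Q ∧ P.M.Conn3 ∧ ¬ P.Good ∧
    ((∃ x ∈ P.M.E, N.IsIsomorphic (P.M ／ {x}) ∧ (P.con x).Good) ∨
     (∃ y ∈ P.M.E, N.IsIsomorphic (P.M ＼ {y}) ∧ (P.del y).Good) ∨
     (∃ x ∈ P.M.E, ∃ y ∈ P.M.E, x ≠ y ∧ N.IsIsomorphic (P.M ／ {x} ＼ {y}) ∧
        ((P.con x).del y).Good ∧ ((P.M ／ {x}).Conn3 ∨ (P.M ＼ {y}).Conn3)))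

lemma HasSmallObstruction.of_isMinor (h : Q'.HasSmallObstruction N) (h' : Q'.IsMinor Q) :
    Q.HasSmallObstruction N := by
  obtain ⟨P, h1, h2⟩ := h
  exact ⟨P, h1.trans h', h2⟩

lemma HasSmallObstruction.dual (h : Q.HasSmallObstruction N) (hne : N.E.Nonempty) :
    Q.dual.HasSmallObstruction N✶ := by
  obtain ⟨P, h1, h2, h3, h4⟩ := h
  refine ⟨P.dual, h1.dual, h2.dual, by rwa [good_dual], ?_⟩
  rcases h4 with ⟨x, hx, hi, hg⟩ | ⟨x, hx, hi, hg⟩ | ⟨x, hx, y, hy, hxy, hi, hg, hc⟩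
  · exact Or.inr (Or.inl ⟨x, hx, by simpa using hi.dual hne, by simpa using hg.dual⟩)
  · exact Or.inl ⟨x, hx, by simpa using hi.dual hne, by simpa using hg.dual⟩
  · refine Or.inr (Or.inr ⟨y, hy, x, hx, hxy.symm, ?_, ?_, ?_⟩)
    · have := hi.dual hne
      rw [dual_delete, dual_contract] at this
      rwa [dual_M, contract_delete_comm _ (disjoint_singleton.2 hxy.symm)]
    · have hxL : P.M.NonLoop x := h2.1.nonLoop hx ⟨y, hy, hxy.symm⟩
      have hyC : P.M.NonColoop y := h2.1.nonColoop hy ⟨x, hx, hxy⟩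
      rw [← good_dual]
      simp only [dual_del, dual_con, dual_dual]
      rwa [del_con_comm _ hyC hxL hxy.symm]
    · rw [dual_M, ← conn3_dual, ← conn3_dual (M := P.M✶ ＼ {x})]
      simp only [dual_contract, dual_delete, Matroid.dual_dual]
      exact hc.symm

/-- `Q` is good, `3`-connected, and isomorphic to `N` or to an extension or a coextension
of `N` by the element `p`. -/
def IsExtensionBy (Q : WeightedMatroid α G) (N : Matroid β) (p : α) : Prop :=
  Q.M.Conn3 ∧ Q.Good ∧
    (N.IsIsomorphic Q.M ∨ N.IsIsomorphic (Q.M ＼ {p}) ∨ N.IsIsomorphic (Q.M ／ {p}))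

lemma IsExtensionBy.dual (h : Q.IsExtensionBy N a) (hne : N.E.Nonempty) :
    Q.dual.IsExtensionBy N✶ a := by
  obtain ⟨h1, h2, h3⟩ := h
  refine ⟨h1.dual, h2.dual, ?_⟩
  rw [dual_M]
  rcases h3 with h | h | h
  · exact Or.inl (h.dual hne)
  · exact Or.inr (Or.inr (by simpa using h.dual hne))
  · exact Or.inr (Or.inl (by simpa using h.dual hne))

/-- The configuration to which a minimal counterexample is reduced: `a`, `b`, `c` form a triangle and
a triad, and removing two of them by a deletion and a contraction leaves a good `3`-connected
weighted matroid. -/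
structure IsTriangleTriad (P : WeightedMatroid α G) (N : Matroid β) (a b c : α) : Prop where
  bad : ¬ P.Good
  par₁ : P.M.NonParallel a b
  par₂ : P.M.NonParallel a c
  par₃ : P.M.NonParallel b c
  triangle : P.M.rk {a, b, c} = 2
  triad : P.M.rk (P.M.E \ {a, b, c}) = P.M.rk P.M.E - 1
  span₁ : P.M.rk (insert a (P.M.E \ {a, b, c})) = P.M.rk P.M.E
  span₂ : P.M.rk (insert b (P.M.E \ {a, b, c})) = P.M.rk P.M.E
  span₃ : P.M.rk (insert c (P.M.E \ {a, b, c})) = P.M.rk P.M.E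
  ext : ((P.con a).del b).IsExtensionBy N c

namespace IsTriangleTriad

lemma nonSeries₁ (h : P.IsTriangleTriad N a b c) : P.M.NonSeries a b := by
  rw [NonSeries, ← h.span₃]
  congr 1
  ext z
  have := h.par₃.symm.nonLoop_left.mem
  have := h.par₃.ne
  have := h.par₂.ne
  simp; grind

lemma nonSeries₂ (h : P.IsTriangleTriad N a b c) : P.M.NonSeries a c := by
  rw [NonSeries, ← h.span₂]
  congr 1
  ext z
  have := h.par₃.nonLoop_left.mem
  have := h.par₃.ne
  have := h.par₁.ne
  simp; grind

lemma nonSeries₃ (h : P.IsTriangleTriad N a b c) : P.M.NonSeries b c := by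
  rw [NonSeries, ← h.span₁]
  congr 1
  ext z
  have := h.par₁.nonLoop_left.mem
  have := h.par₁.ne
  have := h.par₂.ne
  simp; grind

lemma dual (h : P.IsTriangleTriad N a b c) (hne : N.E.Nonempty) :
    P.dual.IsTriangleTriad N✶ b a c := by
  have ha := h.par₁.nonLoop_left.mem
  have hb := h.par₃.nonLoop_left.mem
  have hc := h.par₃.symm.nonLoop_left.mem
  have hab := h.par₁.ne
  have hac := h.par₂.ne
  have hbc := h.par₃.ne
  have hss : ({a, b, c} : Set α) ⊆ P.M.E := by simp [insert_subset_iff, *]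
  have hn3 : ({a, b, c} : Set α).ncard = 3 := by
    rw [ncard_insert_of_notMem (by simp [hab, hac]), ncard_pair hbc]
  have hcW := ncard_ground_diff (M := P.M) hss
  have hs2 : ∀ x, x ∈ ({a, b, c} : Set α) → x ∈ P.M.E →
      P.M.rk (P.M.E \ insert x (P.M.E \ {a, b, c})) = 2 →
      P.M✶.rk (insert x (P.M.E \ {a, b, c})) = P.M✶.rk P.M.E := by
    intro x hx hxE h2
    rw [rk_dual _ (insert_subset hxE sdiff_subset), rk_dual _ subset_rfl, h2,
      ncard_insert_of_notMem (fun h => h.2 hx) (P.M.ground_finite.subset sdiff_subset), sdiff_self,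
      rk_empty]
    rw [hn3] at hcW
    push_cast; lia
  refine ⟨by rw [good_dual]; exact h.bad, (nonParallel_dual hb ha hab.symm).2 h.nonSeries₁.symm,
    (nonParallel_dual hb hc hbc).2 h.nonSeries₃, (nonParallel_dual ha hc hac).2 h.nonSeries₂,
    ?_, ?_, ?_, ?_, ?_, ?_⟩
  · rw [insert_comm, dual_M, rk_dual _ hss, h.triad, hn3]
    push_cast; lia
  · rw [insert_comm, dual_M, dual_ground, rk_dual _ sdiff_subset, sdiff_sdiff_cancel_left hss,
      h.triangle, rk_dual _ subset_rfl, hcW, hn3, sdiff_self, rk_empty]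
    push_cast; lia
  · rw [insert_comm b a, dual_M, dual_ground]
    refine hs2 b (by simp) hb ?_
    rw [← h.par₂]
    congr 1; ext; simp; grind
  · rw [insert_comm b a, dual_M, dual_ground]
    refine hs2 a (by simp) ha ?_
    rw [← h.par₃]
    congr 1; ext; simp; grind
  · rw [insert_comm b a, dual_M, dual_ground]
    refine hs2 c (by simp) hc ?_
    rw [← h.par₁]
    congr 1; ext; simp; grind
  · have := h.ext.dual hne
    simp only [dual_del, dual_con] at this
    have h1 : P.dual.M.NonColoop a := (nonColoop_dual ha).2 h.par₁.nonLoop_left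
    have h2 : P.dual.M.NonLoop b := (nonLoop_dual hb).2 h.nonSeries₁.symm.nonColoop_left
    rwa [P.dual.del_con_comm h1 h2 hab] at this

/-- As `b` and `c` are parallel after the contraction of `a`, they are interchangeable. -/
lemma swap_right (h : P.IsTriangleTriad N a b c) : P.IsTriangleTriad N a c b := by
  have e1 : ({a, c, b} : Set α) = {a, b, c} := by rw [pair_comm]
  have ha := h.par₁.nonLoop_left
  have hbc := h.par₃.ne
  have hab := h.par₁.ne
  have hac := h.par₂.ne
  have hb' : (P.M ／ {a}).NonLoop b := (nonLoop_contract ha).2 h.par₁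
  have hc' : (P.M ／ {a}).NonLoop c := (nonLoop_contract ha).2 h.par₂
  have hbc' : ¬ (P.M ／ {a}).NonParallel b c := by
    rw [nonParallel_contract ha, h.triangle]; norm_num
  have hcc : (P.M ／ {a}).NonColoop c := NonColoop.of_parallel hb' hbc.symm
    (fun h => hbc' h.symm)
  refine ⟨h.bad, h.par₂, h.par₁, h.par₃.symm, by rw [e1, h.triangle],
    by rw [e1, h.triad], by rw [e1, h.span₁], by rw [e1, h.span₃], by rw [e1, h.span₂], ?_⟩
  have hg : ((P.con a).del c).Good :=
    (Good.of_delete_parallel (Q := P.con a) hb' hc' hbc hbc' h.ext.2.1).del (Q := P.con a) hcc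
  have hiso : (P.M ／ {a} ＼ {b}).IsIsomorphic (P.M ／ {a} ＼ {c}) :=
    IsIsomorphic.delete_swap (.refl _) hb' hc' hbc hbc'
  refine ⟨hiso.conn3 ⟨c, ⟨h.par₃.symm.nonLoop_left.mem, hac.symm⟩, hbc.symm⟩ h.ext.1, hg, ?_⟩
  rcases h.ext.2.2 with h1 | h1 | h1
  · exact Or.inl (IsIsomorphic.delete_swap h1 hb' hc' hbc hbc')
  · refine Or.inr (Or.inl ?_)
    rwa [del_M, con_M, delete_comm]
  · refine Or.inr (Or.inr ?_)
    rwa [del_M, con_M, ← contract_delete_of_parallel hb' hc' hbc hbc']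

/-- As `a` and `c` are in series after the deletion of `b`, they are interchangeable. -/
lemma swap_outer (h : P.IsTriangleTriad N a b c) (hne : N.E.Nonempty) :
    P.IsTriangleTriad N c b a := by
  simpa using ((h.dual hne).swap_right).dual hne

end IsTriangleTriad

end WeightedMatroid

end Isomorphism

/-! ### Minimal bad weighted matroids -/

section MinimalBad

open Set Matroid

namespace WeightedMatroid

variable {α β G : Type*} [CommGroup G] {Q Q' P : WeightedMatroid α G} {x y z a b c e : α}
  {N : Matroid β} {N' : Matroid α}

/-- `Q` is connected and bad, but every connected deletion or contraction of a single element that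
retains a good copy of `N` is good. -/
structure IsMinimalBad (Q : WeightedMatroid α G) (N : Matroid β) : Prop where
  conn : Q.M.Conn
  bad : ¬ Q.Good
  del : ∀ x ∈ Q.M.E, (Q.M ＼ {x}).Conn → (Q.del x).HasGoodCopy N → (Q.del x).Good
  con : ∀ x ∈ Q.M.E, (Q.M ／ {x}).Conn → (Q.con x).HasGoodCopy N → (Q.con x).Good

lemma IsMinimalBad.dual (h : Q.IsMinimalBad N) (hne : N.E.Nonempty) :
    Q.dual.IsMinimalBad N✶ := by
  refine ⟨h.conn.dual, by rw [good_dual]; exact h.bad, fun x hx h1 h2 => ?_, fun x hx h1 h2 => ?_⟩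
  · have := h2.dual (by simpa)
    rw [Matroid.dual_dual] at this
    rw [← good_dual]
    refine h.con x hx ?_ this
    rw [← conn_dual, dual_contract]; exact h1
  · have := h2.dual (by simpa)
    rw [Matroid.dual_dual, dual_con, dual_dual] at this
    rw [← good_dual, dual_con, dual_dual]
    refine h.del x hx ?_ this
    rw [← conn_dual, dual_delete]; exact h1

lemma IsMinimalBad.nonParallel (h : Q.IsMinimalBad N) (hi : N.IsIsomorphic N')
    (hg : Q.HasGoodMinor N') (hL : ∀ e ∈ N'.E, N'.NonLoop e) (hx : x ∈ Q.M.E \ N'.E)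
    (he : e ∈ Q.M.E) (hxe : x ≠ e) : Q.M.NonParallel x e := by
  by_contra hp
  have hxL : Q.M.NonLoop x := h.conn.nonLoop hx.1 ⟨e, he, hxe.symm⟩
  have heL : Q.M.NonLoop e := h.conn.nonLoop he ⟨x, hx.1, hxe⟩
  exact h.bad (Good.of_delete_parallel hxL heL hxe hp (h.del x hx.1
    (h.conn.delete_of_parallel hxL heL hxe hp)
    ⟨N', hi, hg.del_of_parallel hL hx.2 hxL heL hxe hp⟩))

lemma IsMinimalBad.nonSeries (h : Q.IsMinimalBad N) (hne : N.E.Nonempty) (hi : N.IsIsomorphic N')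
    (hg : Q.HasGoodMinor N') (hL : ∀ e ∈ N'.E, N'.NonColoop e) (hx : x ∈ Q.M.E \ N'.E)
    (he : e ∈ Q.M.E) (hxe : x ≠ e) : Q.M.NonSeries x e := by
  have hf : N'.Finite := by obtain ⟨P, rfl, -⟩ := hg; infer_instance
  exact (nonParallel_dual hx.1 he hxe).1 ((h.dual hne).nonParallel (hi.dual hne) hg.dual
    (fun e he => (nonLoop_dual (M := N') he).2 (hL e he)) hx he hxe)

/-- The case of `exists_isTriangleTriad` in which one element is contracted and one deleted. -/
lemma IsMinimalBad.exists_of_pair (h : Q.IsMinimalBad N) (hN4 : 4 ≤ N.E.ncard)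
    (hi : N.IsIsomorphic (Q.M ＼ {x} ／ {y})) (h3 : (Q.M ＼ {x} ／ {y}).Conn3)
    (hpar : ∀ u ∈ ({x, y} : Set α), ∀ e ∈ Q.M.E, u ≠ e → Q.M.NonParallel u e)
    (hser : ∀ u ∈ ({x, y} : Set α), ∀ e ∈ Q.M.E, u ≠ e → Q.M.NonSeries u e)
    (hx : x ∈ Q.M.E) (hy : y ∈ Q.M.E) (hxy : x ≠ y) (hcx : (Q.M ＼ {x}).Conn)
    (hg : ((Q.del x).con y).Good) :
    Q.HasSmallObstruction N ∨ ∃ e, Q.IsTriangleTriad N y x e := by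
  have hxyP := hpar x (by simp) y hy hxy
  have hxyS := hser x (by simp) y hy hxy
  have hxL := hxyP.nonLoop_left
  have hyL := hxyP.symm.nonLoop_left
  have hxC := hxyS.nonColoop_left
  have hyC := hxyS.symm.nonColoop_left
  have hxL' : (Q.M ／ {y}).NonLoop x := (nonLoop_contract hyL).2 hxyP.symm
  have hxC' : (Q.M ／ {y}).NonColoop x := (nonColoop_contract hy hxy.symm).2 hxC
  have hyL' : (Q.M ＼ {x}).NonLoop y := (nonLoop_delete hxy).2 hyL
  have ecomm : Q.M ＼ {x} ／ {y} = Q.M ／ {y} ＼ {x} :=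
    (contract_delete_comm Q.M (disjoint_singleton.2 hxy.symm)).symm
  have hn := hi.ncard_eq
  have hn' : 4 ≤ (Q.M ／ {y} ＼ {x}).E.ncard := by rw [← ecomm]; lia
  have hg' : ((Q.con y).del x).Good := by rwa [← Q.del_con_comm hxC hyL hxy]
  by_cases hc3 : (Q.M ／ {y}).Conn3
  · left
    refine ⟨Q, .refl Q, ?_, h.bad, Or.inr (Or.inr ⟨y, hy, x, hx, hxy.symm, ecomm ▸ hi, hg',
      Or.inl hc3⟩)⟩
    refine hc3.of_contract ?_ hyL hyC fun e he hey => hser y (by simp) e he hey.symm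
    exact hn'.trans (ncard_le_ncard sdiff_subset (ground_finite _))
  obtain ⟨e, heE, hex, hep⟩ : ∃ e ∈ (Q.M ／ {y}).E, e ≠ x ∧ ¬ (Q.M ／ {y}).NonParallel x e := by
    by_contra! hall
    exact hc3 (Conn3.of_delete (ecomm ▸ h3) hn' hxL' hxC' hall)
  have heE' : e ∈ Q.M.E := heE.1
  have hey : e ≠ y := heE.2
  have heL' : (Q.M ／ {y}).NonLoop e :=
    (nonLoop_contract hyL).2 (hpar y (by simp) e heE' hey.symm)
  have htri : Q.M.rk {y, x, e} = 2 := by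
    rw [nonParallel_contract hyL] at hep
    have h1 := Q.M.rk_insert_le e {y, x}
    have h2 := Q.M.le_rk_insert e {y, x}
    rw [show insert e {y, x} = ({y, x, e} : Set α) by ext; simp; tauto, hxyP.symm] at h1 h2
    lia
  have hxeP := hpar x (by simp) e heE' hex.symm
  have hxeS := hser x (by simp) e heE' hex.symm
  have hyeP := hpar y (by simp) e heE' hey.symm
  have hyeS := hser y (by simp) e heE' hey.symm
  have heC := hyeS.symm.nonColoop_left
  have heC' : (Q.M ／ {y}).NonColoop e := (nonColoop_contract hy hey.symm).2 heC
  right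
  refine ⟨e, h.bad, hxyP.symm, hyeP, hxeP, htri, ?_, ?_, ?_, ?_, ?_⟩
  rotate_left
  · rw [← hxeS]
    congr 1; ext; simp; grind
  · rw [← hyeS]
    congr 1; ext; simp; grind
  · rw [← hxyS]
    congr 1; ext; simp; grind
  · exact ⟨by rw [del_M, con_M, ← ecomm]; exact h3, hg',
      Or.inl (by rw [del_M, con_M, ← ecomm]; exact hi)⟩
  -- otherwise both deletions of `x` and of `e` are good
  by_contra hW
  have hiso : (Q.M ／ {y} ＼ {x}).IsIsomorphic (Q.M ／ {y} ＼ {e}) :=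
    IsIsomorphic.delete_swap (.refl _) hxL' heL' hex.symm hep
  have hi' : N.IsIsomorphic (Q.M ／ {y} ＼ {e}) :=
    IsIsomorphic.delete_swap (ecomm ▸ hi) hxL' heL' hex.symm hep
  have hNe : (Q.M ／ {y} ＼ {x}).E.Nonempty := ⟨e, heE, hex⟩
  have hge : ((Q.con y).del e).Good :=
    (Good.of_delete_parallel (Q := Q.con y) hxL' heL' hex.symm hep hg').del (Q := Q.con y) heC'
  have hce : (Q.M ／ {y} ＼ {e}).Conn := (hiso.conn3 hNe (ecomm ▸ h3)).1
  have hyLe : (Q.M ＼ {e}).NonLoop y := (nonLoop_delete hey).2 hyL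
  have hdele : (Q.M ＼ {e}).Conn := by
    rw [contract_delete_comm _ (disjoint_singleton.2 hey.symm)] at hce
    exact hce.of_contract hyLe ((nonColoop_delete heC).2 hyeS.symm)
  have hGe : (Q.del e).Good := by
    refine h.del e heE' hdele ⟨_, hi', (Q.con y).del e, rfl, ?_, hge⟩
    rw [← Q.del_con_comm heC hyL hey]
    exact isMinor_con hyLe
  have hGx : (Q.del x).Good :=
    h.del x hx hcx ⟨_, hi, (Q.del x).con y, rfl, isMinor_con hyL', hg⟩
  refine h.bad (Good.of_delete_delete hex.symm ?_ hxeS hGx hGe)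
  have hc1 : (Q.M ＼ {x} ／ {y} ＼ {e}).Conn := h3.conn_delete (by lia) ⟨⟨heE', hex⟩, hey⟩
  rw [contract_delete_comm _ (disjoint_singleton.2 hey.symm)] at hc1
  have heC'' : (Q.M ＼ {x}).NonColoop e := (nonColoop_delete hxC).2 hxeS
  refine hc1.of_contract ((nonLoop_delete hey).2 hyL') ?_
  rw [NonColoop, heC''.rk_delete_ground, hxC.rk_delete_ground, rk_deleteElem (by simp),
    rk_deleteElem (by simp)]
  have e3 : (Q.M ＼ {x} ＼ {e}).E \ {y} = Q.M.E \ {y, x, e} := by ext; simp; tauto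
  rw [e3]
  have h1 := Q.M.rk_diff_singleton_ge y (Q.M.E \ {x, e})
  have h2 := Q.M.rk_le_rk_ground (Q.M.E \ {y, x, e})
  rw [hxeS, show (Q.M.E \ {x, e}) \ {y} = Q.M.E \ {y, x, e} by ext; simp; tauto] at h1
  lia

set_option maxHeartbeats 1000000 in
/-- The case of `exists_isTriangleTriad` in which a triangle is removed. -/
lemma IsMinimalBad.isTriangleTriad_of_triangle (h : Q.IsMinimalBad N) (hN4 : 4 ≤ N.E.ncard)
    (hi : N.IsIsomorphic (Q.M ＼ {x} ／ {y} ／ {z})) (h3 : (Q.M ＼ {x} ／ {y} ／ {z}).Conn3)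
    (hpar : ∀ u ∈ ({x, y, z} : Set α), ∀ e ∈ Q.M.E, u ≠ e → Q.M.NonParallel u e)
    (hser : ∀ u ∈ ({x, y, z} : Set α), ∀ e ∈ Q.M.E, u ≠ e → Q.M.NonSeries u e)
    (hx : x ∈ Q.M.E) (hy : y ∈ Q.M.E) (hz : z ∈ Q.M.E) (hxy : x ≠ y) (hxz : x ≠ z) (hyz : y ≠ z)
    (hcx : (Q.M ＼ {x}).Conn) (htri : Q.M.rk {x, y, z} = 2)
    (hg : (((Q.del x).con y).con z).Good) :
    Q.IsTriangleTriad N z x y := by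
  have hxyP := hpar x (by simp) y hy hxy
  have hxyS := hser x (by simp) y hy hxy
  have hxzP := hpar x (by simp) z hz hxz
  have hxzS := hser x (by simp) z hz hxz
  have hyzP := hpar y (by simp) z hz hyz
  have hyzS := hser y (by simp) z hz hyz
  have hxL := hxyP.nonLoop_left
  have hyL := hxyP.symm.nonLoop_left
  have hzL := hxzP.symm.nonLoop_left
  have hxC := hxyS.nonColoop_left
  have hyC := hxyS.symm.nonColoop_left
  have hzC := hxzS.symm.nonColoop_left
  have hyL1 : (Q.M ＼ {x}).NonLoop y := (nonLoop_delete hxy).2 hyL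
  have hzL1 : (Q.M ＼ {x}).NonLoop z := (nonLoop_delete hxz).2 hzL
  have hyC1 : (Q.M ＼ {x}).NonColoop y := (nonColoop_delete hxC).2 hxyS
  have hzC1 : (Q.M ＼ {x}).NonColoop z := (nonColoop_delete hxC).2 hxzS
  have hyzP1 : (Q.M ＼ {x}).NonParallel y z := (nonParallel_delete hxy hxz).2 hyzP
  have hyE1 : y ∈ (Q.M ＼ {x}).E := hyL1.mem
  have hzE1 : z ∈ (Q.M ＼ {x}).E := hzL1.mem
  have hyL2 : (Q.M ＼ {x} ／ {z}).NonLoop y := (nonLoop_contract hzL1).2 hyzP1.symm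
  have hyC2 : (Q.M ＼ {x} ／ {z}).NonColoop y := (nonColoop_contract hzE1 hyz.symm).2 hyC1
  have ecomm : Q.M ＼ {x} ／ {y} ／ {z} = Q.M ＼ {x} ／ {z} ／ {y} := contract_comm _ _ _
  have ecomm' : Q.M ＼ {x} ／ {z} = Q.M ／ {z} ＼ {x} :=
    (contract_delete_comm Q.M (disjoint_singleton.2 hxz.symm)).symm
  have wcomm : ((Q.del x).con y).con z = ((Q.del x).con z).con y :=
    (Q.del x).con_con_comm hyE1 hzE1 hyzP1
  have hn := hi.ncard_eq
  have hNe : (Q.M ＼ {x} ／ {z} ／ {y}).E.Nonempty := by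
    rw [← ecomm, ← ncard_pos (ground_finite _)]; lia
  have hGx : (Q.del x).Good := by
    have hz2 : (Q.M ＼ {x} ／ {y}).NonLoop z := (nonLoop_contract hyL1).2 hyzP1
    exact h.del x hx hcx ⟨_, hi, ((Q.del x).con y).con z, rfl,
      (isMinor_con (Q := (Q.del x).con y) hz2).trans (isMinor_con (Q := Q.del x) hyL1), hg⟩
  have hGL : ((Q.del x).con z).Good := hGx.con (Q := Q.del x) hzL1
  have hxC2 : ∀ u ∈ Q.M.E, u ≠ x → (Q.M ／ {u}).NonColoop x := fun u hu hux =>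
    (nonColoop_contract hu hux).2 hxC
  -- contracting `u` from `Q` preserves connectivity if it does after removing `x` and `z`
  have hlift : ∀ u ∈ Q.M.E, u ≠ x → u ≠ z → (Q.M ＼ {x} ／ {u} ／ {z}).Conn → Q.M.NonLoop u →
      (Q.M ／ {u}).Conn := by
    intro u hu hux huz hc huL
    have huzP := (hpar z (by simp) u hu huz.symm).symm
    have huxP := (hpar x (by simp) u hu hux.symm).symm
    have huL1 : (Q.M ＼ {x}).NonLoop u := (nonLoop_delete hux.symm).2 huL
    have hz2 : (Q.M ＼ {x} ／ {u}).NonLoop z :=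
      (nonLoop_contract huL1).2 ((nonParallel_delete hux.symm hxz).2 huzP)
    have hz3 : (Q.M ＼ {x} ／ {u}).NonColoop z := (nonColoop_contract huL1.mem huz).2 hzC1
    have := hc.of_contract hz2 hz3
    rw [← contract_delete_comm _ (disjoint_singleton.2 hux)] at this
    exact this.of_delete ((nonLoop_contract huL).2 huxP) (hxC2 u hu hux)
  have hL3 : (Q.M ＼ {x} ／ {z}).Conn3 := by
    by_contra hL3
    obtain ⟨e, heE, hey, heS⟩ : ∃ e ∈ (Q.M ＼ {x} ／ {z}).E, e ≠ y ∧
        ¬ (Q.M ＼ {x} ／ {z}).NonSeries y e := by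
      by_contra! hall
      exact hL3 (Conn3.of_contract (ecomm ▸ h3) (by rw [← ecomm]; lia) hyL2 hyC2 hall)
    have heE' : e ∈ Q.M.E := heE.1.1
    have hex : e ≠ x := heE.1.2
    have hez : e ≠ z := heE.2
    have hzeP := hpar z (by simp) e heE' hez.symm
    have hyeP := hpar y (by simp) e heE' hey.symm
    have heL := hzeP.symm.nonLoop_left
    have heL1 : (Q.M ＼ {x}).NonLoop e := (nonLoop_delete hex.symm).2 heL
    have hzeP1 : (Q.M ＼ {x}).NonParallel z e := (nonParallel_delete hxz hex.symm).2 hzeP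
    have heL2 : (Q.M ＼ {x} ／ {z}).NonLoop e := (nonLoop_contract hzL1).2 hzeP1
    have heC2 : (Q.M ＼ {x} ／ {z}).NonColoop e := by
      have hxe := hser x (by simp) e heE' hex.symm
      exact (nonColoop_contract hzE1 hez.symm).2 ((nonColoop_delete hxC).2 hxe)
    have hyE2 : y ∈ (Q.M ＼ {x} ／ {z}).E := hyL2.mem
    have hi' : N.IsIsomorphic (Q.M ＼ {x} ／ {z} ／ {e}) := by
      refine (ecomm ▸ hi : N.IsIsomorphic (Q.M ＼ {x} ／ {z} ／ {y})).contract_swap ?_ hyC2 heC2 hyE2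
        heE hey.symm heS
      by_contra h0
      rw [not_nonempty_iff_eq_empty] at h0
      rw [h0] at hN4; simp at hN4
    have hce : (Q.M ＼ {x} ／ {e} ／ {z}).Conn := by
      rw [contract_comm]
      exact ((IsIsomorphic.contract_swap (.refl _) hNe hyC2 heC2 hyE2 heE hey.symm heS).conn3 hNe
        (ecomm ▸ h3)).1
    have hGe : (Q.con e).Good := by
      refine h.con e heE' (hlift e heE' hex hez hce heL)
        ⟨_, hi', ((Q.del x).con z).con e, rfl, ?_, hGL.con (Q := (Q.del x).con z) heL2⟩
      rw [(Q.del x).con_con_comm hzE1 heL1.mem hzeP1, Q.del_con_comm hxC heL hex.symm]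
      have h1 : (Q.M ／ {e} ＼ {x}).NonLoop z := by
        rw [nonLoop_delete hxz, nonLoop_contract heL]; exact hzeP.symm
      exact (isMinor_con (Q := (Q.con e).del x) h1).trans
        (isMinor_del (Q := Q.con e) (hxC2 e heE' hex))
    have hGy : (Q.con y).Good := by
      refine h.con y hy (hlift y hy hxy.symm hyz h3.1 hyL) ⟨_, hi, ((Q.del x).con y).con z, rfl,
        ?_, hg⟩
      rw [Q.del_con_comm hxC hyL hxy]
      have h1 : (Q.M ／ {y} ＼ {x}).NonLoop z := by
        rw [nonLoop_delete hxz, nonLoop_contract hyL]; exact hyzP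
      exact (isMinor_con (Q := (Q.con y).del x) h1).trans
        (isMinor_del (Q := Q.con y) (hxC2 y hy hxy.symm))
    refine h.bad (Good.of_contract_contract hey heE' hy ?_ hyeP.symm hGe hGy)
    have hye3 : Q.M.rk {y, z, e} = 3 := by
      have h1 : (Q.M ＼ {x} ／ {y} ／ {z}).NonLoop e := h3.nonLoop (by lia)
        (by simp [heE', hex, hey, hez])
      rw [nonLoop_contract ((nonLoop_contract hyL1).2 hyzP1), nonParallel_contract hyL1,
        rk_deleteElem (by simp [hxy, hxz, hex.symm])] at h1
      exact h1
    have hye3' : Q.M.rk {y, x, e} = 3 := by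
      have r1 : Q.M.rk {x, y} = 2 := hxyP
      have r2 := rk_insert_eq_of_subset (M := Q.M) (X := {x, y}) (Y := {y, x, e}) (e := z)
        (by intro; simp; tauto) (by
          rw [r1, ← htri]; congr 1; ext; simp; tauto)
      have r3 := Q.M.rk_mono (X := {y, z, e}) (Y := insert z {y, x, e}) (by intro; simp; tauto)
      have r4 := Q.M.rk_insert_le e {y, x}
      rw [show insert e {y, x} = ({y, x, e} : Set α) by ext; simp; tauto, hxyP.symm] at r4
      lia
    have hc1 : (Q.M ＼ {x} ／ {y} ／ {z} ／ {e}).Conn := h3.conn_contract (by lia)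
      (by simp [heE', hex, hey, hez])
    have heL1y : (Q.M ／ {e}).NonLoop y := (nonLoop_contract heL).2 hyeP.symm
    have ec : Q.M ＼ {x} ／ {y} ／ {z} ／ {e} = Q.M ／ {e} ／ {y} ＼ {x} ／ {z} := by
      rw [contract_comm (Q.M ＼ {x} ／ {y}) {z} {e}, contract_comm (Q.M ＼ {x}) {y} {e},
        ← contract_delete_comm Q.M (disjoint_singleton.2 hex),
        ← contract_delete_comm (Q.M ／ {e}) (disjoint_singleton.2 hxy.symm)]
    rw [ec] at hc1
    have hxC3 : (Q.M ／ {e} ／ {y}).NonColoop x :=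
      (nonColoop_contract (M := Q.M ／ {e}) ⟨hy, hey.symm⟩ hxy.symm).2 (hxC2 e heE' hex)
    have hxzS3 : (Q.M ／ {e} ／ {y}).NonSeries x z := by
      rw [nonSeries_contract (M := Q.M ／ {e}) ⟨hy, hey.symm⟩ hxy.symm hyz,
        nonSeries_contract heE' hex hez]
      exact hxzS
    refine (hc1.of_contract ?_ ((nonColoop_delete hxC3).2 hxzS3)).of_delete ?_ hxC3
    · rw [nonLoop_delete hxz, nonLoop_contract heL1y, nonParallel_contract heL, ← hye3]
      congr 1; ext; simp; tauto
    · rw [nonLoop_contract heL1y, nonParallel_contract heL, ← hye3']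
      congr 1; ext; simp; tauto
  have hxL3 : (Q.M ／ {z}).NonLoop x := (nonLoop_contract hzL).2 hxzP.symm
  have hyL3 : (Q.M ／ {z}).NonLoop y := (nonLoop_contract hzL).2 hyzP.symm
  have wcomm' : (Q.del x).con z = (Q.con z).del x := Q.del_con_comm hxC hzL hxz
  have hxyp : ¬ (Q.M ／ {z}).NonParallel x y := by
    rw [nonParallel_contract hzL, show ({z, x, y} : Set α) = {x, y, z} by ext; simp; tauto, htri]
    norm_num
  refine ⟨h.bad, hxzP.symm, hyzP.symm, hxyP, ?_, ?_, ?_, ?_, ?_, ?_⟩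
  · rw [← htri]; congr 1; ext; simp; tauto
  rotate_left
  · rw [← hxyS]
    congr 1; ext; simp; grind
  · rw [← hyzS]
    congr 1; ext; simp; grind
  · rw [← hxzS]
    congr 1; ext; simp; grind
  · refine ⟨by rw [del_M, con_M, ← ecomm']; exact hL3, wcomm' ▸ hGL, Or.inr (Or.inr ?_)⟩
    rw [del_M, con_M, ← ecomm', ← ecomm]
    exact hi
  by_contra hW
  have hW' : Q.M.rk (Q.M.E \ {z, x, y}) = Q.M.rk Q.M.E := by
    have h1 := Q.M.rk_diff_singleton_ge z (Q.M.E \ {x, y})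
    have h2 := Q.M.rk_le_rk_ground (Q.M.E \ {z, x, y})
    rw [hxyS, show (Q.M.E \ {x, y}) \ {z} = Q.M.E \ {z, x, y} by ext; simp; tauto] at h1
    lia
  have hLn : 4 ≤ (Q.M ＼ {x} ／ {z}).E.ncard := by
    have : 4 ≤ (Q.M ＼ {x} ／ {z} ／ {y}).E.ncard := by rw [← ecomm]; lia
    exact this.trans (ncard_le_ncard sdiff_subset (ground_finite _))
  have hc2 : (Q.M ＼ {x} ＼ {y}).Conn := by
    have := hL3.conn_delete hLn hyL2.mem
    rw [contract_delete_comm _ (disjoint_singleton.2 hyz.symm)] at this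
    refine this.of_contract ((nonLoop_delete hyz).2 hzL1) ?_
    rw [NonColoop, hyC1.rk_delete_ground, hxC.rk_delete_ground, rk_deleteElem (by simp),
      rk_deleteElem (by simp), ← hW']
    congr 1; ext; simp; tauto
  have hxLy : (Q.M ＼ {y}).NonLoop x := (nonLoop_delete hxy.symm).2 hxL
  have hcy : (Q.M ＼ {y}).Conn := by
    rw [delete_comm] at hc2
    exact hc2.of_delete hxLy ((nonColoop_delete hyC).2 hxyS.symm)
  refine h.bad (Good.of_delete_delete hxy hc2 hxyS hGx (h.del y hy hcy
    ⟨_, hi, ((Q.con z).del y).con x, ?_, ?_, ?_⟩))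
  · rw [con_M, del_M, con_M, ecomm, ecomm', contract_delete_of_parallel hxL3 hyL3 hxy hxyp]
  · rw [← Q.del_con_comm hyC hzL hyz]
    have h1 : (Q.M ＼ {y}).NonLoop z := (nonLoop_delete hyz).2 hzL
    refine (isMinor_con (Q := (Q.del y).con z) (x := x) ?_).trans (isMinor_con (Q := Q.del y) h1)
    exact (nonLoop_contract h1).2 ((nonParallel_delete hyz hxy.symm).2 hxzP.symm)
  · refine Good.con (Q := (Q.con z).del y) (Good.del (Q := Q.con z) ?_ ?_) ?_
    · exact Good.of_delete_parallel (Q := Q.con z) hxL3 hyL3 hxy hxyp (wcomm' ▸ hGL)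
    · exact (nonColoop_contract hz hyz.symm).2 hyC
    · exact (nonLoop_delete hxy.symm).2 hxL3

/-- A bad connected weighted matroid with a good copy of `N` has a small obstruction, or a minor with
a triangle that is also a triad. -/
lemma exists_isTriangleTriad [N.Finite] (hN4 : 4 ≤ N.E.ncard) (hN : N.Conn3) (hQ : Q.M.Conn)
    (hbad : ¬ Q.Good) (hc : Q.HasGoodCopy N) :
    Q.HasSmallObstruction N ∨
      ∃ P : WeightedMatroid α G, ∃ a b c, P.IsMinor Q ∧ P.IsTriangleTriad N a b c := by
  have hne : N.E.Nonempty := by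
    rw [← ncard_pos N.ground_finite]; lia
  induction hn : Q.M.E.ncard using Nat.strong_induction_on generalizing Q with
  | _ n ih =>
  by_contra hcon
  have hE2 : ∀ x, (Q.M.E \ {x}).Nonempty := by
    intro x
    obtain ⟨N', hi, hg⟩ := hc
    have h1 := ncard_le_ncard hg.ground Q.M.ground_finite
    rw [hi.ncard_eq] at h1
    exact Conn3.diff_nonempty (by lia)
  have hmin : Q.IsMinimalBad N := by
    have key : ∀ Q' : WeightedMatroid α G, Q'.IsMinor Q → Q'.M.E.ncard < n → Q'.M.Conn →
        Q'.HasGoodCopy N → Q'.Good := by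
      intro Q' hm hlt hc hg
      by_contra hb
      rcases ih _ hlt hc hb hg rfl with h | ⟨P, a, b, c, h1, h2⟩
      · exact hcon (Or.inl (h.of_isMinor hm))
      · exact hcon (Or.inr ⟨P, a, b, c, h1.trans hm, h2⟩)
    refine ⟨hQ, hbad, fun x hx h1 h2 => ?_, fun x hx h1 h2 => ?_⟩
    · exact key _ (isMinor_del (hQ.nonColoop hx (hE2 x)))
        (hn ▸ ncard_sdiff_singleton_lt_of_mem hx Q.M.ground_finite) h1 h2
    · exact key _ (isMinor_con (hQ.nonLoop hx (hE2 x)))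
        (hn ▸ ncard_sdiff_singleton_lt_of_mem hx Q.M.ground_finite) h1 h2
  obtain ⟨N', hi, hg⟩ := hc
  have hN'3 : N'.Conn3 := hi.conn3 hne hN
  have hN'ne := hi.nonempty hne
  have hN'f : N'.Finite := by obtain ⟨P, rfl, -⟩ := hg; infer_instance
  have hN'4 : 4 ≤ N'.E.ncard := by rw [hi.ncard_eq]; exact hN4
  -- the conclusion for a close minor
  have main : ∀ (Q : WeightedMatroid α G) (N : Matroid β) (N' : Matroid α), N'.Finite →
      4 ≤ N.E.ncard → N.E.Nonempty →
      Q.IsMinimalBad N → N.IsIsomorphic N' → N'.Conn3 → Q.HasGoodMinor N' → Q.IsCloseMinor N' →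
      Q.HasSmallObstruction N ∨ ∃ a b c, Q.IsTriangleTriad N a b c := by
    intro Q N N' hN'f hN4 hne hmin hi h3 hg hclose
    have hN'4 : 4 ≤ N'.E.ncard := by rw [hi.ncard_eq]; exact hN4
    have hpar : ∀ u ∈ Q.M.E \ N'.E, ∀ e ∈ Q.M.E, u ≠ e → Q.M.NonParallel u e :=
      fun u hu e he hue => hmin.nonParallel hi hg (fun e he => h3.nonLoop hN'4 he) hu he hue
    have hser : ∀ u ∈ Q.M.E \ N'.E, ∀ e ∈ Q.M.E, u ≠ e → Q.M.NonSeries u e :=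
      fun u hu e he hue => hmin.nonSeries hne hi hg (fun e he => h3.nonColoop hN'4 he) hu he hue
    obtain ⟨n, hn⟩ := hi.nonempty hne
    have hnQ := hg.ground hn
    rcases hclose with ⟨x, hx, rfl, hgx⟩ | ⟨x, hx, y, hy, hxy, hcx, -, rfl, hgx⟩ |
      ⟨x, hx, y, hy, z, hz, hxy, hxz, hyz, hcx, htri, rfl, hgx⟩
    · have hxN : x ∈ Q.M.E \ (Q.M ＼ {x}).E := ⟨hx, by simp⟩
      refine Or.inl ⟨Q, .refl Q, ?_, hmin.bad, Or.inr (Or.inl ⟨x, hx, hi, hgx⟩)⟩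
      exact h3.of_delete hN'4 (hpar x hxN n hnQ fun h => hn.2 h.symm).nonLoop_left
        (hser x hxN n hnQ fun h => hn.2 h.symm).nonColoop_left fun y hy hyx => hpar x hxN y hy hyx.symm
    · have hmem : ∀ u ∈ ({x, y} : Set α), u ∈ Q.M.E \ (Q.M ＼ {x} ／ {y}).E := by
        rintro u (rfl | rfl)
        · exact ⟨hx, by simp⟩
        · exact ⟨hy, by simp⟩
      rcases hmin.exists_of_pair hN4 hi h3 (fun u hu => hpar u (hmem u hu))
        (fun u hu => hser u (hmem u hu)) hx hy hxy hcx hgx with h | ⟨e, h⟩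
      · exact Or.inl h
      · exact Or.inr ⟨_, _, _, h⟩
    · have hmem : ∀ u ∈ ({x, y, z} : Set α), u ∈ Q.M.E \ (Q.M ＼ {x} ／ {y} ／ {z}).E := by
        rintro u (rfl | rfl | rfl)
        · exact ⟨hx, by simp⟩
        · exact ⟨hy, by simp⟩
        · exact ⟨hz, by simp⟩
      exact Or.inr ⟨_, _, _, hmin.isTriangleTriad_of_triangle hN4 hi h3
        (fun u hu => hpar u (hmem u hu)) (fun u hu => hser u (hmem u hu)) hx hy hz hxy hxz hyz hcx
        htri hgx⟩
  have hclose := isCloseMinor_of_minimal hQ hN'3.1 hN'ne hg hbad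
    (fun x hx h1 h2 => hmin.del x hx.1 h1 ⟨N', hi, h2⟩)
    (fun x hx h1 h2 => hmin.con x hx.1 h1 ⟨N', hi, h2⟩)
    (fun x hx e he hxe => hmin.nonParallel hi hg (fun e he => hN'3.nonLoop hN'4 he) hx he hxe)
    (fun x hx e he hxe => hmin.nonSeries hne hi hg (fun e he => hN'3.nonColoop hN'4 he) hx he hxe)
  rcases hclose with h | h
  · rcases main Q N N' hN'f hN4 hne hmin hi hN'3 hg h with h | ⟨a, b, c, h⟩
    · exact hcon (Or.inl h)
    · exact hcon (Or.inr ⟨Q, a, b, c, .refl Q, h⟩)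
  · rcases main Q.dual N✶ N'✶ inferInstance hN4 hne (hmin.dual hne) (hi.dual hne) hN'3.dual hg.dual
      h with h | ⟨a, b, c, h⟩
    · exact hcon (Or.inl (by simpa using h.dual hne))
    · exact hcon (Or.inr ⟨Q, b, a, c, .refl Q, by simpa using h.dual hne⟩)

end WeightedMatroid

end MinimalBad

/-! ### Extensions of triangle-triad configurations -/

section BridgingExtensions

open Set Matroid

namespace WeightedMatroid

variable {α β G : Type*} [CommGroup G] {Q Q' P : WeightedMatroid α G} {x y z a b c e v t : α}
  {N : Matroid β} {N' : Matroid α}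

lemma IsExtensionBy.ncard_le (h : Q.IsExtensionBy N c) : N.E.ncard ≤ Q.M.E.ncard := by
  rcases h.2.2 with h | h | h
  · exact h.ncard_eq.ge
  · exact h.ncard_eq.ge.trans (ncard_le_ncard sdiff_subset Q.M.ground_finite)
  · exact h.ncard_eq.ge.trans (ncard_le_ncard sdiff_subset Q.M.ground_finite)

/-- `Q` is a one-element extension by `v` of a weighted matroid with a triangle `{a, b, c}` that is
also a triad, and `v` is not spanned by the elements outside the triangle. -/
structure IsBridgingExtension (Q : WeightedMatroid α G) (N : Matroid β) (v a b c : α) : Prop where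
  four_le : 4 ≤ N.E.ncard
  conn3 : N.Conn3
  nonColoop : Q.M.NonColoop v
  config : (Q.del v).IsTriangleTriad N a b c
  span : Q.M.rk (insert v ((Q.M.E \ {v}) \ {a, b, c})) = Q.M.rk Q.M.E

namespace IsBridgingExtension

lemma nonempty (h : Q.IsBridgingExtension N v a b c) : N.E.Nonempty := by
  by_contra h0
  rw [not_nonempty_iff_eq_empty] at h0
  have := h.four_le
  rw [h0] at this; simp at this

lemma swap_right (h : Q.IsBridgingExtension N v a b c) : Q.IsBridgingExtension N v a c b :=
  ⟨h.four_le, h.conn3, h.nonColoop, h.config.swap_right, by rw [pair_comm c b, h.span]⟩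

lemma swap_outer (h : Q.IsBridgingExtension N v a b c) : Q.IsBridgingExtension N v c b a := by
  refine ⟨h.four_le, h.conn3, h.nonColoop, h.config.swap_outer h.nonempty, ?_⟩
  rw [show ({c, b, a} : Set α) = {a, b, c} by ext; simp; tauto, h.span]

section

variable (h : Q.IsBridgingExtension N v a b c)
include h

lemma rk_rest : Q.M.rk ((Q.M.E \ {v}) \ {a, b, c}) = Q.M.rk Q.M.E - 1 := by
  have := h.config.triad
  rwa [del_M, h.nonColoop.rk_delete_ground, delete_ground, rk_deleteElem (by simp)] at this

lemma ne_a : v ≠ a := fun e => h.config.par₁.nonLoop_left.mem.2 e.symm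
lemma ne_b : v ≠ b := fun e => h.config.par₃.nonLoop_left.mem.2 e.symm
lemma ne_c : v ≠ c := fun e => h.config.par₃.symm.nonLoop_left.mem.2 e.symm

lemma mem_a : a ∈ Q.M.E := h.config.par₁.nonLoop_left.mem.1
lemma mem_c : c ∈ Q.M.E := h.config.par₃.symm.nonLoop_left.mem.1

lemma mem_v : v ∈ Q.M.E := by
  by_contra hv
  have h1 := h.span
  rw [← rk_inter_ground, insert_inter_of_notMem hv, rk_inter_ground, h.rk_rest] at h1
  lia

lemma par₁ : Q.M.NonParallel a b := (nonParallel_delete h.ne_a h.ne_b).1 h.config.par₁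
lemma par₂ : Q.M.NonParallel a c := (nonParallel_delete h.ne_a h.ne_c).1 h.config.par₂
lemma par₃ : Q.M.NonParallel b c := (nonParallel_delete h.ne_b h.ne_c).1 h.config.par₃

lemma triangle : Q.M.rk {a, b, c} = 2 := by
  have := h.config.triangle
  rwa [del_M, rk_deleteElem (by simp [h.ne_a, h.ne_b, h.ne_c])] at this

lemma span₁ : Q.M.rk (insert a ((Q.M.E \ {v}) \ {a, b, c})) = Q.M.rk Q.M.E := by
  have := h.config.span₁
  rwa [del_M, h.nonColoop.rk_delete_ground, delete_ground, rk_deleteElem (by simp [h.ne_a])] at this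

lemma span₃ : Q.M.rk (insert c ((Q.M.E \ {v}) \ {a, b, c})) = Q.M.rk Q.M.E := by
  have := h.config.span₃
  rwa [del_M, h.nonColoop.rk_delete_ground, delete_ground, rk_deleteElem (by simp [h.ne_c])] at this

lemma nonSeries₁ : Q.M.NonSeries a b := by
  have h1 := Q.M.rk_mono (X := insert c ((Q.M.E \ {v}) \ {a, b, c})) (Y := Q.M.E \ {a, b}) (by
    have := h.mem_c; have := h.par₂.ne; have := h.par₃.ne
    intro z; simp; grind)
  have h2 := Q.M.rk_le_rk_ground (Q.M.E \ {a, b})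
  rw [h.span₃] at h1
  rw [NonSeries]; lia

lemma nonColoop_b : Q.M.NonColoop b := h.nonSeries₁.symm.nonColoop_left

lemma nonSeries_v : Q.M.NonSeries v b := by
  have h1 := Q.M.rk_mono (X := insert c ((Q.M.E \ {v}) \ {a, b, c})) (Y := Q.M.E \ {v, b}) (by
    have := h.mem_c; have := h.ne_c; have := h.par₃.ne
    intro z; simp; grind)
  have h2 := Q.M.rk_le_rk_ground (Q.M.E \ {v, b})
  rw [h.span₃] at h1
  rw [NonSeries]; lia

lemma four_le_ext : 4 ≤ (Q.M ＼ {v} ／ {a} ＼ {b}).E.ncard :=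
  h.four_le.trans h.config.ext.ncard_le

/-- Deleting two elements of the triangle keeps `Q` connected. -/
lemma conn_delete_delete (hvc : Q.M.NonParallel v c) : (Q.M ＼ {a} ＼ {b}).Conn := by
  have hE := h.mem_c
  have hac := h.par₂.ne
  have hbc := h.par₃.ne
  have hab := h.par₁.ne
  have hc0 : (Q.M ＼ {v} ／ {a} ＼ {b} ＼ {c}).Conn :=
    h.config.ext.1.conn_delete h.four_le_ext (by
      simp [hE, h.ne_c.symm, hac.symm, hbc.symm])
  set W := (Q.M.E \ {v}) \ {a, b, c} with hW
  have hcL : Q.M.NonLoop c := h.par₂.symm.nonLoop_left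
  have haL : Q.M.NonLoop a := h.par₂.nonLoop_left
  have hraise : ∀ w, Q.M.rk (insert w W) = Q.M.rk Q.M.E → ∀ X ⊆ W,
      Q.M.rk (insert w X) = Q.M.rk X + 1 := by
    intro w hw X hX
    have h1 := Q.M.rk_insert_le w X
    have h2 := Q.M.le_rk_insert w X
    by_contra hne
    have h3 := rk_insert_eq_of_subset (M := Q.M) (e := w) hX (by lia)
    have := h.rk_rest
    lia
  have e1 : Q.M ＼ {v} ／ {a} ＼ {b} ＼ {c} = Q.M ＼ {a} ＼ {b} ／ {c} ＼ {v} := by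
    refine ext_rk (by ext z; simp; tauto) fun X hX => ?_
    have hXW : X ⊆ W := by
      intro z hz; have := hX hz; simp at this; simp [hW]; tauto
    have n1 : a ∉ X := fun hz => (hXW hz).2 (by simp)
    have n2 : b ∉ X := fun hz => (hXW hz).2 (by simp)
    have n3 : c ∉ X := fun hz => (hXW hz).2 (by simp)
    have n4 : v ∉ X := fun hz => (hXW hz).1.2 rfl
    rw [rk_deleteElem n3, rk_deleteElem n2, rk_contractElem,
      rk_deleteElem (by simp [h.ne_a, n4]), rk_deleteElem (by simp [h.ne_a]), rk_deleteElem n4,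
      rk_contractElem, rk_deleteElem (by simp [hbc, n2]), rk_deleteElem (by simp [hac, n1]),
      rk_deleteElem (by simp [hbc]), rk_deleteElem (by simp [hac]),
      hraise a h.span₁ X hXW, hraise c h.span₃ X hXW, haL, hcL]
  rw [e1] at hc0
  have hbC : (Q.M ＼ {a}).NonColoop b := (nonColoop_delete h.nonSeries₁.nonColoop_left).2 h.nonSeries₁
  have hcL' : (Q.M ＼ {a} ＼ {b}).NonLoop c :=
    (nonLoop_delete hbc).2 ((nonLoop_delete hac).2 hcL)
  have hrk : (Q.M ＼ {a} ＼ {b}).rk (Q.M ＼ {a} ＼ {b}).E = Q.M.rk Q.M.E := by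
    rw [hbC.rk_delete_ground, h.nonSeries₁.nonColoop_left.rk_delete_ground]
  have hcC : (Q.M ＼ {a} ＼ {b}).NonColoop c := by
    rw [NonColoop, hrk, rk_deleteElem (by simp), rk_deleteElem (by simp), ← h.span]
    congr 1
    have := h.mem_v; have := h.ne_a; have := h.ne_b; have := h.ne_c
    ext z; simp; grind
  refine Conn.of_contract (hc0.of_delete ?_ ?_) hcL' hcC
  · rw [nonLoop_contract hcL', nonParallel_delete hbc h.ne_b.symm,
      nonParallel_delete hac h.ne_a.symm]
    exact hvc.symm
  · rw [nonColoop_contract hcL'.mem h.ne_c.symm, NonColoop, hrk, rk_deleteElem (by simp),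
      rk_deleteElem (by simp), ← h.span₃]
    congr 1
    have := h.ne_c
    ext z; simp; grind

/-- Without a small obstruction, goodness extends over `v` once one element of the triangle is
contracted and another one deleted. -/
lemma good_con_del (hvS : Q.M.rk (insert v {a, b, c}) = 3) (hno : ¬ Q.HasSmallObstruction N) :
    ((Q.con a).del b).Good := by
  by_contra hbad
  have hE := h.mem_c
  have hac := h.par₂.ne
  have hbc := h.par₃.ne
  have hab := h.par₁.ne
  have hvC := h.nonColoop
  have haL : Q.M.NonLoop a := h.par₂.nonLoop_left
  have hvaP : Q.M.NonParallel a v := by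
    have r1 := Q.M.rk_pair_le a v
    by_contra hne
    have r2 : Q.M.rk {a} = 1 := haL
    have r3 := Q.M.le_rk_insert v {a}
    rw [pair_comm v a] at r3
    rw [NonParallel] at hne
    have r4 := rk_insert_eq_of_subset (M := Q.M) (X := {a}) (Y := {a, b, c}) (e := v) (by simp)
      (by rw [pair_comm v a]; lia)
    rw [hvS, h.triangle] at r4
    norm_num at r4
  have hbC := h.nonColoop_b
  have hbC1 : (Q.M ／ {a}).NonColoop b := (nonColoop_contract h.mem_a hab).2 hbC
  have hvC1 : (Q.M ／ {a}).NonColoop v := (nonColoop_contract h.mem_a h.ne_a.symm).2 hvC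
  have hvbS1 : (Q.M ／ {a}).NonSeries v b :=
    (nonSeries_contract h.mem_a h.ne_a.symm hab).2 h.nonSeries_v
  have hvL1 : (Q.M ／ {a}).NonLoop v := (nonLoop_contract haL).2 hvaP
  have hvL : (Q.M ／ {a} ＼ {b}).NonLoop v := (nonLoop_delete h.ne_b.symm).2 hvL1
  have hvC2 : (Q.M ／ {a} ＼ {b}).NonColoop v := (nonColoop_delete hbC1).2 hvbS1.symm
  -- `K` is an extension by `v` of the extension or coextension `K ＼ v` of `N`
  set K := (Q.con a).del b with hK
  have hKQ : K.IsMinor Q := (isMinor_del (Q := Q.con a) hbC1).trans (isMinor_con haL)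
  have eK : K.del v = ((Q.del v).con a).del b := by
    rw [hK, (Q.con a).del_del_comm hvbS1.symm, Q.del_con_comm hvC haL h.ne_a]
  have hext : (K.del v).IsExtensionBy N c := eK ▸ h.config.ext
  have hn4 : 4 ≤ (K.del v).M.E.ncard := h.four_le.trans hext.ncard_le
  have hvE : v ∈ K.M.E := hvL.mem
  have hcE : c ∈ (K.del v).M.E := ⟨⟨⟨hE, hac.symm⟩, hbc.symm⟩, h.ne_c.symm⟩
  have hcE' : c ∈ K.M.E := hcE.1
  have hpar : ∀ y ∈ K.M.E, y ≠ v → K.M.NonParallel v y := by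
    intro y hy hyv
    by_contra hp
    have hyL : (K.M ＼ {v}).NonLoop y := hext.1.nonLoop hn4 ⟨hy, hyv⟩
    exact hbad (Good.of_delete_parallel (Q := K) hvL ((nonLoop_delete hyv.symm).1 hyL) hyv.symm hp
      hext.2.1)
  have hK3 : K.M.Conn3 := hext.1.of_delete (M := K.M) hn4 hvL hvC2 hpar
  have hKn : 4 ≤ K.M.E.ncard := hn4.trans (ncard_le_ncard sdiff_subset K.M.ground_finite)
  have hcC' : K.M.NonColoop c := hK3.nonColoop hKn hcE'
  have hcL' : K.M.NonLoop c := hK3.nonLoop hKn hcE'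
  have hvcS : K.M.NonSeries v c := hK3.nonSeries hKn hvE hcE' h.ne_c
  have hcC2 : (K.M ＼ {v}).NonColoop c := (nonColoop_delete hvC2).2 hvcS
  rcases hext.2.2 with h1 | h1 | h1
  · exact hno (HasSmallObstruction.of_isMinor ⟨K, .refl K, hK3, hbad,
      Or.inr (Or.inl ⟨v, hvE, h1, hext.2.1⟩)⟩ hKQ)
  · have hcomm : (K.del v).del c = (K.del c).del v := K.del_del_comm hvcS
    have hgvc : ((K.del c).del v).Good := hcomm ▸ hext.2.1.del (Q := K.del v) hcC2
    rw [del_M, del_M, delete_comm] at h1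
    have h3 : (K.M ＼ {c} ＼ {v}).Conn3 := h1.conn3 h.nonempty h.conn3
    have hvC3 : (K.M ＼ {c}).NonColoop v := (nonColoop_delete hcC').2 hvcS.symm
    have hKc : (K.del c).Good := by
      by_contra hb
      refine hno (HasSmallObstruction.of_isMinor ⟨K.del c, .refl _, ?_, hb,
        Or.inr (Or.inl ⟨v, ⟨hvE, h.ne_c⟩, h1, hgvc⟩)⟩
        ((isMinor_del (Q := K) hcC').trans hKQ))
      refine h3.of_delete (h1.ncard_eq.symm ▸ h.four_le) ((nonLoop_delete h.ne_c.symm).2 hvL) hvC3 ?_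
      intro y hy hyv
      exact (nonParallel_delete h.ne_c.symm (fun h => hy.2 h.symm)).2 (hpar y hy.1 hyv)
    refine hbad (Good.of_delete_delete h.ne_c ?_ hvcS hext.2.1 hKc)
    exact hext.1.conn_delete hn4 hcE
  · have hcomm : (K.del v).con c = (K.con c).del v := K.del_con_comm hvC2 hcL' h.ne_c
    refine hno (HasSmallObstruction.of_isMinor ⟨K, .refl K, hK3, hbad,
      Or.inr (Or.inr ⟨c, hcE', v, hvE, h.ne_c.symm, ?_, ?_, Or.inr hext.1⟩)⟩ hKQ)
    · rwa [contract_delete_comm _ (disjoint_singleton.2 h.ne_c.symm)]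
    · rw [← hcomm]
      exact hext.2.1.con (Q := K.del v) ((nonLoop_delete h.ne_c).2 hcL')

lemma good_del (hvS : Q.M.rk (insert v {a, b, c}) = 3) (hno : ¬ Q.HasSmallObstruction N) :
    (Q.del b).Good := by
  have hac := h.par₂.ne
  have hbc := h.par₃.ne
  have hab := h.par₁.ne
  have hbC := h.nonColoop_b
  have haL : Q.M.NonLoop a := h.par₂.nonLoop_left
  have hcL : Q.M.NonLoop c := h.par₂.symm.nonLoop_left
  have haL1 : (Q.M ＼ {b}).NonLoop a := (nonLoop_delete hab.symm).2 haL
  have hcL1 : (Q.M ＼ {b}).NonLoop c := (nonLoop_delete hbc).2 hcL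
  have hacP : (Q.M ＼ {b}).NonParallel a c := (nonParallel_delete hab.symm hbc).2 h.par₂
  have g1 : ((Q.del b).con a).Good := by
    rw [Q.del_con_comm hbC haL hab.symm]
    exact h.good_con_del hvS hno
  have g2 : ((Q.del b).con c).Good := by
    rw [Q.del_con_comm hbC hcL hbc]
    refine h.swap_outer.good_con_del ?_ hno
    rw [show ({c, b, a} : Set α) = {a, b, c} by ext; simp; tauto, hvS]
  refine Good.of_contract_contract hac haL1.mem hcL1.mem ?_ hacP g1 g2
  have hc0 : (Q.M ＼ {v} ／ {a} ＼ {b} ／ {c}).Conn :=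
    h.config.ext.1.conn_contract h.four_le_ext (by
      simp [h.mem_c, h.ne_c.symm, hac.symm, hbc.symm])
  have e1 : Q.M ＼ {v} ／ {a} ＼ {b} ／ {c} = Q.M ＼ {b} ／ {a} ／ {c} ＼ {v} := by
    rw [contract_delete_comm _ (disjoint_singleton.2 hab), delete_comm,
      ← contract_delete_comm _ (disjoint_singleton.2 h.ne_a.symm),
      ← contract_delete_comm _ (disjoint_singleton.2 h.ne_c.symm)]
  rw [e1] at hc0
  have hvS' : Q.M.rk {a, c, v} = 3 := by
    have r1 : Q.M.rk {a, c} = 2 := h.par₂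
    have r2 := rk_insert_eq_of_subset (M := Q.M) (X := {a, c}) (Y := {a, c, v}) (e := b)
      (by intro; simp; tauto) (by rw [r1, insert_comm, h.triangle])
    rw [← r2, ← hvS]
    congr 1; ext; simp; tauto
  have hcL2 : (Q.M ＼ {b} ／ {a}).NonLoop c := (nonLoop_contract haL1).2 hacP
  refine hc0.of_delete ?_ ?_
  · rw [nonLoop_contract hcL2, nonParallel_contract haL1, rk_deleteElem, hvS']
    simp [hab.symm, hbc, h.ne_b.symm]
  · rw [nonColoop_contract hcL2.mem h.ne_c.symm, nonColoop_contract haL1.mem h.ne_a.symm,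
      nonColoop_delete hbC]
    exact h.nonSeries_v.symm

/-- If `v` is not spanned by the triangle, there is a small obstruction: otherwise the deletions of
two elements of the triangle would be good, and so would `Q`. -/
lemma hasSmallObstruction (hvS : Q.M.rk (insert v {a, b, c}) = 3) : Q.HasSmallObstruction N := by
  by_contra hno
  have h1 := h.good_del hvS hno
  have h2 : (Q.del a).Good := by
    refine h.swap_right.swap_outer.swap_right.good_del ?_ hno
    rw [insert_comm b a, hvS]
  have hvc : Q.M.NonParallel v c := by
    have r1 := Q.M.rk_pair_le v c
    by_contra hne
    have r2 : Q.M.rk {c} = 1 := h.par₂.symm.nonLoop_left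
    have r3 := Q.M.le_rk_insert v {c}
    rw [NonParallel] at hne
    have r4 := rk_insert_eq_of_subset (M := Q.M) (X := {c}) (Y := {a, b, c}) (e := v) (by simp)
      (by lia)
    rw [hvS, h.triangle] at r4
    norm_num at r4
  exact h.config.bad ((Good.of_delete_delete h.par₁.ne (h.conn_delete_delete hvc) h.nonSeries₁ h2
    h1).del h.nonColoop)

/-- If `v` is spanned by the triangle, it takes the place of `b`, provided that the deletion of `b` is
bad. -/
lemma replace (hvS : Q.M.rk (insert v {a, b, c}) = 2) (hva : Q.M.NonParallel v a)
    (hvc : Q.M.NonParallel v c) (hb : ¬ (Q.del b).Good) :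
    (Q.del b).IsTriangleTriad N a v c := by
  have hac := h.par₂.ne
  have hbc := h.par₃.ne
  have hab := h.par₁.ne
  have hbC := h.nonColoop_b
  have hW : (Q.M.E \ {b}) \ {a, v, c} = (Q.M.E \ {v}) \ {a, b, c} := by ext; simp; tauto
  have hbn := h.ne_b
  refine ⟨hb, ?_, ?_, ?_, ?_, ?_, ?_, ?_, ?_, ?_⟩
  · exact (nonParallel_delete hab.symm hbn.symm).2 hva.symm
  · exact (nonParallel_delete hab.symm hbc).2 h.par₂
  · exact (nonParallel_delete hbn.symm hbc).2 hvc
  · rw [del_M, rk_deleteElem (by simp [hab.symm, hbn.symm, hbc])]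
    have r1 : Q.M.rk {a, c} = 2 := h.par₂
    have r2 := Q.M.rk_mono (X := {a, c}) (Y := {a, v, c}) (by intro; simp; tauto)
    have r3 := Q.M.rk_mono (X := {a, v, c}) (Y := insert v {a, b, c}) (by intro; simp; tauto)
    lia
  · rw [del_M, hbC.rk_delete_ground, rk_deleteElem (by simp), delete_ground, hW, h.rk_rest]
  · rw [del_M, hbC.rk_delete_ground, rk_deleteElem (by simp [hab.symm]), delete_ground, hW, h.span₁]
  · rw [del_M, hbC.rk_delete_ground, rk_deleteElem (by simp [hbn.symm]), delete_ground, hW, h.span]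
  · rw [del_M, hbC.rk_delete_ground, rk_deleteElem (by simp [hbc]), delete_ground, hW, h.span₃]
  · have hvbS1 : (Q.M ／ {a}).NonSeries v b :=
      (nonSeries_contract h.mem_a h.ne_a.symm hab).2 h.nonSeries_v
    have haL : Q.M.NonLoop a := h.par₂.nonLoop_left
    rw [Q.del_con_comm hbC haL hab.symm, (Q.con a).del_del_comm hvbS1.symm,
      ← Q.del_con_comm h.nonColoop haL h.ne_a]
    exact h.config.ext

end

/-- If `v` is spanned by the triangle, it can take the place of one of its elements. This is the
element parallel to `v`, if there is one, and otherwise an element with a bad deletion. -/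
lemma exists_replace (h : Q.IsBridgingExtension N v a b c)
    (hvS : Q.M.rk (insert v {a, b, c}) = 2) :
    ∃ a' b' c', Q.IsBridgingExtension N v a' b' c' ∧ ({a', b', c'} : Set α) = {a, b, c} ∧
      (Q.del b').IsTriangleTriad N a' v c' := by
  have e1 : ({a, c, b} : Set α) = {a, b, c} := by rw [pair_comm]
  have e2 : ({b, a, c} : Set α) = {a, b, c} := insert_comm _ _ _
  have h1 := h.swap_right
  have h2 := h.swap_right.swap_outer.swap_right
  have hv : Q.M.NonLoop v := by
    have r1 := Q.M.rk_insert_le v ∅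
    have := Q.M.rk_singleton_le v
    by_contra hne
    have r2 := rk_insert_eq_of_subset (M := Q.M) (X := ∅) (Y := (Q.M.E \ {v}) \ {a, b, c}) (e := v)
      (by simp) (by
        have := Q.M.rk_nonneg {v}
        rw [NonLoop] at hne
        rw [insert_empty_eq, rk_empty]
        lia)
    rw [h.span, h.rk_rest] at r2
    lia
  have key : ∀ a b c, Q.IsBridgingExtension N v a b c → Q.M.rk (insert v {a, b, c}) = 2 →
      ¬ Q.M.NonParallel v b → (Q.del b).IsTriangleTriad N a v c := by
    intro a b c h hvS hp
    have hbL : Q.M.NonLoop b := h.par₃.nonLoop_left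
    have htrans : ∀ u, Q.M.NonParallel b u → Q.M.NonParallel v u := by
      intro u hu
      have r0 := Q.M.rk_pair_le v b
      have r1 := Q.M.rk_mono (X := {v}) (Y := {v, b}) (by simp)
      have r2 : Q.M.rk {v} = 1 := hv
      rw [NonParallel] at hp hu ⊢
      have r3 := rk_insert_eq_of_subset (M := Q.M) (X := {v}) (Y := {v, u}) (e := b) (by simp)
        (by rw [pair_comm]; lia)
      have r4 := Q.M.rk_mono (X := {b, u}) (Y := {b, v, u}) (by intro; simp; tauto)
      have := Q.M.rk_pair_le v u
      lia
    refine h.replace hvS (htrans a h.par₁.symm) (htrans c h.par₃) fun hg => ?_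
    exact h.config.bad ((Good.of_delete_parallel hbL hv h.ne_b.symm (fun h => hp h.symm) hg).del
      h.nonColoop)
  by_cases hpb : Q.M.NonParallel v b
  swap
  · exact ⟨a, b, c, h, rfl, key a b c h hvS hpb⟩
  by_cases hpc : Q.M.NonParallel v c
  swap
  · exact ⟨a, c, b, h1, e1, key a c b h1 (e1 ▸ hvS) hpc⟩
  by_cases hpa : Q.M.NonParallel v a
  swap
  · exact ⟨b, a, c, h2, e2, key b a c h2 (e2 ▸ hvS) hpa⟩
  by_cases hgb : (Q.del b).Good
  swap
  · exact ⟨a, b, c, h, rfl, h.replace hvS hpa hpc hgb⟩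
  by_cases hga : (Q.del a).Good
  swap
  · exact ⟨b, a, c, h2, e2, h2.replace (e2 ▸ hvS) hpb hpc hga⟩
  exact absurd ((Good.of_delete_delete h.par₁.ne (h.conn_delete_delete hpc) h.nonSeries₁ hga
    hgb).del h.nonColoop) h.config.bad

end IsBridgingExtension

end WeightedMatroid

end BridgingExtensions

/-! ### Bridging a separation -/

section Bridging

open Set

namespace Matroid

variable {α : Type*} {M : Matroid α} {U I : Set α}

/-- Elements none of which is spanned by `U` and the other ones are independent over `U`. -/
lemma rk_union_eq_add_ncard [M.RankFinite] (hI : I.Finite)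
    (h : ∀ v ∈ I, M.rk (U ∪ I \ {v}) = M.rk (U ∪ I) - 1) : M.rk (U ∪ I) = M.rk U + I.ncard := by
  have key : ∀ K ⊆ I, M.rk (U ∪ I) ≤ M.rk (U ∪ (I \ K)) + K.ncard ∧
      M.rk (U ∪ (I \ K)) + K.ncard ≤ M.rk (U ∪ I) := by
    intro K hK
    have hKf := hI.subset hK
    induction K, hKf using Set.Finite.induction_on with
    | empty => simp
    | @insert v K' hv hKf ih =>
      rw [insert_subset_iff] at hK
      have ih' := ih hK.2
      rw [ncard_insert_of_notMem hv hKf]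
      have hvI : v ∈ I \ K' := ⟨hK.1, hv⟩
      have e1 : insert v (U ∪ (I \ insert v K')) = U ∪ (I \ K') := by
        ext z; simp only [mem_insert_iff, mem_union, mem_sdiff]; by_cases hz : z = v
        · subst hz; simp [hK.1, hv]
        · simp [hz]
      have h1 := M.rk_insert_le v (U ∪ (I \ insert v K'))
      have h2 := M.le_rk_insert v (U ∪ (I \ insert v K'))
      rw [e1] at h1 h2
      have h3 : M.rk (U ∪ (I \ K')) ≠ M.rk (U ∪ (I \ insert v K')) := by
        intro he
        have := rk_insert_eq_of_subset (M := M) (X := U ∪ (I \ insert v K')) (Y := U ∪ I \ {v})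
          (e := v) (by
            intro z; simp only [mem_insert_iff, mem_union, mem_sdiff, mem_singleton_iff]; tauto)
          (by rw [e1, he])
        rw [← union_insert, insert_sdiff_singleton, insert_eq_of_mem hK.1, h v hK.1] at this
        lia
      push_cast
      lia
  have := key I subset_rfl
  rw [sdiff_self, union_empty] at this
  lia

/-- A set of elements each of which is spanned by `U` is spanned by `U`. -/
lemma rk_union_eq_of_forall [M.RankFinite] (hI : I.Finite)
    (h : ∀ v ∈ I, M.rk (insert v U) = M.rk U) : M.rk (U ∪ I) = M.rk U := by
  induction I, hI using Set.Finite.induction_on with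
  | empty => simp
  | @insert v K hv hKf ih =>
    rw [union_insert, rk_insert_eq_of_subset subset_union_left (h v (by simp))]
    exact ih fun w hw => h w (mem_insert_of_mem _ hw)

end Matroid

open Matroid

namespace WeightedMatroid

variable {α β G : Type*} [CommGroup G] {Q Q' P : WeightedMatroid α G} {x y z a b c e v t : α}
  {N : Matroid β} {N' : Matroid α} {C U V S W X Y : Set α}

/-- No separation of connectivity at most one has `S` on one side and `W` on the other. -/
def IsBridged (Q : WeightedMatroid α G) (S W : Set α) : Prop :=
  ∀ X, S ⊆ X → X ⊆ Q.M.E \ W → Q.M.rk Q.M.E + 2 ≤ Q.M.rk X + Q.M.rk (Q.M.E \ X)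

lemma IsBridged.dual (h : Q.IsBridged S W) : Q.dual.IsBridged S W := by
  intro X hSX hXW
  have hX : X ⊆ Q.M.E := hXW.trans sdiff_subset
  have := h X hSX hXW
  rw [dual_M, dual_ground, rk_dual _ hX, rk_dual _ sdiff_subset, rk_dual _ subset_rfl,
    sdiff_sdiff_cancel_left hX, sdiff_self, rk_empty]
  have := ncard_ground_diff hX
  lia

/-- If `S` and `W` partition a minor with connectivity one, but are bridged in `Q`, then a single
element `v` that was deleted or contracted already raises the connectivity. -/
lemma IsMinorVia.exists_bridge (h : P.IsMinorVia Q C) (hSW : S ∪ W = P.M.E) (hd : Disjoint S W)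
    (hl : P.M.rk S + P.M.rk W = P.M.rk P.M.E + 1) (hb : Q.IsBridged S W) :
    (∃ v ∈ (Q.M.E \ P.M.E) \ C, Q.M.rk (insert v (W ∪ C)) = Q.M.rk (W ∪ C) + 1) ∨
    (∃ v ∈ C, Q.M.rk (S ∪ C \ {v}) = Q.M.rk (S ∪ C)) := by
  by_contra! hcon
  obtain ⟨h1, h2⟩ := hcon
  have hS : S ⊆ P.M.E := hSW ▸ subset_union_left
  have hW : W ⊆ P.M.E := hSW ▸ subset_union_right
  have hCf := h.finite
  have r1 : Q.M.rk (S ∪ C) = Q.M.rk S + C.ncard := rk_union_eq_add_ncard hCf fun v hv => by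
    have e := Q.M.rk_diff_singleton_ge v (S ∪ C)
    have e2 := Q.M.rk_mono (X := (S ∪ C) \ {v}) (Y := S ∪ C \ {v}) (by
      intro z; simp only [mem_sdiff, mem_union]; tauto)
    have e3 := Q.M.rk_mono (X := S ∪ C \ {v}) (Y := S ∪ C) (by
      intro z; simp only [mem_sdiff, mem_union]; tauto)
    have := h2 v hv
    lia
  have r2 : Q.M.rk ((W ∪ C) ∪ ((Q.M.E \ P.M.E) \ C)) = Q.M.rk (W ∪ C) :=
    rk_union_eq_of_forall (Q.M.ground_finite.subset (sdiff_subset.trans sdiff_subset)) fun v hv => by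
      have := h1 v hv
      have := Q.M.rk_insert_le v (W ∪ C)
      have := Q.M.le_rk_insert v (W ∪ C)
      lia
  have e1 : (W ∪ C) ∪ ((Q.M.E \ P.M.E) \ C) = Q.M.E \ S := by
    ext z
    have a1 := Set.ext_iff.1 hSW z
    have a2 := @h.ground z
    have a3 := @h.sub z
    have a4 : z ∈ C → z ∉ P.M.E := fun hz hz' => disjoint_left.1 h.disj hz hz'
    have a5 : z ∈ S → z ∉ W := fun hz hz' => disjoint_left.1 hd hz hz'
    simp only [mem_union, mem_sdiff] at *
    tauto
  rw [e1] at r2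
  have := hb S subset_rfl (subset_sdiff.2 ⟨hS.trans h.ground, hd⟩)
  have s1 := h.rk S hS
  have s2 := h.rk W hW
  have s3 := h.rk _ subset_rfl
  rw [h.span] at s3
  lia

lemma IsTriangleTriad.disjoint_union (h : P.IsTriangleTriad N a b c) :
    ({a, b, c} : Set α) ∪ (P.M.E \ {a, b, c}) = P.M.E :=
  union_sdiff_cancel (by
    simp [insert_subset_iff, h.par₁.nonLoop_left.mem, h.par₃.nonLoop_left.mem,
      h.par₃.symm.nonLoop_left.mem])

/-- Uncrossing two separations, one of the deletion of `v` and one of the deletion of `t`. -/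
lemma not_separated_of_bridged {E : Set α} (hE : E = Q.M.E) (ht : t ∈ E) (hv : v ∈ E)
    (htv : t ≠ v) (hb : Q.IsBridged S W)
    (hX : X ⊆ (E \ {v}) \ W) (hY : Y ⊆ (E \ {t}) \ W) (hSX : S ⊆ X) (htX : t ∈ X) (hvY : v ∈ Y)
    (lX : Q.M.rk X + Q.M.rk ((E \ {v}) \ X) ≤ Q.M.rk E + 1)
    (lY : Q.M.rk Y + Q.M.rk ((E \ {t}) \ Y) ≤ Q.M.rk E + 1)
    (kX : Q.M.rk (X \ {t}) = Q.M.rk X) (kY : Q.M.rk (Y \ {v}) = Q.M.rk Y)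
    (hA : Q.M.rk E + 1 ≤ Q.M.rk ((X \ {t}) ∩ (Y \ {v})) +
      Q.M.rk (((E \ {t}) \ {v}) \ ((X \ {t}) ∩ (Y \ {v})))) : False := by
  subst hE
  have s1 := Q.M.rk_submod (X \ {t}) (Y \ {v})
  have s2 := Q.M.rk_submod (((Q.M.E \ {v}) \ X)) ((Q.M.E \ {t}) \ Y)
  have hvX : v ∉ X := fun h => (hX h).1.2 rfl
  have htY : t ∉ Y := fun h => (hY h).1.2 rfl
  have e1 : ((Q.M.E \ {v}) \ X) ∪ ((Q.M.E \ {t}) \ Y) =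
      ((Q.M.E \ {t}) \ {v}) \ ((X \ {t}) ∩ (Y \ {v})) := by
    ext z
    simp only [mem_union, mem_sdiff, mem_inter_iff, mem_singleton_iff]
    by_cases h1 : z = t
    · subst h1; simp [htX]
    by_cases h2 : z = v
    · subst h2; simp [hvY]
    simp [h1, h2]; tauto
  have e2 : ((Q.M.E \ {v}) \ X) ∩ ((Q.M.E \ {t}) \ Y) = Q.M.E \ (X ∪ Y) := by
    ext z
    simp only [mem_union, mem_sdiff, mem_inter_iff, mem_singleton_iff]
    by_cases h1 : z = t
    · subst h1; simp [htX]
    by_cases h2 : z = v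
    · subst h2; simp [hvY]
    simp [h1, h2]; tauto
  rw [e1, e2] at s2
  have hbX := hb (X ∪ Y) (hSX.trans subset_union_left) (by
    refine union_subset ?_ ?_
    · intro z hz; exact ⟨(hX hz).1.1, (hX hz).2⟩
    · intro z hz; exact ⟨(hY hz).1.1, (hY hz).2⟩)
  -- `t` and `v` are spanned by the two sides without them
  have k1 : Q.M.rk (X ∪ Y) = Q.M.rk ((X \ {t}) ∪ (Y \ {v})) := by
    have t1 := rk_insert_eq_of_subset (M := Q.M) (X := X \ {t}) (Y := (X \ {t}) ∪ (Y \ {v}))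
      (e := t) subset_union_left (by rw [insert_sdiff_singleton, insert_eq_of_mem htX, kX])
    have t2 := rk_insert_eq_of_subset (M := Q.M) (X := Y \ {v})
      (Y := insert t ((X \ {t}) ∪ (Y \ {v})))
      (e := v) (subset_union_right.trans (subset_insert _ _))
      (by rw [insert_sdiff_singleton, insert_eq_of_mem hvY, kY])
    rw [← t1, ← t2]
    congr 1
    ext z
    simp only [mem_insert_iff, mem_union, mem_sdiff, mem_singleton_iff]
    by_cases h1 : z = t
    · subst h1; simp [htX]
    by_cases h2 : z = v
    · subst h2; simp [hvY]
    simp [h1, h2]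
  lia

/-- The second alternative of `IsMinorVia.exists_bridge` is dual to the first one. -/
lemma IsMinorVia.rk_insert_dual (h : P.IsMinorVia Q C) (hS : S ⊆ P.M.E) (hv : v ∈ C)
    (hvS : Q.M.rk (S ∪ C \ {v}) = Q.M.rk (S ∪ C)) :
    Q.M✶.rk (insert v ((P.M.E \ S) ∪ ((Q.M.E \ P.M.E) \ C))) =
      Q.M✶.rk ((P.M.E \ S) ∪ ((Q.M.E \ P.M.E) \ C)) + 1 := by
  have hE := h.ground
  have hvE : v ∉ P.M.E := fun hz => disjoint_left.1 h.disj hv hz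
  set D := (Q.M.E \ P.M.E) \ C with hD
  have hDE : D ⊆ Q.M.E := sdiff_subset.trans sdiff_subset
  have hWE : P.M.E \ S ⊆ Q.M.E := sdiff_subset.trans hE
  have hvWD : v ∉ (P.M.E \ S) ∪ D := by
    rintro (h | h)
    · exact hvE h.1
    · exact h.2 hv
  have e1 : Q.M.E \ ((P.M.E \ S) ∪ D) = S ∪ C := by
    ext z
    have h1 := @hS z
    have h2 := @hE z
    have h3 := @h.sub z
    have h4 : z ∈ C → z ∉ P.M.E := fun hz hz' => disjoint_left.1 h.disj hz hz'
    simp only [hD, mem_sdiff, mem_union]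
    tauto
  have e2 : Q.M.E \ insert v ((P.M.E \ S) ∪ D) = S ∪ C \ {v} := by
    have hvS : v ∉ S := fun hz => hvE (hS hz)
    rw [← union_singleton, ← sdiff_sdiff, e1, union_sdiff_distrib, sdiff_singleton_eq_self hvS]
  have hfin : ((P.M.E \ S) ∪ D).Finite := Q.M.ground_finite.subset (union_subset hWE hDE)
  rw [rk_dual Q.M (insert_subset (h.sub hv) (union_subset hWE hDE)),
    rk_dual Q.M (union_subset hWE hDE), e2, e1, ncard_insert_of_notMem hvWD hfin, hvS]
  push_cast; lia

/-- The induction step of `hasSmallObstruction_of_isBridged`, for an element `v` that was deleted in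
the minor and raises the connectivity. -/
lemma IsMinorVia.hasSmallObstruction_step (hN4 : 4 ≤ N.E.ncard) (hN : N.Conn3)
    (h : P.IsMinorVia Q C) (hP : P.IsTriangleTriad N a b c)
    (hb : Q.IsBridged {a, b, c} (P.M.E \ {a, b, c}))
    (ih : ∀ Q' P' : WeightedMatroid α G, ∀ a b c, Q'.M.E.ncard < Q.M.E.ncard → P'.IsMinor Q' →
      P'.IsTriangleTriad N a b c → Q'.IsBridged {a, b, c} (P'.M.E \ {a, b, c}) →
      Q'.HasSmallObstruction N)
    (hv : v ∈ (Q.M.E \ P.M.E) \ C)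
    (hvW : Q.M.rk (insert v ((P.M.E \ {a, b, c}) ∪ C)) = Q.M.rk ((P.M.E \ {a, b, c}) ∪ C) + 1) :
    Q.HasSmallObstruction N := by
  obtain ⟨⟨hvE, hvP⟩, hvC⟩ := hv
  set W := P.M.E \ {a, b, c} with hW
  have hWP : W ⊆ P.M.E := sdiff_subset
  obtain ⟨hvNC, hPv⟩ := h.of_notMem hvP hvC
  by_cases hbv : (Q.del v).IsBridged {a, b, c} W
  · exact (ih (Q.del v) P a b c (ncard_sdiff_singleton_lt_of_mem hvE Q.M.ground_finite)
      ⟨C, hPv⟩ hP hbv).of_isMinor (isMinor_del hvNC)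
  -- the one-element extension `R` of `P` by `v`
  obtain ⟨R, hRE, hR⟩ := IsMinorVia.exists_via (Q := Q) (C := C) (E' := insert v P.M.E)
    (insert_subset hvE h.ground) h.sub (disjoint_insert_right.2 ⟨hvC, h.disj⟩) h.indep (by
      have h1 := Q.M.rk_mono (X := P.M.E ∪ C) (Y := insert v P.M.E ∪ C)
        (union_subset_union_left _ (subset_insert _ _))
      have h2 := Q.M.rk_le_rk_ground (insert v P.M.E ∪ C)
      rw [h.span] at h1
      lia)
  have hREv : R.M.E \ {v} = P.M.E := by rw [hRE]; simp [hvP]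
  have hRv : R.M.NonColoop v := by
    rw [NonColoop, hREv, hR.rk _ (by rw [hRE]; exact subset_insert _ _), hR.rk _ subset_rfl,
      hR.span, h.span]
  have hRP : R.del v = P := by
    have := (IsMinorVia.delete hRv).trans hR
    rw [empty_union] at this
    exact this.eq_of_ground_eq h hREv
  have hWR : W ⊆ R.M.E := by rw [hRE]; exact hWP.trans (subset_insert _ _)
  have hRspan : R.M.rk (insert v ((R.M.E \ {v}) \ {a, b, c})) = R.M.rk R.M.E := by
    have h1 := hP.triad
    rw [← hW, h.rk W hWP, h.rk _ subset_rfl, h.span] at h1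
    rw [hREv, ← hW, hR.rk _ (insert_subset (hRE ▸ mem_insert _ _) hWR), hR.rk _ subset_rfl,
      hR.span, insert_union, hvW]
    lia
  have hext : R.IsBridgingExtension N v a b c := ⟨hN4, hN, hRv, hRP ▸ hP, hRspan⟩
  have hr3 : R.M.rk (insert v {a, b, c}) = 2 ∨ R.M.rk (insert v {a, b, c}) = 3 := by
    have h1 := R.M.rk_insert_le v {a, b, c}
    have h2 := R.M.le_rk_insert v {a, b, c}
    rw [hext.triangle] at h1 h2
    lia
  rcases hr3 with hvS | hvS
  swap
  · exact (hext.hasSmallObstruction hvS).of_isMinor ⟨C, hR⟩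
  obtain ⟨a', t, c', hext', hset, hrep⟩ := hext.exists_replace hvS
  rw [← hset] at hb hbv hW
  have hP' : P.IsTriangleTriad N a' t c' := hRP ▸ hext'.config
  have htv : t ≠ v := hext'.ne_b.symm
  have htP : t ∈ P.M.E := hP'.par₃.nonLoop_left.mem
  have htE : t ∈ Q.M.E := h.ground htP
  have htC : t ∉ C := fun h' => disjoint_left.1 h.disj h' htP
  have hat : a' ≠ t := hext'.par₁.ne
  have htc : t ≠ c' := hext'.par₃.ne
  have hPt : (R.del t).IsMinorVia Q C := by
    have := (IsMinorVia.delete hext'.nonColoop_b).trans hR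
    rwa [empty_union] at this
  have hPtE : (R.del t).M.E = insert v (P.M.E \ {t}) := by
    rw [del_M, delete_ground, hRE, insert_sdiff_of_notMem _ (by simpa using htv.symm)]
  have hWt : (R.del t).M.E \ {a', v, c'} = W := by
    rw [hPtE, hW]
    ext z; simp only [mem_insert_iff, mem_sdiff, mem_singleton_iff]
    by_cases hz : z = v
    · subst hz; simp [hvP]
    · simp [hz]; tauto
  obtain ⟨htNC, hPt'⟩ := hPt.of_notMem (x := t) (by rw [hPtE]; simp [htv]) htC
  by_cases hbt : (Q.del t).IsBridged {a', v, c'} W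
  · exact (ih (Q.del t) (R.del t) a' v c' (ncard_sdiff_singleton_lt_of_mem htE Q.M.ground_finite)
      ⟨C, hPt'⟩ hrep (by rwa [hWt])).of_isMinor (isMinor_del htNC)
  exfalso
  unfold IsBridged at hbv hbt
  push Not at hbv hbt
  obtain ⟨X, hSX, hXW, lX⟩ := hbv
  obtain ⟨Y, hSY, hYW, lY⟩ := hbt
  rw [del_M, hvNC.rk_delete_ground, delete_ground,
    rk_deleteElem (fun hz => (hXW hz).1.2 rfl), rk_deleteElem (by simp)] at lX
  rw [del_M, htNC.rk_delete_ground, delete_ground,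
    rk_deleteElem (fun hz => (hYW hz).1.2 rfl), rk_deleteElem (by simp)] at lY
  have hXW' : X ⊆ (Q.M.E \ {v}) \ W := hXW
  have hYW' : Y ⊆ (Q.M.E \ {t}) \ W := hYW
  have haX : a' ∈ X := hSX (by simp)
  have htX : t ∈ X := hSX (by simp)
  have hcX : c' ∈ X := hSX (by simp)
  have haY : a' ∈ Y := hSY (by simp)
  have hvY : v ∈ Y := hSY (by simp)
  have hcY : c' ∈ Y := hSY (by simp)
  have hvX : v ∉ X := fun h => (hXW' h).1.2 rfl
  have htY : t ∉ Y := fun h => (hYW' h).1.2 rfl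
  have hcov : ∀ z ∈ P.M.E, z = a' ∨ z = t ∨ z = c' ∨ z ∈ W := by
    intro z hz
    rw [hW]
    by_cases hz' : z ∈ ({a', t, c'} : Set α)
    · simp at hz'; tauto
    · exact Or.inr (Or.inr (Or.inr ⟨hz, hz'⟩))
  have haP : a' ∈ P.M.E := hP'.par₁.nonLoop_left.mem
  have hcP : c' ∈ P.M.E := hP'.par₃.symm.nonLoop_left.mem
  have hWn : ∀ z ∈ W, z ≠ a' ∧ z ≠ t ∧ z ≠ c' := by
    intro z hz
    rw [hW] at hz
    have := hz.2
    simp at this; tauto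
  -- In `P` the elements `a'`, `c'` have connectivity two to the rest, `t` included; as the side `X`
  -- has connectivity at most one in `Q ＼ v`, the element `t` is spanned by `X \ {t}`. Likewise `v`
  -- is spanned by `Y \ {v}`, through the minor `R ＼ t`.
  have kX : Q.M.rk (X \ {t}) = Q.M.rk X := by
    have h1 := h.rk_add_le (U := X \ {t}) (V := insert t ((Q.M.E \ {v}) \ X))
      (fun z hz => by
        have := h.sub hz
        have : z ≠ v := by rintro rfl; exact hvC hz
        have : z ≠ t := by rintro rfl; exact htC hz
        simp only [mem_union, mem_sdiff, mem_insert_iff, mem_singleton_iff]; tauto)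
    have e1 : X \ {t} ∩ P.M.E = {a', c'} := by
      ext z
      simp only [mem_inter_iff, mem_sdiff, mem_singleton_iff, mem_insert_iff]
      constructor
      · rintro ⟨⟨h1, h2⟩, h3⟩
        rcases hcov z h3 with h | h | h | h
        · exact Or.inl h
        · exact absurd h h2
        · exact Or.inr h
        · exact absurd h (hXW' h1).2
      · rintro (rfl | rfl)
        · exact ⟨⟨haX, hat⟩, haP⟩
        · exact ⟨⟨hcX, htc.symm⟩, hcP⟩
    have e2 : insert t ((Q.M.E \ {v}) \ X) ∩ P.M.E = insert t (P.M.E \ {a', t, c'}) := by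
      rw [← hW]
      ext z
      simp only [mem_inter_iff, mem_sdiff, mem_singleton_iff, mem_insert_iff]
      constructor
      · rintro ⟨h1 | h1, h3⟩
        · exact Or.inl h1
        rcases hcov z h3 with h | h | h | h
        · exact absurd (h ▸ haX) h1.2
        · exact Or.inl h
        · exact absurd (h ▸ hcX) h1.2
        · exact Or.inr h
      · rintro (rfl | hz)
        · exact ⟨Or.inl rfl, htP⟩
        · refine ⟨Or.inr ⟨⟨h.ground (hWP hz), ?_⟩, fun h => (hXW' h).2 hz⟩, hWP hz⟩
          rintro rfl; exact hvP (hWP hz)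
    rw [e1, e2, hP'.span₂, hP'.par₂] at h1
    have h2 := Q.M.rk_insert_le t ((Q.M.E \ {v}) \ X)
    have h3 := Q.M.rk_diff_singleton_ge t X
    have h4 := Q.M.rk_mono (sdiff_subset (s := X) (t := {t}))
    lia
  have hWv : v ∉ W := fun h => hvP (hWP h)
  have kY : Q.M.rk (Y \ {v}) = Q.M.rk Y := by
    have h1 := hPt.rk_add_le (U := Y \ {v}) (V := insert v ((Q.M.E \ {t}) \ Y))
      (fun z hz => by
        have := h.sub hz
        have : z ≠ v := by rintro rfl; exact hvC hz
        have : z ≠ t := by rintro rfl; exact htC hz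
        simp only [mem_union, mem_sdiff, mem_insert_iff, mem_singleton_iff]; tauto)
    have e1 : Y \ {v} ∩ (R.del t).M.E = {a', c'} := by
      rw [hPtE]
      ext z
      simp only [mem_inter_iff, mem_sdiff, mem_singleton_iff, mem_insert_iff]
      constructor
      · rintro ⟨⟨h1, h2⟩, h3⟩
        rcases hcov z (h3.resolve_left h2).1 with h | h | h | h
        · exact Or.inl h
        · exact absurd (h ▸ h1) htY
        · exact Or.inr h
        · exact absurd h (hYW' h1).2
      · rintro (rfl | rfl)
        · exact ⟨⟨haY, hext'.ne_a.symm⟩, Or.inr ⟨haP, hat⟩⟩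
        · exact ⟨⟨hcY, hext'.ne_c.symm⟩, Or.inr ⟨hcP, htc.symm⟩⟩
    have e2 : insert v ((Q.M.E \ {t}) \ Y) ∩ (R.del t).M.E =
        insert v ((R.del t).M.E \ {a', v, c'}) := by
      rw [hWt, hPtE]
      ext z
      simp only [mem_inter_iff, mem_sdiff, mem_singleton_iff, mem_insert_iff]
      constructor
      · rintro ⟨h1 | h1, h3⟩
        · exact Or.inl h1
        rcases h3 with h3 | h3
        · exact Or.inl h3
        rcases hcov z h3.1 with h | h | h | h
        · exact absurd (h ▸ haY) h1.2
        · exact absurd h h3.2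
        · exact absurd (h ▸ hcY) h1.2
        · exact Or.inr h
      · rintro (rfl | hz)
        · exact ⟨Or.inl rfl, Or.inl rfl⟩
        · have := (hWn z hz).2.1
          exact ⟨Or.inr ⟨⟨h.ground (hWP hz), this⟩, fun h => (hYW' h).2 hz⟩,
            Or.inr ⟨hWP hz, this⟩⟩
    rw [e1, e2, hrep.span₂, hrep.par₂] at h1
    have h2 := Q.M.rk_insert_le v ((Q.M.E \ {t}) \ Y)
    have h3 := Q.M.rk_diff_singleton_ge v Y
    have h4 := Q.M.rk_mono (sdiff_subset (s := Y) (t := {v}))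
    lia
  refine not_separated_of_bridged rfl htE hvE htv hb hXW' hYW' hSX htX hvY (by lia) (by lia) kX kY ?_
  have h1 := h.rk_add_le (U := (X \ {t}) ∩ (Y \ {v}))
    (V := ((Q.M.E \ {t}) \ {v}) \ ((X \ {t}) ∩ (Y \ {v})))
    (fun z hz => by
      have := h.sub hz
      have : z ≠ v := by rintro rfl; exact hvC hz
      have : z ≠ t := by rintro rfl; exact htC hz
      simp only [mem_union, mem_sdiff, mem_singleton_iff]; tauto)
  have e1 : (X \ {t}) ∩ (Y \ {v}) ∩ P.M.E = {a', c'} := by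
    ext z
    simp only [mem_inter_iff, mem_sdiff, mem_singleton_iff, mem_insert_iff]
    constructor
    · rintro ⟨⟨⟨h1, h2⟩, -⟩, h3⟩
      rcases hcov z h3 with h | h | h | h
      · exact Or.inl h
      · exact absurd h h2
      · exact Or.inr h
      · exact absurd h (hXW' h1).2
    · rintro (rfl | rfl)
      · exact ⟨⟨⟨haX, hat⟩, haY, hext'.ne_a.symm⟩, haP⟩
      · exact ⟨⟨⟨hcX, htc.symm⟩, hcY, hext'.ne_c.symm⟩, hcP⟩
  have e2 : (((Q.M.E \ {t}) \ {v}) \ ((X \ {t}) ∩ (Y \ {v}))) ∩ P.M.E =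
      P.M.E \ {a', t, c'} := by
    rw [← hW]
    ext z
    simp only [mem_inter_iff, mem_sdiff, mem_singleton_iff]
    constructor
    · rintro ⟨⟨⟨⟨h0, h1⟩, h2⟩, h3⟩, h4⟩
      rcases hcov z h4 with h | h | h | h
      · subst h; exact absurd ⟨⟨haX, hat⟩, haY, hext'.ne_a.symm⟩ h3
      · exact absurd h h1
      · subst h; exact absurd ⟨⟨hcX, htc.symm⟩, hcY, hext'.ne_c.symm⟩ h3
      · exact h
    · intro hz
      refine ⟨⟨⟨⟨h.ground (hWP hz), (hWn z hz).2.1⟩, ?_⟩, fun h => (hXW' h.1.1).2 hz⟩, hWP hz⟩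
      rintro rfl; exact hWv hz
  rw [e1, e2, hP'.triad, hP'.par₂] at h1
  lia

/-- A triangle that is also a triad in a minor, and is bridged in `Q`, yields a small obstruction. -/
lemma hasSmallObstruction_of_isBridged (hN4 : 4 ≤ N.E.ncard) (hN : N.Conn3) (h : P.IsMinor Q)
    (hP : P.IsTriangleTriad N a b c) (hb : Q.IsBridged {a, b, c} (P.M.E \ {a, b, c})) :
    Q.HasSmallObstruction N := by
  induction hn : Q.M.E.ncard using Nat.strong_induction_on generalizing Q P a b c N with
  | _ n ih =>
  have hNf : N.Finite := ⟨finite_of_ncard_pos (by lia)⟩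
  have hne : N.E.Nonempty := by rw [← ncard_pos N.ground_finite]; lia
  obtain ⟨C, hC⟩ := h
  rcases hC.exists_bridge hP.disjoint_union disjoint_sdiff_right
    (by rw [hP.triangle, hP.triad]; lia) hb with ⟨v, hv, hvW⟩ | ⟨v, hv, hvS⟩
  · exact hC.hasSmallObstruction_step hN4 hN hP hb
      (fun Q' P' a b c hlt hm hc hb => ih _ (hn ▸ hlt) hN4 hN hm hc hb rfl) hv hvW
  · have hE := hC.ground
    have hPE : ∀ z ∈ ({a, b, c} : Set α), z ∈ P.M.E := fun z hz =>
      hP.disjoint_union.subset (Or.inl hz)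
    have hvE : v ∉ P.M.E := fun h => disjoint_left.1 hC.disj hv h
    have hset : ({b, a, c} : Set α) = {a, b, c} := insert_comm _ _ _
    have := hC.dual.hasSmallObstruction_step (v := v) (N := N✶) hN4 hN.dual (hP.dual hne)
      (by rw [hset]; exact hb.dual)
      (fun Q' P' a b c hlt hm hc hb => ih _ (hn ▸ hlt) (N := N✶) hN4 hN.dual hm hc hb rfl)
      ⟨⟨hC.sub hv, hvE⟩, fun h => h.2 hv⟩ (by
        rw [hset]
        exact hC.rk_insert_dual (fun z hz => hPE z hz) hv hvS)
    simpa using this.dual (by simpa)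

/-- A bad `3`-connected weighted matroid with a good copy of a `3`-connected matroid with at least
four elements has a small obstruction. The `2`-separation given by the triangle in
`exists_isTriangleTriad` is bridged, because there are none in `Q`. -/
lemma hasSmallObstruction_of_four_le [N.Finite] (hN4 : 4 ≤ N.E.ncard) (hN : N.Conn3)
    (hQ : Q.M.Conn3) (hbad : ¬ Q.Good) (hc : Q.HasGoodCopy N) : Q.HasSmallObstruction N := by
  rcases exists_isTriangleTriad hN4 hN hQ.1 hbad hc with h | ⟨P, a, b, c, hm, hP⟩
  · exact h
  refine hasSmallObstruction_of_isBridged hN4 hN hm hP fun X hSX hXW => hQ.2 X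
    (hXW.trans sdiff_subset) ?_ ?_
  · refine le_trans ?_ (ncard_le_ncard hSX (Q.M.ground_finite.subset (hXW.trans sdiff_subset)))
    rw [ncard_insert_of_notMem (by simp [hP.par₁.ne, hP.par₂.ne]), ncard_pair hP.par₃.ne]
    norm_num
  · have hWX : P.M.E \ {a, b, c} ⊆ Q.M.E \ X := fun z hz =>
      ⟨hm.ground hz.1, fun h => (hXW h).2 hz⟩
    refine le_trans ?_ (ncard_le_ncard hWX (Q.M.ground_finite.subset sdiff_subset))
    have h4 : 4 ≤ ((P.M.E \ {a}) \ {b}).ncard := hN4.trans hP.ext.ncard_le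
    have h5 := ncard_sdiff_singleton_add_one (s := (P.M.E \ {a}) \ {b}) (a := c)
      ⟨⟨hP.par₃.symm.nonLoop_left.mem, hP.par₂.ne.symm⟩, hP.par₃.ne.symm⟩
      (P.M.ground_finite.subset (sdiff_subset.trans sdiff_subset))
    rw [show ((P.M.E \ {a}) \ {b}) \ {c} = P.M.E \ {a, b, c} by ext; simp; tauto] at h5
    lia

end WeightedMatroid

end Bridging

/-! ### Existence of small obstructions -/

section SmallObstructions

open Set

namespace Matroid

variable {α β : Type*} {N : Matroid β} {M : Matroid α}

/-- Two uniform matroids of the same rank and size are isomorphic. -/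
lemma isIsomorphic_of_uniform [N.Finite] [M.Finite] (k : ℤ) (hc : N.E.ncard = M.E.ncard)
    (hN : ∀ X ⊆ N.E, N.rk X = min (X.ncard : ℤ) k) (hM : ∀ X ⊆ M.E, M.rk X = min (X.ncard : ℤ) k) :
    N.IsIsomorphic M := by
  have : Finite N.E := N.ground_finite
  have : Finite M.E := M.ground_finite
  obtain ⟨e⟩ : Nonempty (N.E ≃ M.E) := by
    rw [← Finite.card_eq, Nat.card_coe_set_eq, Nat.card_coe_set_eq, hc]
  refine ⟨e, fun I => ?_⟩
  have h1 : (Subtype.val '' I : Set β) ⊆ N.E := by rintro _ ⟨z, -, rfl⟩; exact z.2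
  have h2 : (Subtype.val '' (e '' I) : Set α) ⊆ M.E := by rintro _ ⟨z, -, rfl⟩; exact z.2
  rw [indep_iff_rk (N.ground_finite.subset h1), indep_iff_rk (M.ground_finite.subset h2), hN _ h1,
    hM _ h2, ncard_image_of_injective _ Subtype.val_injective,
    ncard_image_of_injective _ Subtype.val_injective, ncard_image_of_injective _ e.injective]

lemma Conn.rk_eq_min_one [M.Finite] (h : M.Conn) (h2 : M.E.Nontrivial) (hr : M.rk M.E = 1)
    {X : Set α} (hX : X ⊆ M.E) : M.rk X = min (X.ncard : ℤ) 1 := by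
  rcases X.eq_empty_or_nonempty with rfl | ⟨x, hx⟩
  · simp
  have h1 : M.NonLoop x := h.nonLoop (hX hx) (by
    obtain ⟨y, hy, hyx⟩ := h2.exists_ne x
    exact ⟨y, hy, hyx⟩)
  have h3 := M.rk_mono (singleton_subset_iff.2 hx)
  have h4 := M.rk_mono hX
  have h5 : 0 < X.ncard := (ncard_pos (M.ground_finite.subset hX)).2 ⟨x, hx⟩
  rw [h1] at h3
  rw [min_eq_right (by lia)]; lia

end Matroid

open Matroid

namespace WeightedMatroid

variable {α β G : Type*} [CommGroup G] {Q Q' P : WeightedMatroid α G} {x y z a b c e v t : α}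
  {N : Matroid β} {N' : Matroid α} {C U V S W X Y : Set α}

lemma good_of_subsingleton (h : Q.M.E.Subsingleton) : Q.Good := by
  refine ⟨fun _ => 1, fun S a b _ _ h1 h2 => ?_⟩
  rw [h (h1.subset_ground (mem_insert _ _)) (h2.subset_ground (mem_insert _ _))]

lemma exists_singleton_minor (he : Q.M.NonLoop e) :
    ∃ P : WeightedMatroid α G, P.M.E = {e} ∧ P.IsMinor Q := by
  have hi : Q.M.Indep {e} := (indep_iff_rk (finite_singleton e)).2 (by rw [he]; simp)
  obtain ⟨B, hB, heB⟩ := hi.exists_isBase_superset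
  rw [singleton_subset_iff] at heB
  have hr := isBase_iff_rk.1 hB
  obtain ⟨P, h1, h2⟩ := IsMinorVia.exists_via (Q := Q) (C := B \ {e}) (E' := {e})
    (singleton_subset_iff.2 he.mem) (sdiff_subset.trans hr.1) disjoint_sdiff_left
    ((indep_iff_rk (Q.M.ground_finite.subset (sdiff_subset.trans hr.1))).1
      (hB.indep.subset sdiff_subset))
    (by rw [union_sdiff_self, singleton_union, insert_eq_of_mem heB, hr.2.2])
  exact ⟨P, h1, _, h2⟩

/-- A minimal bad connected weighted matroid is a `U₂,₄`. Here `isCloseMinor_of_minimal` is applied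
to a minor with a single element, which is good for trivial reasons. -/
lemma ncard_eq_four_of_minimal (hQ : Q.M.Conn) (hbad : ¬ Q.Good)
    (hdel : ∀ x ∈ Q.M.E, (Q.M ＼ {x}).Conn → (Q.del x).Good)
    (hcon : ∀ x ∈ Q.M.E, (Q.M ／ {x}).Conn → (Q.con x).Good) :
    Q.M.E.ncard = 4 ∧ ∀ X ⊆ Q.M.E, Q.M.rk X = min (X.ncard : ℤ) 2 := by
  have h2 : Q.M.E.Nontrivial := by
    rw [← not_subsingleton_iff]
    exact fun h => hbad (good_of_subsingleton h)
  have hne : ∀ x, (Q.M.E \ {x}).Nonempty := fun x => by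
    obtain ⟨y, hy, hyx⟩ := h2.exists_ne x
    exact ⟨y, hy, hyx⟩
  have hL : ∀ x ∈ Q.M.E, Q.M.NonLoop x := fun x hx => hQ.nonLoop hx (hne x)
  have hC : ∀ x ∈ Q.M.E, Q.M.NonColoop x := fun x hx => hQ.nonColoop hx (hne x)
  have hpar : ∀ x ∈ Q.M.E, ∀ e ∈ Q.M.E, x ≠ e → Q.M.NonParallel x e := by
    intro x hx e he hxe
    by_contra hp
    exact hbad (Good.of_delete_parallel (hL x hx) (hL e he) hxe hp
      (hdel x hx (hQ.delete_of_parallel (hL x hx) (hL e he) hxe hp)))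
  have hser : ∀ x ∈ Q.M.E, ∀ e ∈ Q.M.E, x ≠ e → Q.M.NonSeries x e := by
    intro x hx e he hxe
    by_contra hp
    exact hbad (Good.of_contract_series (hC x hx) (hC e he) hx he hxe hp
      (hcon x hx (hQ.contract_of_series (hC x hx) (hC e he) hx he hxe hp)))
  obtain ⟨x, hx, y, hy, hxy⟩ := h2
  have r1 : Q.M.rk {x, y} = 2 := hpar x hx y hy hxy
  have r2 : Q.M.rk (Q.M.E \ {x, y}) = Q.M.rk Q.M.E := hser x hx y hy hxy
  have r3 := Q.M.rk_le_ncard (Q.M.ground_finite.subset (sdiff_subset (t := {x, y})))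
  have r4 := Q.M.rk_le_rk_ground {x, y}
  have c1 := ncard_ground_diff (M := Q.M) (pair_subset hx hy)
  rw [ncard_pair hxy] at c1
  have hle : Q.M.E.ncard ≤ 4 := by
    obtain ⟨P, hPE, hPm⟩ := exists_singleton_minor (hL x hx)
    have hg : Q.HasGoodMinor P.M := ⟨P, rfl, hPm, good_of_subsingleton (by rw [hPE]; simp)⟩
    have hPc : P.M.Conn := by
      intro X hX h1 h2
      rw [hPE, subset_singleton_iff_eq] at hX
      rcases hX with rfl | rfl
      · simp at h1
      · rw [hPE] at h2; simp at h2
    have key : ∀ (Q : WeightedMatroid α G) (N' : Matroid α), N'.E = {x} → Q.IsCloseMinor N' →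
        Q.M.E.ncard ≤ 4 := by
      intro Q N' hN' hclose
      have hsub : ∀ u v w : α, N'.E ⊇ Q.M.E \ {u, v, w} → Q.M.E.ncard ≤ 4 := by
        intro u v w h
        rw [hN'] at h
        have h1 : Q.M.E ⊆ {x, u, v, w} := by
          intro t ht
          by_cases htu : t ∈ ({u, v, w} : Set α)
          · exact mem_insert_of_mem _ htu
          · exact Or.inl (h ⟨ht, htu⟩)
        have h2 := ncard_le_ncard h1
        have h3 := ncard_insert_le x {u, v, w}
        have h4 := ncard_insert_le u {v, w}
        have h5 := ncard_insert_le v {w}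
        rw [ncard_singleton] at h5
        lia
      rcases hclose with ⟨u, -, rfl, -⟩ | ⟨u, -, v, -, -, -, -, rfl, -⟩ |
        ⟨u, -, v, -, w, -, -, -, -, -, -, rfl, -⟩
      · exact hsub u u u (by intro; simp)
      · exact hsub u v v (by intro; simp; tauto)
      · exact hsub u v w (by intro; simp; tauto)
    rcases isCloseMinor_of_minimal hQ hPc (by rw [hPE]; simp) hg hbad
      (fun x hx h _ => hdel x hx.1 h) (fun x hx h _ => hcon x hx.1 h)
      (fun x hx => hpar x hx.1) (fun x hx => hser x hx.1) with h | h
    · exact key Q _ hPE h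
    · exact key Q.dual P.M✶ hPE h
  have h4 : Q.M.E.ncard = 4 := by lia
  refine ⟨h4, fun X hX => ?_⟩
  have hXf := Q.M.ground_finite.subset hX
  have s1 := Q.M.rk_mono hX
  have s2 := Q.M.rk_le_ncard hXf
  rcases X.eq_empty_or_nonempty with rfl | ⟨u, hu⟩
  · simp
  by_cases hX1 : X = {u}
  · subst hX1
    rw [hL u (hX hu)]; simp
  obtain ⟨w, hw, hwu⟩ : ∃ w ∈ X, w ≠ u := by
    by_contra! hall
    exact hX1 (subset_antisymm hall (singleton_subset_iff.2 hu))
  have s3 := Q.M.rk_mono (pair_subset hw hu)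
  rw [hpar w (hX hw) u (hX hu) hwu] at s3
  rw [min_eq_right (by lia)]; lia

/-- A bad weighted matroid has a bad minor `U₂,₄`, which exceeds the connected matroids of rank one
with two or three elements in the required way. -/
lemma hasSmallObstruction_of_rank_one [N.Finite] (hN : N.Conn) (h2 : 2 ≤ N.E.ncard)
    (h3 : N.E.ncard ≤ 3) (hr : N.rk N.E = 1) (hQ : Q.M.Conn) (hbad : ¬ Q.Good) :
    Q.HasSmallObstruction N := by
  induction hn : Q.M.E.ncard using Nat.strong_induction_on generalizing Q with
  | _ n ih =>
  by_contra hcon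
  have hE2 : Q.M.E.Nontrivial := by
    rw [← not_subsingleton_iff]
    exact fun h => hbad (good_of_subsingleton h)
  have hE2' : ∀ x, (Q.M.E \ {x}).Nonempty := fun x => by
    obtain ⟨y, hy, hyx⟩ := hE2.exists_ne x
    exact ⟨y, hy, hyx⟩
  have key : ∀ Q' : WeightedMatroid α G, Q'.IsMinor Q → Q'.M.E.ncard < n → Q'.M.Conn →
      Q'.Good := by
    intro Q' hm hlt hc
    by_contra hb
    exact hcon ((ih _ hlt hc hb rfl).of_isMinor hm)
  have hgd : ∀ x ∈ Q.M.E, (Q.M ＼ {x}).Conn → (Q.del x).Good := fun x hx h =>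
    key _ (isMinor_del (hQ.nonColoop hx (hE2' x)))
      (hn ▸ ncard_sdiff_singleton_lt_of_mem hx Q.M.ground_finite) h
  have hgc : ∀ x ∈ Q.M.E, (Q.M ／ {x}).Conn → (Q.con x).Good := fun x hx h =>
    key _ (isMinor_con (hQ.nonLoop hx (hE2' x)))
      (hn ▸ ncard_sdiff_singleton_lt_of_mem hx Q.M.ground_finite) h
  obtain ⟨h4, hu⟩ := ncard_eq_four_of_minimal hQ hbad hgd hgc
  have hQ3 : Q.M.Conn3 := by
    refine ⟨hQ, fun X hX h1 h2 => ?_⟩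
    rw [hu X hX, hu _ sdiff_subset, hu _ subset_rfl]
    lia
  have hNt : N.E.Nontrivial := (one_lt_ncard_iff_nontrivial_and_finite.1 (by lia)).1
  obtain ⟨x, hx, y, hy, hxy⟩ := hE2
  have hxL : Q.M.NonLoop x := hQ.nonLoop hx (hE2' x)
  have hcx : (Q.M ／ {x}).Conn := hQ3.conn_contract (by lia) hx
  have hc1 := ncard_sdiff_singleton_add_one hx Q.M.ground_finite
  have hyx : y ∈ Q.M.E \ {x} := ⟨hy, hxy.symm⟩
  have hc2 := ncard_sdiff_singleton_add_one hyx (Q.M.ground_finite.subset sdiff_subset)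
  have hux : ∀ X ⊆ Q.M.E \ {x}, (Q.M ／ {x}).rk X = min (X.ncard : ℤ) 1 := by
    intro X hX
    rw [rk_contractElem, hxL, hu _ (insert_subset hx (hX.trans sdiff_subset)),
      ncard_insert_of_notMem (fun h => (hX h).2 rfl)
        (Q.M.ground_finite.subset (hX.trans sdiff_subset))]
    push_cast; lia
  refine hcon ⟨Q, .refl Q, hQ3, hbad, ?_⟩
  rcases (show N.E.ncard = 2 ∨ N.E.ncard = 3 by lia) with hc | hc
  · refine Or.inr (Or.inr ⟨x, hx, y, hy, hxy, ?_, (hgc x hx hcx).del (Q := Q.con x) ?_, Or.inl ?_⟩)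
    · refine isIsomorphic_of_uniform 1 ?_ (fun X hX => hN.rk_eq_min_one hNt hr hX) fun X hX => ?_
      · rw [delete_ground, contract_ground]; lia
      · rw [rk_deleteElem (fun h => (hX h).2 rfl), hux X (hX.trans sdiff_subset)]
    · refine hcx.nonColoop hyx ?_
      rw [contract_ground, ← ncard_pos (Q.M.ground_finite.subset (sdiff_subset.trans sdiff_subset))]
      lia
    · refine ⟨hcx, fun X hX h1 h2 => ?_⟩
      have := ncard_ground_diff hX
      rw [contract_ground] at this h2
      lia
  · refine Or.inl ⟨x, hx, ?_, hgc x hx hcx⟩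
    refine isIsomorphic_of_uniform 1 ?_ (fun X hX => hN.rk_eq_min_one hNt hr hX) hux
    rw [contract_ground]; lia

/-- A bad `3`-connected weighted matroid with a good copy of a `3`-connected matroid with at least
two elements has a small obstruction. -/
theorem hasSmallObstruction [N.Finite] (h2 : 2 ≤ N.E.ncard) (hN : N.Conn3)
    (hQ : Q.M.Conn3) (hbad : ¬ Q.Good) (hc : Q.HasGoodCopy N) : Q.HasSmallObstruction N := by
  by_cases h4 : 4 ≤ N.E.ncard
  · exact hasSmallObstruction_of_four_le h4 hN hQ hbad hc
  have hne : N.E.Nonempty := by rw [← ncard_pos N.ground_finite]; lia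
  obtain ⟨x, hx⟩ := hne
  have hxe : (N.E \ {x}).Nonempty := by
    rw [← ncard_pos (N.ground_finite.subset sdiff_subset)]
    have := ncard_sdiff_singleton_add_one hx N.ground_finite
    lia
  have r1 : N.rk {x} = 1 := hN.1.nonLoop hx hxe
  have r2 : N.rk (N.E \ {x}) = N.rk N.E := hN.1.nonColoop hx hxe
  have r3 := N.rk_le_ncard (N.ground_finite.subset (sdiff_subset (t := {x})))
  have r4 := N.rk_le_rk_ground {x}
  have := ncard_sdiff_singleton_add_one hx N.ground_finite
  rcases (show N.rk N.E = 1 ∨ (N.rk N.E = 2 ∧ N.E.ncard = 3) by lia) with hr | ⟨hr, hc3⟩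
  · exact hasSmallObstruction_of_rank_one hN.1 h2 (by lia) hr hQ.1 hbad
  · have hd : Q.dual.HasSmallObstruction N✶ :=
      hasSmallObstruction_of_rank_one hN.1.dual h2 (by rw [dual_ground]; lia) (by
        rw [dual_ground, rk_dual _ subset_rfl, sdiff_self, rk_empty]; lia) hQ.1.dual
        (by rwa [good_dual])
    simpa using hd.dual ⟨x, hx⟩

end WeightedMatroid

end SmallObstructions

/-! ### Maximal minors and pairs of representations -/

section Representations

open Set Matroid

variable {R : Type*} [CommRing R] {α ι κ : Type*} [Fintype ι] [DecidableEq ι]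

section Determinants

/-- If all columns outside the range of `p` are unit columns, then the determinant is that of the
square submatrix selected by `p`. -/
lemma det_eq_det_submatrix_of_unit_columns [Fintype κ] [DecidableEq κ] (A : Matrix ι ι R)
    {p : κ → ι} (hp : p.Injective) (h : ∀ s ∉ range p, ∀ r, A r s = if r = s then 1 else 0) :
    A.det = (A.submatrix p p).det := by
  classical
  have h0 : ∀ i, ¬ (i ∉ range p) → ∀ j, j ∉ range p → A i j = 0 := by
    intro i hi j hj
    rw [h j hj, if_neg]
    rintro rfl; exact hi hj
  rw [Matrix.twoBlockTriangular_det A (fun i => i ∉ range p) h0]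
  have e1 : (A.toSquareBlockProp fun i => i ∉ range p) = 1 := by
    ext i j
    rw [Matrix.toSquareBlockProp_def, Matrix.of_apply, h j j.2, Matrix.one_apply]
    simp only [Subtype.ext_iff]
  rw [e1, Matrix.det_one, one_mul]
  let e : κ ≃ {i // ¬ (i ∉ range p)} :=
    (Equiv.ofInjective p hp).trans (Equiv.subtypeEquivRight fun i => by simp)
  rw [← Matrix.det_submatrix_equiv_self e]
  rfl

/-- The maximal minor of the matrix with columns `c x` on the columns listed by `f`. -/
def colDet (c : α → ι → R) (f : ι → α) : R := (Matrix.of fun i j => c (f j) i).det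

variable {c : α → ι → R} {f g : ι → α}

lemma colDet_eq_zero_of_not_injective (h : ¬ f.Injective) : colDet c f = 0 := by
  rw [Function.Injective] at h
  push Not at h
  obtain ⟨i, j, hij, hne⟩ := h
  exact Matrix.det_zero_of_column_eq hne fun k => by simp [hij]

lemma colDet_eq_zero_of_column (i : ι) (h : c (f i) = 0) : colDet c f = 0 :=
  Matrix.det_eq_zero_of_column_eq_zero i fun k => by simp [h]

lemma colDet_comp_perm (c : α → ι → R) (f : ι → α) (σ : Equiv.Perm ι) :
    colDet c (f ∘ σ) = ((Equiv.Perm.sign σ : ℤ) : R) * colDet c f := by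
  rw [colDet, colDet, ← Matrix.det_permute']
  rfl

/-- Two enumerations of a set differ by a permutation. -/
lemma exists_perm_of_range_eq {ι : Type*} {f g : ι → α} (hf : f.Injective) (hg : g.Injective) (h : range f = range g) :
    ∃ σ : Equiv.Perm ι, g = f ∘ σ := by
  refine ⟨(Equiv.ofInjective g hg).trans ((Equiv.setCongr h.symm).trans
    (Equiv.ofInjective f hf).symm), ?_⟩
  funext i
  simp [Equiv.apply_ofInjective_symm]

lemma exists_sign_of_range_eq (hf : f.Injective) (hg : g.Injective) (h : range f = range g) :
    ∃ u : ℤˣ, ∀ c : α → ι → R, colDet c g = ((u : ℤ) : R) * colDet c f := by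
  obtain ⟨σ, rfl⟩ := exists_perm_of_range_eq hf hg h
  exact ⟨_, fun c => colDet_comp_perm c f σ⟩

/-- The minors of `V⁻¹ * C`, where `V` consists of the columns of `C` listed by `e`. -/
lemma colDet_inv_mulVec {e : ι → α} (he : IsUnit (colDet c e)) (f : ι → α) :
    colDet c e * colDet (fun x => (Matrix.of fun i j => c (e j) i)⁻¹.mulVec (c x)) f =
      colDet c f := by
  rw [colDet, colDet, colDet, ← Matrix.det_mul]
  set V := Matrix.of fun i j => c (e j) i with hV
  have : (Matrix.of fun i j => (V⁻¹.mulVec (c (f j))) i) = V⁻¹ * Matrix.of fun i j => c (f j) i := by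
    ext i j
    simp [Matrix.mul_apply, Matrix.mulVec, dotProduct]
  rw [this, ← mul_assoc, Matrix.mul_nonsing_inv _ he, one_mul]

lemma inv_mulVec_apply {e : ι → α} (he : IsUnit (colDet c e)) (i : ι) :
    (Matrix.of fun i j => c (e j) i)⁻¹.mulVec (c (e i)) = Pi.single i 1 := by
  set V := Matrix.of fun i j => c (e j) i with hV
  have h1 : c (e i) = V.mulVec (Pi.single i 1) := by
    ext k; simp [hV]
  rw [h1, Matrix.mulVec_mulVec, Matrix.nonsing_inv_mul _ he, Matrix.one_mulVec]

/-- The three-term Grassmann–Plücker relation. -/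
lemma colDet_plucker {i j : ι} (hij : i ≠ j) (hf : IsUnit (colDet c f)) (x y : α) :
    let D := fun p q => colDet c (Function.update (Function.update f i p) j q)
    D (f i) (f j) * D x y = D (f i) y * D x (f j) - D (f i) x * D y (f j) := by
  intro D
  obtain ⟨c', hc', hu⟩ : ∃ c' : α → ι → R, (∀ g, colDet c f * colDet c' g = colDet c g) ∧
    ∀ k, c' (f k) = Pi.single k 1 := ⟨_, colDet_inv_mulVec hf, inv_mulVec_apply hf⟩
  have key : ∀ p q, D p q = colDet c f * (c' p i * c' q j - c' q i * c' p j) := by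
    intro p q
    rw [show D p q = _ from (hc' _).symm]
    congr 1
    have hinj : Function.Injective ![i, j] := by
      intro a b; fin_cases a <;> fin_cases b <;> simp [hij, hij.symm]
    rw [colDet, det_eq_det_submatrix_of_unit_columns _ hinj, Matrix.det_fin_two]
    · simp [hij]
    · intro s hs r
      have hsi : s ≠ i := fun h => hs ⟨0, by simp [h]⟩
      have hsj : s ≠ j := fun h => hs ⟨1, by simp [h]⟩
      simp [hsi, hsj, hu, Pi.single_apply]
  simp only [key, hu, Pi.single_eq_same, Pi.single_eq_of_ne hij, Pi.single_eq_of_ne hij.symm]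
  ring

end Determinants

namespace PartialField

variable {P : PartialField R}

lemma Mem.exists_unit {x : R} (h : P.Mem x) (hx : x ≠ 0) : ∃ u : P.group, ((u : Rˣ) : R) = x := by
  obtain h | ⟨u, hu, rfl⟩ := h
  · exact absurd h hx
  · exact ⟨⟨u, hu⟩, rfl⟩

lemma Mem.mul_unit {x : R} (h : P.Mem x) (u : P.group) : P.Mem (((u : Rˣ) : R) * x) := by
  obtain rfl | ⟨v, hv, rfl⟩ := h
  · simp [Mem]
  · exact .inr ⟨u * v, P.group.mul_mem u.2 hv, by simp⟩

lemma Mem.sign_mul {x : R} (h : P.Mem x) (u : ℤˣ) : P.Mem (((u : ℤ) : R) * x) := by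
  obtain rfl | rfl := Int.units_eq_one_or u
  · simpa using h
  · have := h.mul_unit ⟨-1, P.neg_one_mem⟩
    simpa using this

end PartialField

/-- The matrix with columns `c x` is a representation of `M` over `P`: its maximal minors lie in
`P`, and the nonzero ones are those on the bases of `M`. Elements outside the ground set of `M`
carry columns as well. -/
structure IsRep (P : PartialField R) (c : α → ι → R) (M : Matroid α) : Prop where
  mem : ∀ f, P.Mem (colDet c f)
  ne_zero_iff : ∀ f, colDet c f ≠ 0 ↔ f.Injective ∧ M.IsBase (range f)
  exists_enum : ∀ B, M.IsBase B → ∃ f : ι → α, f.Injective ∧ range f = B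

namespace IsRep

variable {P : PartialField R} {c c₁ c₂ : α → ι → R} {M : Matroid α} {f : ι → α}

lemma exists_unit (h : IsRep P c M) (hf : f.Injective) (hB : M.IsBase (range f)) :
    ∃ u : P.group, ((u : Rˣ) : R) = colDet c f :=
  (h.mem f).exists_unit ((h.ne_zero_iff f).2 ⟨hf, hB⟩)

lemma isUnit (h : IsRep P c M) (hf : f.Injective) (hB : M.IsBase (range f)) :
    IsUnit (colDet c f) := by
  obtain ⟨u, hu⟩ := h.exists_unit hf hB
  exact hu ▸ (u : Rˣ).isUnit

lemma exists_quotient (h₁ : IsRep P c₁ M) (h₂ : IsRep P c₂ M) {B : Set α} (hB : M.IsBase B) :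
    ∃ w : P.group, ∀ f : ι → α, f.Injective → range f = B →
      ((w : Rˣ) : R) * colDet c₂ f = colDet c₁ f := by
  obtain ⟨f, hf, rfl⟩ := h₁.exists_enum B hB
  obtain ⟨u, hu⟩ := h₁.exists_unit hf hB
  obtain ⟨v, hv⟩ := h₂.exists_unit hf hB
  refine ⟨u * v⁻¹, fun g hg hgf => ?_⟩
  obtain ⟨s, hs⟩ := exists_sign_of_range_eq (R := R) hf hg hgf.symm
  rw [hs, hs, ← hu, ← hv]
  push_cast
  rw [mul_left_comm]
  congr 1
  simp

/-- Quotients of the maximal minors of two representations satisfy the exchange condition of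
weighted matroids. -/
lemma exchange (h₁ : IsRep P c₁ M) (h₂ : IsRep P c₂ M) {w : Set α → P.group}
    (hw : ∀ f : ι → α, f.Injective → M.IsBase (range f) →
      ((w (range f) : Rˣ) : R) * colDet c₂ f = colDet c₁ f)
    {S : Set α} {a b x y : α} (ha : a ∉ S) (hb : b ∉ S) (hx : x ∉ S) (hy : y ∉ S)
    (hab : a ≠ b) (hax : a ≠ x) (hay : a ≠ y) (hbx : b ≠ x) (hby : b ≠ y) (hxy : x ≠ y)
    (h1 : M.IsBase (insert a (insert b S))) (h2 : M.IsBase (insert x (insert y S)))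
    (h3 : M.IsBase (insert a (insert y S))) (h4 : M.IsBase (insert b (insert x S)))
    (h5 : M.IsBase (insert a (insert x S)) → M.IsBase (insert b (insert y S)) →
      w (insert a (insert x S)) * w (insert b (insert y S)) =
        w (insert a (insert b S)) * w (insert x (insert y S))) :
    w (insert a (insert b S)) * w (insert x (insert y S)) =
      w (insert a (insert y S)) * w (insert b (insert x S)) := by
  obtain ⟨f, hf, hfr⟩ := h₁.exists_enum _ h1
  obtain ⟨i, hi⟩ : a ∈ range f := hfr ▸ mem_insert _ _
  obtain ⟨j, hj⟩ : b ∈ range f := hfr ▸ mem_insert_of_mem _ (mem_insert _ _)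
  have hij : i ≠ j := by rintro rfl; exact hab (hi.symm.trans hj)
  have hfS : ∀ k, k ≠ i → k ≠ j → f k ∈ S := by
    intro k hki hkj
    have : f k ∈ insert a (insert b S) := hfr ▸ mem_range_self k
    simp only [mem_insert_iff, ← hi, ← hj, hf.eq_iff, hki, hkj, false_or] at this
    exact this
  have hSf : ∀ z ∈ S, ∃ k, k ≠ i ∧ k ≠ j ∧ f k = z := by
    intro z hz
    obtain ⟨k, rfl⟩ : z ∈ range f := hfr ▸ mem_insert_of_mem _ (mem_insert_of_mem _ hz)
    refine ⟨k, ?_, ?_, rfl⟩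
    · rintro rfl; exact ha (hi ▸ hz)
    · rintro rfl; exact hb (hj ▸ hz)
  set F : α → α → ι → α := fun p q => Function.update (Function.update f i p) j q with hF
  have hFr : ∀ p q, range (F p q) = insert p (insert q S) := by
    intro p q
    ext z
    simp only [mem_range, mem_insert_iff, hF]
    constructor
    · rintro ⟨k, rfl⟩
      by_cases hkj : k = j
      · subst hkj; simp
      by_cases hki : k = i
      · subst hki; simp [hkj]
      · simp [hkj, hki, hfS k hki hkj]
    · rintro (rfl | rfl | hz)
      · exact ⟨i, by simp [hij]⟩
      · exact ⟨j, by simp⟩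
      · obtain ⟨k, hki, hkj, rfl⟩ := hSf z hz
        exact ⟨k, by simp [hki, hkj]⟩
  have hFi : ∀ p q, p ∉ S → q ∉ S → p ≠ q → (F p q).Injective := by
    intro p q hp hq hpq k l hkl
    have e1 : ∀ m, m ≠ i → m ≠ j → f m ≠ p := fun m hi hj h => hp (h ▸ hfS m hi hj)
    have e2 : ∀ m, m ≠ i → m ≠ j → f m ≠ q := fun m hi hj h => hq (h ▸ hfS m hi hj)
    simp only [hF, Function.update_apply] at hkl
    by_cases hkj : k = j <;> by_cases hlj : l = j
    · rw [hkj, hlj]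
    · rw [if_pos hkj, if_neg hlj] at hkl
      split_ifs at hkl with hli
      · exact absurd hkl.symm hpq
      · exact absurd hkl.symm (e2 l hli hlj)
    · rw [if_neg hkj, if_pos hlj] at hkl
      split_ifs at hkl with hki
      · exact absurd hkl hpq
      · exact absurd hkl (e2 k hki hkj)
    · rw [if_neg hkj, if_neg hlj] at hkl
      split_ifs at hkl with hki hli hli
      · rw [hki, hli]
      · exact absurd hkl.symm (e1 l hli hlj)
      · exact absurd hkl (e1 k hki hkj)
      · exact hf hkl
  have hwt : ∀ p q, p ∉ S → q ∉ S → p ≠ q → M.IsBase (insert p (insert q S)) →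
      ((w (insert p (insert q S)) : Rˣ) : R) * colDet c₂ (F p q) = colDet c₁ (F p q) := by
    intro p q hp hq hpq hB
    have := hw (F p q) (hFi p q hp hq hpq) ((hFr p q).symm ▸ hB)
    rwa [hFr] at this
  have hz : ∀ {c} (h : IsRep P c M) p q, ¬ M.IsBase (insert p (insert q S)) →
      colDet c (F p q) = 0 := by
    intro c h p q hB
    by_contra h0
    exact hB (hFr p q ▸ ((h.ne_zero_iff _).1 h0).2)
  have hfB : M.IsBase (range f) := hfr ▸ h1
  have g1 := colDet_plucker hij (h₁.isUnit hf hfB) x y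
  have g2 := colDet_plucker hij (h₂.isUnit hf hfB) x y
  simp only [hi, hj] at g1 g2
  change colDet c₁ (F a b) * colDet c₁ (F x y) = colDet c₁ (F a y) * colDet c₁ (F x b) -
    colDet c₁ (F a x) * colDet c₁ (F y b) at g1
  change colDet c₂ (F a b) * colDet c₂ (F x y) = colDet c₂ (F a y) * colDet c₂ (F x b) -
    colDet c₂ (F a x) * colDet c₂ (F y b) at g2
  have h5' : colDet c₁ (F a x) * colDet c₁ (F y b) =
      (((w (insert a (insert b S)) : Rˣ) : R) * ((w (insert x (insert y S)) : Rˣ) : R)) *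
        (colDet c₂ (F a x) * colDet c₂ (F y b)) := by
    by_cases hax' : M.IsBase (insert a (insert x S))
    · by_cases hby' : M.IsBase (insert b (insert y S))
      · have e := congrArg (fun u : P.group => ((u : Rˣ) : R)) (h5 hax' hby')
        simp only [Subgroup.coe_mul, Units.val_mul] at e
        change ((w _ : Rˣ) : R) * ((w _ : Rˣ) : R) = ((w _ : Rˣ) : R) * ((w _ : Rˣ) : R) at e
        rw [← e, ← hwt a x ha hx hax hax', insert_comm b y,
          ← hwt y b hy hb hby.symm (insert_comm b y S ▸ hby')]
        ring
      · rw [insert_comm] at hby'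
        rw [hz h₁ y b hby', hz h₂ y b hby']; ring
    · rw [hz h₁ a x hax', hz h₂ a x hax']; ring
  rw [h5', ← hwt a b ha hb hab h1, ← hwt x y hx hy hxy h2, ← hwt a y ha hy hay h3,
    ← hwt x b hx hb hbx.symm (insert_comm b x S ▸ h4), insert_comm x b] at g1
  have u1 := h₂.isUnit (hFi a y ha hy hay) (by rwa [hFr])
  have u2 := h₂.isUnit (hFi x b hx hb hbx.symm) (by rwa [hFr, insert_comm])
  refine Subtype.ext (Units.ext ?_)
  change ((w _ : Rˣ) : R) * ((w _ : Rˣ) : R) = ((w _ : Rˣ) : R) * ((w _ : Rˣ) : R)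
  refine (u1.mul u2).mul_right_cancel ?_
  linear_combination g1 - ((w (insert a (insert b S)) : Rˣ) : R) *
    ((w (insert x (insert y S)) : Rˣ) : R) * g2

open Classical in
/-- The weighted matroid of a pair of representations: the weight of a basis is the quotient of
the minors of the two representations on that basis. It does not depend on the order in which the
elements of the basis are listed. -/
noncomputable def quotient [M.Finite] (h₁ : IsRep P c₁ M) (h₂ : IsRep P c₂ M) :
    WeightedMatroid α P.group where
  M := M
  finite := inferInstance
  wt B := if hB : M.IsBase B then (h₁.exists_quotient h₂ hB).choose else 1
  wt_off B hB := dif_neg hB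
  exchange S a b x y ha hb hx hy hab hax hay hbx hby hxy h1 h2 h3 h4 h5 :=
    h₁.exchange h₂ (w := fun B =>
        if hB : M.IsBase B then (h₁.exists_quotient h₂ hB).choose else 1) (fun f hf hB => by
      rw [dif_pos hB]
      exact (h₁.exists_quotient h₂ hB).choose_spec f hf rfl)
      ha hb hx hy hab hax hay hbx hby hxy h1 h2 h3 h4 h5

lemma quotient_wt [M.Finite] (h₁ : IsRep P c₁ M) (h₂ : IsRep P c₂ M) (hf : f.Injective)
    (hB : M.IsBase (range f)) :
    ((((h₁.quotient h₂).wt (range f) : P.group) : Rˣ) : R) * colDet c₂ f = colDet c₁ f := by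
  have : (h₁.quotient h₂).wt (range f) = (h₁.exists_quotient h₂ hB).choose := dif_pos hB
  rw [this]
  exact (h₁.exists_quotient h₂ hB).choose_spec f hf rfl

end IsRep

end Representations

/-! ### Representations in normal form -/

section NormalForm

open Set Matroid

variable {R : Type*} [CommRing R] {α ι κ : Type*} [Fintype ι] [DecidableEq ι]
  {P : PartialField R}

/-- The columns `c₁` and `c₂` represent the matroid of `Q` over `P`, and the weights of `Q` are, up
to a constant factor, the quotients of their maximal minors. -/
structure IsRepPair (P : PartialField R) (Q : WeightedMatroid α P.group) (c₁ c₂ : α → ι → R) :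
    Prop where
  left : IsRep P c₁ Q.M
  right : IsRep P c₂ Q.M
  wt : ∃ u : P.group, ∀ f : ι → α, f.Injective → Q.M.IsBase (range f) →
    ((u : Rˣ) : R) * ((Q.wt (range f) : Rˣ) : R) * colDet c₂ f = colDet c₁ f

lemma colDet_reindex [Fintype κ] [DecidableEq κ] (σ : κ ≃ ι) (c : α → ι → R) (f : κ → α) :
    colDet (fun x k => c x (σ k)) f = colDet c (f ∘ σ.symm) := by
  rw [colDet, colDet, ← Matrix.det_submatrix_equiv_self σ]
  congr 1
  ext i j
  simp

lemma IsRep.of_colDet [Fintype κ] [DecidableEq κ] {c : α → ι → R} {c' : α → κ → R}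
    {M : Matroid α} (h : IsRep P c M) (σ : κ ≃ ι) {u : P.group}
    (hc : ∀ f : κ → α, ((u : Rˣ) : R) * colDet c' f = colDet c (f ∘ σ.symm)) : IsRep P c' M where
  mem f := by
    have := (h.mem (f ∘ σ.symm)).mul_unit u⁻¹
    rw [← hc, ← mul_assoc] at this
    simpa using this
  ne_zero_iff f := by
    have := h.ne_zero_iff (f ∘ σ.symm)
    have hz : ((u : Rˣ) : R) * colDet c' f ≠ 0 ↔ colDet c' f ≠ 0 :=
      (Units.isUnit (u : Rˣ)).mul_right_eq_zero.not
    rw [← hc, hz, σ.symm.surjective.range_comp] at this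
    simpa using this
  exists_enum B hB := by
    obtain ⟨f, hf, rfl⟩ := h.exists_enum B hB
    exact ⟨f ∘ σ, hf.comp σ.injective, by rw [σ.surjective.range_comp]⟩

section Normal

variable [DecidableEq α] {X : Finset α}

/-- The columns of the elements of `X` form an identity matrix. -/
def IsNormal (X : Finset α) (c : α → X → R) : Prop := ∀ x y : X, c x y = if y = x then 1 else 0

/-- Both representations can be pivoted to have unit columns on a given basis; the quotients of the
maximal minors then change by a constant factor. -/
lemma IsRepPair.exists_normal {Q : WeightedMatroid α P.group} {c₁ c₂ : α → ι → R}
    (h : IsRepPair P Q c₁ c₂) (hX : Q.M.IsBase X) :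
    ∃ c₁' c₂' : α → X → R, IsRepPair P Q c₁' c₂' ∧ IsNormal X c₁' ∧ IsNormal X c₂' := by
  obtain ⟨e, he, heX⟩ := h.left.exists_enum _ hX
  obtain ⟨u₁, hu₁⟩ := h.left.exists_unit he (heX ▸ hX)
  obtain ⟨u₂, hu₂⟩ := h.right.exists_unit he (heX ▸ hX)
  let σ : X ≃ ι := ((Equiv.ofInjective e he).trans (Equiv.setCongr heX)).symm
  have hσ : ∀ x : X, e (σ x) = x := fun x =>
    congrArg Subtype.val (((Equiv.ofInjective e he).trans (Equiv.setCongr heX)).apply_symm_apply x)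
  have key : ∀ {c : α → ι → R} {u : P.group}, ((u : Rˣ) : R) = colDet c e → ∃ c' : α → X → R,
      (∀ f : X → α, ((u : Rˣ) : R) * colDet c' f = colDet c (f ∘ σ.symm)) ∧ IsNormal X c' := by
    intro c u hu
    have hU : IsUnit (colDet c e) := hu ▸ Units.isUnit _
    refine ⟨fun x k => (Matrix.of fun i j => c (e j) i)⁻¹.mulVec (c x) (σ k), fun f => ?_, ?_⟩
    · rw [hu, colDet_reindex, colDet_inv_mulVec hU]
    · intro x y
      have := inv_mulVec_apply hU (σ x)
      rw [hσ] at this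
      simp only
      rw [this, Pi.single_apply]
      simp
  obtain ⟨c₁', h1, hn1⟩ := key hu₁
  obtain ⟨c₂', h2, hn2⟩ := key hu₂
  refine ⟨c₁', c₂', ⟨h.left.of_colDet σ h1, h.right.of_colDet σ h2, ?_⟩, hn1, hn2⟩
  obtain ⟨u, hu⟩ := h.wt
  refine ⟨u * u₂ * u₁⁻¹, fun f hf hB => ?_⟩
  have := hu (f ∘ σ.symm) (hf.comp σ.symm.injective)
    (by rwa [σ.symm.surjective.range_comp])
  rw [σ.symm.surjective.range_comp, ← h1, ← h2] at this
  refine (Units.isUnit (u₁ : Rˣ)).mul_left_cancel ?_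
  rw [← this]
  have e1 : ((u₁ : Rˣ) : R) * (((u₁ : Rˣ)⁻¹ : Rˣ) : R) = 1 := by simp
  push_cast
  linear_combination ((u : Rˣ) : R) * ((u₂ : Rˣ) : R) * ((Q.wt (range f) : Rˣ) : R) *
    colDet c₂' f * e1

/-- Extending a list of columns by the unit columns outside `X'` does not change the minor, once the
rows outside `X'` are dropped. -/
lemma IsNormal.colDet_extend {c : α → X → R} (hc : IsNormal X c) {X' : Finset α} (hX : X' ⊆ X)
    (f : X' → α) :
    colDet c (fun s => if h : (s : α) ∈ X' then f ⟨s, h⟩ else s) =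
      colDet (fun x (r : X') => c x ⟨r, hX r.2⟩) f := by
  have hinj : Function.Injective (fun r : X' => (⟨r, hX r.2⟩ : X)) := fun r s h =>
    Subtype.ext (congrArg (fun z : X => (z : α)) h)
  rw [colDet, det_eq_det_submatrix_of_unit_columns _ hinj]
  · rw [colDet]
    congr 1
    ext i j
    simp
  · intro s hs r
    have : (s : α) ∉ X' := fun h => hs ⟨⟨s, h⟩, rfl⟩
    simp [this, hc s r]

lemma IsNormal.colDet_val {c : α → X → R} (hc : IsNormal X c) : colDet c (fun x => x) = 1 := by
  rw [colDet, ← Matrix.det_one (n := X)]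
  congr 1
  ext i j
  simp [hc j i, Matrix.one_apply]

lemma IsNormal.colDet_update {c : α → X → R} (hc : IsNormal X c) (x : X) (y : α) :
    colDet c (Function.update (fun x => x) x y) = c y x := by
  have hinj : Function.Injective (fun _ : Fin 1 => x) := fun i j _ => Subsingleton.elim i j
  rw [colDet, det_eq_det_submatrix_of_unit_columns _ hinj, Matrix.det_fin_one]
  · simp
  · intro s hs r
    have : s ≠ x := fun h => hs ⟨0, h.symm⟩
    simp [this, hc s r]

lemma range_extend {X' : Finset α} (hX : X' ⊆ X) (f : X' → α) :
    range (fun s : X => if h : (s : α) ∈ X' then f ⟨s, h⟩ else s) =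
      range f ∪ ((X : Set α) \ X') := by
  ext z
  simp only [mem_range, mem_union, mem_sdiff, Finset.mem_coe]
  constructor
  · rintro ⟨s, rfl⟩
    by_cases h : (s : α) ∈ X'
    · rw [dif_pos h]; exact .inl ⟨_, rfl⟩
    · rw [dif_neg h]; exact .inr ⟨s.2, h⟩
  · rintro (⟨s, rfl⟩ | ⟨h, h'⟩)
    · exact ⟨⟨s, hX s.2⟩, by simp⟩
    · exact ⟨⟨z, h⟩, by simp [h']⟩

lemma injective_extend {X' : Finset α} {f : X' → α} (hf : f.Injective)
    (hd : Disjoint (range f) ((X : Set α) \ X')) :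
    (fun s : X => if h : (s : α) ∈ X' then f ⟨s, h⟩ else s).Injective := by
  intro s t hst
  rw [disjoint_left] at hd
  simp only at hst
  split_ifs at hst with h1 h2 h2
  · exact Subtype.ext (congrArg (fun z : X' => (z : α)) (hf hst))
  · exact absurd ⟨t.2, h2⟩ (hd (a := (t : α)) (hst ▸ mem_range_self _))
  · exact absurd ⟨s.2, h1⟩ (hd (a := (s : α)) (hst ▸ mem_range_self _))
  · exact Subtype.ext hst

lemma IsNormal.colDet_eq_colDet_extend {c : α → X → R} (hc : IsNormal X c) {X' : Finset α}
    (hX : X' ⊆ X) {E : Set α} {c' : α → X' → R} (hc' : ∀ x ∈ E, ∀ r, c' x r = c x ⟨r, hX r.2⟩)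
    {f : X' → α} (hf : range f ⊆ E) :
    colDet c' f = colDet c (fun s => if h : (s : α) ∈ X' then f ⟨s, h⟩ else s) := by
  rw [hc.colDet_extend hX]
  unfold colDet
  congr 1
  ext i j
  exact hc' _ (hf (mem_range_self j)) i

/-- A representation in which the contracted elements carry unit columns restricts to a
representation of the minor. -/
lemma IsRep.minor {Q Q' : WeightedMatroid α P.group} {c : α → X → R} (h : IsRep P c Q.M)
    (hc : IsNormal X c) {X' : Finset α} (hX : X' ⊆ X) (hX' : Q'.M.IsBase X')
    (hQ : Q'.IsMinorVia Q ((X : Set α) \ X')) {c' : α → X' → R}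
    (hc' : ∀ x ∈ Q'.M.E, ∀ r, c' x r = c x ⟨r, hX r.2⟩) (hc0 : ∀ x ∉ Q'.M.E, c' x = 0) :
    IsRep P c' Q'.M := by
  have key0 : ∀ f : X' → α, ¬ range f ⊆ Q'.M.E → colDet c' f = 0 := by
    intro f hf
    rw [range_subset_iff, not_forall] at hf
    obtain ⟨i, hi⟩ := hf
    exact colDet_eq_zero_of_column i (hc0 _ hi)
  refine ⟨fun f => ?_, fun f => ?_, fun B hB => ?_⟩
  · by_cases hf : range f ⊆ Q'.M.E
    · rw [hc.colDet_eq_colDet_extend hX hc' hf]; exact h.mem _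
    · rw [key0 f hf]; exact .inl rfl
  · by_cases hf : range f ⊆ Q'.M.E
    · have hd := hQ.disj.symm.mono_left hf
      rw [hc.colDet_eq_colDet_extend hX hc' hf, h.ne_zero_iff, range_extend hX, hQ.isBase_iff]
      constructor
      · rintro ⟨hi, hB⟩
        refine ⟨fun r s hrs => ?_, hf, hB⟩
        have := @hi ⟨r, hX r.2⟩ ⟨s, hX s.2⟩ (by simpa using hrs)
        exact Subtype.ext (congrArg (fun z : X => (z : α)) this)
      · rintro ⟨hi, -, hB⟩
        exact ⟨injective_extend hi hd, hB⟩
    · rw [key0 f hf]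
      simp only [ne_eq, not_true_eq_false, false_iff, not_and]
      exact fun _ hB => hf hB.subset_ground
  · have hf := Q'.M.ground_finite.subset hB.subset_ground
    have hcard : Nat.card X' = Nat.card B := by
      have := hX'.ncard_eq_ncard_of_isBase hB
      rwa [← Nat.card_coe_set_eq, ← Nat.card_coe_set_eq] at this
    have : Finite B := hf
    obtain ⟨e⟩ := Finite.card_eq.1 hcard
    refine ⟨fun r => e r, Subtype.val_injective.comp e.injective, ?_⟩
    change range (Subtype.val ∘ e) = B
    rw [e.surjective.range_comp, Subtype.range_coe]

lemma IsRepPair.minor {Q Q' : WeightedMatroid α P.group} {c₁ c₂ : α → X → R}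
    (h : IsRepPair P Q c₁ c₂) (hn₁ : IsNormal X c₁) (hn₂ : IsNormal X c₂)
    {X' : Finset α} (hX : X' ⊆ X) (hX' : Q'.M.IsBase X')
    (hQ : Q'.IsMinorVia Q ((X : Set α) \ X')) :
    ∃ c₁' c₂' : α → X' → R, IsRepPair P Q' c₁' c₂' ∧ IsNormal X' c₁' ∧ IsNormal X' c₂' ∧
      ∀ x ∈ Q'.M.E, ∀ r, c₁' x r = c₁ x ⟨r, hX r.2⟩ ∧ c₂' x r = c₂ x ⟨r, hX r.2⟩ := by
  classical
  let d : (α → X → R) → α → X' → R := fun c x r => if x ∈ Q'.M.E then c x ⟨r, hX r.2⟩ else 0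
  have hd : ∀ c, ∀ x ∈ Q'.M.E, ∀ r, d c x r = c x ⟨r, hX r.2⟩ := fun c x hx r => if_pos hx
  have hd0 : ∀ c, ∀ x ∉ Q'.M.E, d c x = 0 := fun c x hx => funext fun r => if_neg hx
  have hdn : ∀ c, IsNormal X c → IsNormal X' (d c) := by
    intro c hc x y
    rw [hd c x (hX'.subset_ground x.2), hc ⟨x, hX x.2⟩ ⟨y, hX y.2⟩]
    simp only [Subtype.ext_iff]
  have r₁ := h.left.minor hn₁ hX hX' hQ (hd c₁) (hd0 c₁)
  have r₂ := h.right.minor hn₂ hX hX' hQ (hd c₂) (hd0 c₂)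
  obtain ⟨u, hu⟩ := h.wt
  refine ⟨d c₁, d c₂, ⟨r₁, r₂, u, fun f hf hB => ?_⟩, hdn _ hn₁, hdn _ hn₂,
    fun x hx r => ⟨hd _ x hx r, hd _ x hx r⟩⟩
  have hfE := hB.subset_ground
  have := hu _ (injective_extend hf (hQ.disj.symm.mono_left hfE))
    (by rw [range_extend hX]; exact (hQ.isBase_iff.1 hB).2)
  rwa [range_extend hX, ← hQ.wt _ hB,
    ← hn₁.colDet_eq_colDet_extend hX (hd c₁) hfE, ← hn₂.colDet_eq_colDet_extend hX (hd c₂) hfE]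
    at this

lemma range_update_val (x : X) {y : α} :
    range (Function.update (fun z : X => (z : α)) x y) = insert y ((X : Set α) \ {(x : α)}) := by
  ext z
  simp only [mem_range, mem_insert_iff, mem_sdiff, Finset.mem_coe, mem_singleton_iff]
  constructor
  · rintro ⟨s, rfl⟩
    by_cases hs : s = x
    · subst hs; simp
    · exact .inr ⟨by simp [hs], by simp [hs]⟩
  · rintro (rfl | ⟨h, h'⟩)
    · exact ⟨x, by simp⟩
    · exact ⟨⟨z, h⟩, Function.update_of_ne (fun e => h' (congrArg Subtype.val e)) _ _⟩

lemma injective_update_val (x : X) {y : α} (hy : y ∉ X) :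
    (Function.update (fun z : X => (z : α)) x y).Injective := by
  intro s t hst
  by_cases hs : s = x <;> by_cases ht : t = x
  · rw [hs, ht]
  · rw [hs, Function.update_self, Function.update_of_ne ht] at hst
    exact absurd (hst ▸ t.2) hy
  · rw [ht, Function.update_self, Function.update_of_ne hs] at hst
    exact absurd (hst ▸ s.2) hy
  · rw [Function.update_of_ne hs, Function.update_of_ne ht] at hst
    exact Subtype.ext hst

lemma IsRep.apply_ne_zero_iff {c : α → X → R} {M : Matroid α} (h : IsRep P c M)
    (hc : IsNormal X c) (x : X) {y : α} (hy : y ∉ X) :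
    c y x ≠ 0 ↔ M.IsBase (insert y ((X : Set α) \ {(x : α)})) := by
  rw [← hc.colDet_update x y, h.ne_zero_iff, range_update_val]
  exact and_iff_right (injective_update_val x hy)

lemma range_val_finset {α : Type*} {X : Finset α} : range (fun z : X => (z : α)) = X := by simp

lemma IsRepPair.wt_insert {Q : WeightedMatroid α P.group} {c₁ c₂ : α → X → R}
    (h : IsRepPair P Q c₁ c₂) (hn₁ : IsNormal X c₁) (hn₂ : IsNormal X c₂) (hX : Q.M.IsBase X)
    (x : X) {y : α} (hy : y ∉ X) :
    ((Q.wt (insert y ((X : Set α) \ {(x : α)})) : Rˣ) : R) * c₂ y x =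
      ((Q.wt X : Rˣ) : R) * c₁ y x := by
  by_cases hB : Q.M.IsBase (insert y ((X : Set α) \ {(x : α)}))
  · obtain ⟨u, hu⟩ := h.wt
    have e1 := hu _ (injective_update_val x hy) (by rwa [range_update_val])
    have e2 := hu (fun z : X => (z : α)) Subtype.val_injective (by rwa [range_val_finset])
    rw [range_update_val, hn₁.colDet_update, hn₂.colDet_update] at e1
    rw [range_val_finset, hn₁.colDet_val, hn₂.colDet_val, mul_one] at e2
    rw [← e1]
    linear_combination (-((Q.wt (insert y ((X : Set α) \ {(x : α)})) : Rˣ) : R) * c₂ y x) * e2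
  · have h1 := (h.left.apply_ne_zero_iff hn₁ x hy).not.2 hB
    have h2 := (h.right.apply_ne_zero_iff hn₂ x hy).not.2 hB
    rw [not_not] at h1 h2
    rw [h1, h2, mul_zero, mul_zero]

/-- The weights of a pair of representations are trivial up to a scaling exactly if the matrices
of the two representations are scaling equivalent. -/
theorem IsRepPair.good_iff {Q : WeightedMatroid α P.group} {c₁ c₂ : α → X → R}
    (h : IsRepPair P Q c₁ c₂) (hn₁ : IsNormal X c₁) (hn₂ : IsNormal X c₂) (hX : Q.M.IsBase X)
    {Y : Finset α} (hXY : Disjoint X Y) (hE : Q.M.E = (X : Set α) ∪ Y) :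
    Q.Good ↔ P.ScalingEquiv (Matrix.of fun (x : X) (y : Y) => c₁ y x)
      (Matrix.of fun (x : X) (y : Y) => c₂ y x) := by
  have hYX : ∀ y ∈ Y, y ∉ X := fun y hy hx => Finset.disjoint_left.1 hXY hx hy
  constructor
  · rintro ⟨t, ht⟩
    refine ⟨fun x => t x, fun y => (t y)⁻¹, fun x y => ?_⟩
    have hy := hYX y y.2
    have hw := h.wt_insert hn₁ hn₂ hX x hy
    simp only [Matrix.of_apply]
    by_cases hB : Q.M.IsBase (insert (y : α) ((X : Set α) \ {(x : α)}))
    · have hxX : insert (x : α) ((X : Set α) \ {(x : α)}) = X := by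
        rw [insert_sdiff_singleton, insert_eq_of_mem]; exact x.2
      have e := ht ((X : Set α) \ {(x : α)}) x y (by simp) (fun h => hy h.1) (by rwa [hxX]) hB
      rw [hxX] at e
      have e' := congrArg (fun u : P.group => ((u : Rˣ) : R)) e
      simp only [Subgroup.coe_mul, Units.val_mul] at e'
      have hu : IsUnit (((Q.wt X : Rˣ) : R) * ((t y : Rˣ) : R)) :=
        (Units.isUnit _).mul (Units.isUnit _)
      have ei : ((t y : Rˣ) : R) * (((t y)⁻¹ : P.group) : Rˣ) = 1 := by simp
      refine hu.mul_left_cancel ?_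
      linear_combination c₂ y x * e' + ((t x : Rˣ) : R) * hw -
        ((Q.wt X : Rˣ) : R) * ((t x : Rˣ) : R) * c₁ y x * ei
    · have h1 := (h.left.apply_ne_zero_iff hn₁ x hy).not.2 hB
      have h2 := (h.right.apply_ne_zero_iff hn₂ x hy).not.2 hB
      rw [not_not] at h1 h2
      rw [h1, h2, mul_zero, zero_mul]
  · rintro ⟨r, s, hrs⟩
    let t : α → P.group := fun z =>
      if h : z ∈ X then r ⟨z, h⟩ else if h' : z ∈ Y then (s ⟨z, h'⟩)⁻¹ else 1
    refine ⟨t, WeightedMatroid.isScaling_of_base hX fun S a b ha hb hS hB => ?_⟩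
    have haX : a ∈ X := by
      have : a ∈ (X : Set α) := hS ▸ mem_insert _ _
      exact this
    have hSX : S = (X : Set α) \ {a} := by rw [← hS, insert_sdiff_self_of_notMem ha]
    by_cases hbX : b ∈ X
    · have : b = a := by
        by_contra hne
        exact hb (hSX ▸ ⟨hbX, hne⟩)
      rw [this, hS]
    have hbY : b ∈ Y := by
      have := hB.subset_ground (mem_insert _ _)
      rw [hE] at this
      exact this.resolve_left hbX
    have ta : t a = r ⟨a, haX⟩ := dif_pos haX
    have tb : t b = (s ⟨b, hbY⟩)⁻¹ := by simp [t, hbX, hbY]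
    rw [hSX] at hB ⊢
    have hw := h.wt_insert hn₁ hn₂ hX ⟨a, haX⟩ hbX
    have e := hrs ⟨a, haX⟩ ⟨b, hbY⟩
    simp only [Matrix.of_apply] at e hw
    have hu : IsUnit (c₁ b ⟨a, haX⟩) := by
      rw [← hn₁.colDet_update]
      exact h.left.isUnit (injective_update_val _ hbX) (by rwa [range_update_val])
    rw [ta, tb, ← div_eq_mul_inv, div_eq_iff_eq_mul]
    refine Subtype.ext (Units.ext (hu.mul_right_cancel ?_))
    simp only [Subgroup.coe_mul, Units.val_mul]
    rw [← hw, e]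
    ring

end Normal

end NormalForm

/-! ### Matrices of the form `[I A]`, and separations -/

section FrozenNotions

open Set Matroid

namespace Matroid

variable {α : Type*} {M : Matroid α}

/-- `3`-connectivity in terms of separations agrees with its description by ranks. -/
lemma isKConnected_three_iff [M.Finite] : M.IsKConnected 3 ↔ M.Conn3 := by
  have hcast : ∀ X ⊆ M.E, ∀ k : ℕ, ((k : ℕ∞) ≤ X.encard ↔ k ≤ X.ncard) := by
    intro X hX k
    rw [← (M.ground_finite.subset hX).cast_ncard_eq]
    norm_cast
  have hlam : ∀ X Y : Set α, ∀ k : ℕ, (M.eRk X + M.eRk Y < M.eRank + k ↔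
      M.rk X + M.rk Y < M.rk M.E + k) := by
    intro X Y k
    rw [eRank_def, ← cast_rk M X, ← cast_rk M Y, ← cast_rk M M.E, rk, rk, rk]
    norm_cast
  have hpos : ∀ X ⊆ M.E, (X.Nonempty ↔ 1 ≤ X.ncard) := fun X hX => by
    rw [Nat.one_le_iff_ne_zero, Ne, ncard_eq_zero (M.ground_finite.subset hX),
      nonempty_iff_ne_empty]
  constructor
  · intro h
    have key : ∀ k : ℕ, k < 3 → ∀ X ⊆ M.E, k ≤ X.ncard → k ≤ (M.E \ X).ncard →
        M.rk M.E + k ≤ M.rk X + M.rk (M.E \ X) := by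
      intro k hk X hX h1 h2
      by_contra! hlt
      exact h k hk X (M.E \ X) ⟨union_sdiff_cancel hX, disjoint_sdiff_right, (hcast X hX k).2 h1,
        (hcast _ sdiff_subset k).2 h2, (hlam _ _ _).2 hlt⟩
    refine ⟨fun X hX h1 h2 => ?_, fun X hX h1 h2 => ?_⟩
    · exact_mod_cast key 1 (by norm_num) X hX ((hpos _ hX).1 h1) ((hpos _ sdiff_subset).1 h2)
    · exact_mod_cast key 2 (by norm_num) X hX h1 h2
  · rintro ⟨h1, h2⟩ k hk X Y ⟨hXY, hd, hX, hY, hlt⟩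
    have hXE : X ⊆ M.E := hXY ▸ subset_union_left
    have hYE : Y ⊆ M.E := hXY ▸ subset_union_right
    obtain rfl : Y = M.E \ X := by
      rw [← hXY, union_sdiff_left, hd.symm.sdiff_eq_left]
    rw [hcast _ hXE] at hX
    rw [hcast _ hYE] at hY
    rw [hlam] at hlt
    interval_cases k
    · have := M.rk_union_le X (M.E \ X)
      rw [hXY] at this
      push_cast at hlt
      lia
    · have := h1 X hXE ((hpos _ hXE).2 hX) ((hpos _ hYE).2 hY)
      push_cast at hlt
      lia
    · have := h2 X hXE hX hY
      push_cast at hlt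
      lia

lemma Conn.nonColoop_of_two_le [M.Finite] {x : α} (h : M.Conn) (h2 : 2 ≤ M.E.ncard) (hx : x ∈ M.E) :
    M.NonColoop x ∧ M.NonLoop x := by
  have hne : (M.E \ {x}).Nonempty := by
    obtain ⟨y, hy, hyx⟩ := exists_ne_of_one_lt_ncard (show 1 < M.E.ncard by lia) x
    exact ⟨y, hy, hyx⟩
  exact ⟨h.nonColoop hx hne, h.nonLoop hx hne⟩

end Matroid

variable {R : Type*} [CommRing R] {α : Type*} [DecidableEq α] {P : PartialField R}
  {X Y : Finset α} {M : Matroid α}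

lemma IsRep.isPMatrix {c : α → X → R} (h : IsRep P c M) (hn : IsNormal X c) :
    P.IsPMatrix (Matrix.of fun (x : X) (y : Y) => c y x) := by
  intro k f g hf hg
  let F : X → α := Function.extend f (fun i => (g i : α)) (fun x => (x : α))
  have hF : ∀ i, F (f i) = g i := fun i => hf.extend_apply _ _ i
  have := h.mem F
  rw [colDet, det_eq_det_submatrix_of_unit_columns _ hf] at this
  · have e : (Matrix.of fun (x : X) (y : Y) => c y x).submatrix f g =
        (Matrix.of fun i j => c (F j) i).submatrix f f := by
      ext i j; simp [hF]
    rwa [e]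
  · intro s hs r
    have : F s = s := Function.extend_apply' _ _ _ (fun ⟨i, hi⟩ => hs ⟨i, hi⟩)
    simp [this, hn s r]

/-- A representation in normal form is the matrix `[I A]` of its columns outside `X`. -/
lemma idAppend_eq {c : α → X → R} (hn : IsNormal X c) (x : X)
    (e : ((X : Set α) ∪ (Y : Set α) : Set α)) :
    idAppend (Matrix.of fun (x : X) (y : Y) => c y x) x e = c e x := by
  classical
  unfold idAppend
  split_ifs with h1 h2
  · rfl
  · rw [← h2, hn, if_pos rfl]
  · have : (e : α) ∈ X := e.2.resolve_right h1
    rw [hn ⟨e, this⟩ x, if_neg]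
    exact fun h => h2 (congrArg Subtype.val h)

lemma exists_equiv_det_ne_zero_iff {α ι : Type*} [Fintype ι] [DecidableEq ι] {E : Set α}
    (c : α → ι → R) (B : Set E) :
    (∃ e : ι ≃ B, ((Matrix.of fun i (e : E) => c e i).submatrix id (fun i => (e i : E))).det ≠ 0) ↔
      ∃ f : ι → α, f.Injective ∧ range f = Subtype.val '' B ∧ colDet c f ≠ 0 := by
  constructor
  · rintro ⟨e, he⟩
    refine ⟨fun i => (e i : E), fun i j hij => e.injective (Subtype.ext (Subtype.ext hij)), ?_, he⟩
    change range ((fun x : B => ((x : E) : α)) ∘ e) = _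
    rw [e.surjective.range_comp]
    ext z; simp
  · rintro ⟨f, hf, hfB, h0⟩
    have hfm : ∀ i, ∃ x : B, ((x : E) : α) = f i := fun i => by
      have : f i ∈ Subtype.val '' B := hfB ▸ mem_range_self i
      obtain ⟨x, hx, hxf⟩ := this
      exact ⟨⟨x, hx⟩, hxf⟩
    choose e he using hfm
    refine ⟨Equiv.ofBijective e ⟨fun i j hij => hf ?_, fun x => ?_⟩, ?_⟩
    · rw [← he, ← he, hij]
    · have : ((x : E) : α) ∈ range f := hfB ▸ mem_image_of_mem _ x.2
      obtain ⟨i, hi⟩ := this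
      exact ⟨i, Subtype.ext (Subtype.ext ((he i).trans hi))⟩
    · have hfe : f = fun i => ((e i : E) : α) := funext fun i => (he i).symm
      rw [hfe] at h0
      exact h0

lemma isMatroidOf_idAppend_iff {c : α → X → R} {A : Matrix X Y R}
    (hA : ∀ x (e : ((X : Set α) ∪ (Y : Set α) : Set α)), idAppend A x e = c e x) :
    IsMatroidOf (idAppend A) M ↔ M.E = (X : Set α) ∪ Y ∧
      ∀ B ⊆ M.E, M.IsBase B ↔ ∃ f : X → α, f.Injective ∧ range f = B ∧ colDet c f ≠ 0 := by
  have hA' : idAppend A = Matrix.of fun i (e : ((X : Set α) ∪ (Y : Set α) : Set α)) => c e i := by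
    ext x e; exact hA x e
  unfold IsMatroidOf
  refine and_congr_right fun hE => ?_
  have key : ∀ B : Set ((X : Set α) ∪ (Y : Set α) : Set α),
      (∃ e : X ≃ B, ((idAppend A).submatrix id (fun i => (e i : ((X : Set α) ∪ (Y : Set α) : Set α)))).det ≠ 0) ↔
        ∃ f : X → α, f.Injective ∧ range f = Subtype.val '' B ∧ colDet c f ≠ 0 := by
    intro B
    rw [hA']
    exact exists_equiv_det_ne_zero_iff c B
  constructor
  · intro h B hB
    obtain ⟨B, rfl⟩ : ∃ B' : Set ((X : Set α) ∪ (Y : Set α) : Set α), Subtype.val '' B' = B :=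
      ⟨Subtype.val ⁻¹' B, by simpa [hE] using hB⟩
    rw [h, ← key]
    convert Iff.rfl
  · intro h B
    rw [h _ (by rw [hE]; rintro _ ⟨z, -, rfl⟩; exact z.2), ← key]
    convert Iff.rfl

lemma IsRep.isMatroidOf {c : α → X → R} (h : IsRep P c M) (hn : IsNormal X c)
    (hE : M.E = (X : Set α) ∪ Y) :
    IsMatroidOf (idAppend (Matrix.of fun (x : X) (y : Y) => c y x)) M := by
  rw [isMatroidOf_idAppend_iff (idAppend_eq hn)]
  refine ⟨hE, fun B _ => ⟨fun hB => ?_, ?_⟩⟩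
  · obtain ⟨f, hf, rfl⟩ := h.exists_enum B hB
    exact ⟨f, hf, rfl, (h.ne_zero_iff f).2 ⟨hf, hB⟩⟩
  · rintro ⟨f, hf, rfl, h0⟩
    exact ((h.ne_zero_iff f).1 h0).2

/-- The columns of the matrix `[I A]`, extended by zero columns outside `X ∪ Y`. -/
def idAppendCol (A : Matrix X Y R) (z : α) (x : X) : R :=
  if h : z ∈ Y then A x ⟨z, h⟩ else if (x : α) = z then 1 else 0

lemma isNormal_idAppendCol (hXY : Disjoint X Y) (A : Matrix X Y R) :
    IsNormal X (idAppendCol A) := by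
  intro x y
  have : (x : α) ∉ Y := Finset.disjoint_left.1 hXY x.2
  rw [idAppendCol, dif_neg this]
  simp only [Subtype.ext_iff]

lemma idAppendCol_apply (A : Matrix X Y R) (x : X) (y : Y) : idAppendCol A y x = A x y := by
  simp [idAppendCol]

/-- Rearranging the columns so that unit columns stand in their own positions, a maximal minor of
`[I A]` becomes, up to sign, a minor of `A`. -/
lemma mem_colDet_idAppendCol (hXY : Disjoint X Y) {A : Matrix X Y R} (hA : P.IsPMatrix A)
    (f : X → α) : P.Mem (colDet (idAppendCol A) f) := by
  by_cases hf : f.Injective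
  swap
  · exact .inl (colDet_eq_zero_of_not_injective hf)
  by_cases hr : ∀ s, f s ∈ X ∨ f s ∈ Y
  swap
  · push Not at hr
    obtain ⟨s, hsX, hsY⟩ := hr
    refine .inl (colDet_eq_zero_of_column s (funext fun x => ?_))
    have : (x : α) ≠ f s := fun h => hsX (h ▸ x.2)
    simp [idAppendCol, hsY, this]
  let e : {s : X // (s : α) ∈ range f} ≃ {s : X // f s ∈ X} := Equiv.symm <| Equiv.ofBijective
    (fun s => ⟨⟨f s, s.2⟩, mem_range_self _⟩) ⟨fun s t hst => by
      have : f s = f t := congrArg (fun z : {s : X // (s : α) ∈ range f} => ((z : X) : α)) hst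
      exact Subtype.ext (hf this), fun ⟨s, hs⟩ => by
      obtain ⟨i, hi⟩ := hs
      exact ⟨⟨i, hi ▸ s.2⟩, Subtype.ext (Subtype.ext hi)⟩⟩
  let σ : Equiv.Perm X := e.extendSubtype
  have h1 : ∀ s : X, (s : α) ∈ range f → f (σ s) = s := by
    intro s hs
    have : (σ s : X) = e ⟨s, hs⟩ := e.extendSubtype_apply_of_mem s hs
    rw [this]
    exact congrArg (fun z : {s : X // (s : α) ∈ range f} => ((z : X) : α)) (e.symm_apply_apply ⟨s, hs⟩)
  have h2 : ∀ s : X, (s : α) ∉ range f → f (σ s) ∈ Y := fun s hs =>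
    (hr _).resolve_left (e.extendSubtype_not_mem s hs)
  have hcomp : f = (f ∘ σ) ∘ (σ⁻¹ : Equiv.Perm X) := by funext s; simp
  rw [hcomp, colDet_comp_perm]
  refine PartialField.Mem.sign_mul ?_ _
  let τ := (Fintype.equivFin {s : X // (s : α) ∉ range f}).symm
  have hp : Function.Injective (fun i => (τ i : X)) := Subtype.val_injective.comp τ.injective
  rw [colDet, det_eq_det_submatrix_of_unit_columns _ hp]
  · have hm := hA _ (fun i => (τ i : X)) (fun i => ⟨f (σ (τ i)), h2 _ (τ i).2⟩) hp (fun i j hij => by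
      have : f (σ (τ i)) = f (σ (τ j)) := congrArg Subtype.val hij
      exact hp (σ.injective (hf this)))
    have e : A.submatrix (fun i => (τ i : X)) (fun i => ⟨f (σ (τ i)), h2 _ (τ i).2⟩) =
        (Matrix.of fun i j => idAppendCol A ((f ∘ σ) j) i).submatrix (fun i => (τ i : X))
          (fun i => (τ i : X)) := by
      ext i j
      simp only [Matrix.submatrix_apply, Matrix.of_apply, Function.comp_apply]
      exact (idAppendCol_apply A _ ⟨_, h2 _ (τ j).2⟩).symm
    rwa [← e]
  · intro s hs r
    have : (s : α) ∈ range f := by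
      by_contra h
      exact hs ⟨τ.symm ⟨s, h⟩, by simp⟩
    rw [Matrix.of_apply, Function.comp_apply, h1 s this, isNormal_idAppendCol hXY A s r]

/-- A `P`-matrix `A` with `M = M[I A]` gives a representation of `M`. -/
lemma IsMatroidOf.isRep (hXY : Disjoint X Y) {A : Matrix X Y R} (hA : P.IsPMatrix A)
    (h : IsMatroidOf (idAppend A) M) : IsRep P (idAppendCol A) M := by
  have hcol : ∀ x (e : ((X : Set α) ∪ (Y : Set α) : Set α)),
      idAppend A x e = idAppendCol A e x := fun x e => by
    unfold idAppend idAppendCol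
    split_ifs <;> rfl
  obtain ⟨hE, hB⟩ := (isMatroidOf_idAppend_iff hcol).1 h
  refine ⟨mem_colDet_idAppendCol hXY hA, fun f => ⟨fun h0 => ?_, ?_⟩, fun B hBB => ?_⟩
  · have hf : f.Injective := by
      by_contra hf
      exact h0 (colDet_eq_zero_of_not_injective hf)
    have hr : range f ⊆ M.E := by
      rintro _ ⟨s, rfl⟩
      by_contra hs
      rw [hE, mem_union, not_or] at hs
      refine h0 (colDet_eq_zero_of_column s (funext fun x => ?_))
      have h1 : (x : α) ≠ f s := fun h => hs.1 (h ▸ x.2)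
      have h2 : f s ∉ Y := hs.2
      simp [idAppendCol, h1, h2]
    exact ⟨hf, (hB _ hr).2 ⟨f, hf, rfl, h0⟩⟩
  · rintro ⟨hf, hBB⟩ h0
    obtain ⟨g, hg, hgf, h1⟩ := (hB _ hBB.subset_ground).1 hBB
    obtain ⟨s, hs⟩ := exists_sign_of_range_eq (R := R) hf hg hgf.symm
    exact h1 (by rw [hs, h0, mul_zero])
  · obtain ⟨f, hf, hfB, -⟩ := (hB _ hBB.subset_ground).1 hBB
    exact ⟨f, hf, hfB⟩

end FrozenNotions

/-! ### Stabilizers -/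

section Stabilizers

open Set Matroid

variable {R : Type*} [CommRing R] {α β ι : Type*} [Fintype ι] [DecidableEq ι] [DecidableEq α]
  {P : PartialField R} {M : Matroid α} {N : Matroid β}

lemma WeightedMatroid.IsMinorVia.eq_contract_delete {α G : Type*} [CommGroup G]
    {Q Q' : WeightedMatroid α G} {C D : Set α} (h : Q'.IsMinorVia Q C)
    (hD : Q'.M.E = (Q.M.E \ C) \ D) : Q'.M = Q.M ／ C ＼ D := by
  refine ext_rk hD fun X hX => ?_
  have hXD : X \ D = X := sdiff_eq_left.2 ((subset_sdiff.1 (hD ▸ hX)).2)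
  rw [rk_delete, hXD, rk_contract, h.indep, h.rk X hX]

lemma WeightedMatroid.IsMinorVia.isBase_union {α G : Type*} [CommGroup G]
    {Q Q' : WeightedMatroid α G} {C : Set α} (h : Q'.IsMinorVia Q C) {B : Set α}
    (hB : Q'.M.IsBase B) : Q.M.IsBase (B ∪ C) := (h.isBase_iff.1 hB).2

/-- Two representations that are inequivalent although they agree on a minor isomorphic to `N`
give a weighted matroid that is not good but has a good minor isomorphic to `N`. -/
lemma exists_not_good_of_not_stabilizes [M.Finite] (h : ¬ Stabilizes P N M) :
    ∃ (Q : WeightedMatroid α P.group) (X : Finset α) (c₁ c₂ : α → X → R), Q.M = M ∧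
      IsRepPair P Q c₁ c₂ ∧ ¬ Q.Good ∧ Q.HasGoodCopy N := by
  simp only [Stabilizes, IsStabilizerFor, not_forall] at h
  obtain ⟨N', hN'M, hN', X, Y, X', Y', hX, hY, hXY, hE, hXB, hE', hXB', hNM, A₁, A₂, hA₁, hA₂,
    hM₁, hM₂, hsc, hnot⟩ := h
  have r₁ := hM₁.isRep hXY hA₁
  have r₂ := hM₂.isRep hXY hA₂
  have n₁ := isNormal_idAppendCol hXY A₁
  have n₂ := isNormal_idAppendCol hXY A₂
  have hp : IsRepPair P (r₁.quotient r₂) (idAppendCol A₁) (idAppendCol A₂) :=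
    ⟨r₁, r₂, 1, fun f hf hB => by
      have := r₁.quotient_wt r₂ hf hB
      simpa using this⟩
  set Q := r₁.quotient r₂ with hQ
  have hQM : Q.M = M := rfl
  have hmat : ∀ A : Matrix X Y R, (Matrix.of fun (x : X) (y : Y) => idAppendCol A y x) = A :=
    fun A => by ext x y; exact idAppendCol_apply A x y
  refine ⟨Q, X, _, _, hQM, hp, ?_, ?_⟩
  · rw [hp.good_iff n₁ n₂ hXB hXY hE, hmat, hmat]
    exact hnot
  · obtain ⟨hXE, hXr, hXr'⟩ := isBase_iff_rk.1 hXB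
    have hXf := M.ground_finite.subset hXE
    have hdisj : Disjoint ((X : Set α) \ X') N'.E := by
      rw [hE', disjoint_union_right]
      refine ⟨disjoint_sdiff_left, disjoint_left.2 fun z hz hz' => ?_⟩
      exact Finset.disjoint_left.1 hXY hz.1 (hY hz')
    have hsp : (X : Set α) ⊆ N'.E ∪ ((X : Set α) \ X') := by
      rw [hE']
      intro z hz
      by_cases hz' : z ∈ X'
      · exact .inl (.inl hz')
      · exact .inr ⟨hz, hz'⟩
    obtain ⟨Q', hQE, hQ'⟩ := WeightedMatroid.IsMinorVia.exists_via (Q := Q) (C := (X : Set α) \ X')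
      (E' := N'.E) hN'M.subset (sdiff_subset.trans hXE) hdisj
      ((indep_iff_rk (hXf.subset sdiff_subset)).1 (hXB.indep.subset sdiff_subset))
      (le_antisymm (Q.M.rk_le_rk_ground _) (hXr' ▸ Q.M.rk_mono hsp))
    have hQN : Q'.M = N' := by
      rw [hNM]
      refine hQ'.eq_contract_delete ?_
      rw [hQE, hNM]
      rfl
    refine ⟨N', hN', Q', hQN, ⟨_, hQ'⟩, ?_⟩
    have hXB'' : Q'.M.IsBase X' := hQN ▸ hXB'
    have hXY' : Disjoint X' Y' := Finset.disjoint_of_subset_left hX (Finset.disjoint_of_subset_right hY hXY)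
    obtain ⟨c₁, c₂, hp', m₁, m₂, hc⟩ := hp.minor n₁ n₂ hX hXB'' hQ'
    rw [hp'.good_iff m₁ m₂ hXB'' hXY' (hQE.trans hE')]
    obtain ⟨r, s, hrs⟩ := hsc
    refine ⟨r, s, fun x y => ?_⟩
    have hy : (y : α) ∈ Q'.M.E := by rw [hQE, hE']; exact .inr y.2
    rw [Matrix.of_apply, Matrix.of_apply, (hc y hy x).1, (hc y hy x).2,
      idAppendCol_apply A₁ _ (⟨y, hY y.2⟩ : Y), idAppendCol_apply A₂ _ (⟨y, hY y.2⟩ : Y)]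
    exact hrs x y

/-- A pair of representations of `Q` yields one of each minor, in normal form with respect to any
basis of the minor. -/
lemma IsRepPair.exists_minor {Q Q' : WeightedMatroid α P.group} {c₁ c₂ : α → ι → R} {C : Set α}
    (h : IsRepPair P Q c₁ c₂) (hQ : Q'.IsMinorVia Q C) {X : Finset α} (hX : Q'.M.IsBase X) :
    ∃ c₁' c₂' : α → X → R, IsRepPair P Q' c₁' c₂' ∧ IsNormal X c₁' ∧ IsNormal X c₂' := by
  lift C to Finset α using hQ.finite
  have hB : Q.M.IsBase ((X ∪ C : Finset α) : Set α) := by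
    rw [Finset.coe_union]; exact hQ.isBase_union hX
  obtain ⟨d₁, d₂, hd, n₁, n₂⟩ := h.exists_normal hB
  have hC : (((X ∪ C : Finset α) : Set α) \ X) = C := by
    rw [Finset.coe_union, union_sdiff_left]
    exact (hQ.disj.mono_right hX.subset_ground).sdiff_eq_left
  obtain ⟨e₁, e₂, he, m₁, m₂, -⟩ := hd.minor n₁ n₂ Finset.subset_union_left hX (hC.symm ▸ hQ)
  exact ⟨e₁, e₂, he, m₁, m₂⟩

/-- A weighted matroid of a pair of representations that is not good, although it has a good minor
isomorphic to `N`, shows that `N` is not a stabilizer. -/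
lemma IsRepPair.not_stabilizes {Q Q' Q'' : WeightedMatroid α P.group} {c₁ c₂ : α → ι → R}
    {C : Set α} (h : IsRepPair P Q c₁ c₂) (hQ : Q'.IsMinor Q) (hbad : ¬ Q'.Good)
    (hQ' : Q''.IsMinorVia Q' C) (hgood : Q''.Good) (hN : N.IsIsomorphic Q''.M) :
    ¬ Stabilizes P N Q'.M := by
  intro hst
  obtain ⟨D, hQ⟩ := hQ
  lift C to Finset α using hQ'.finite
  obtain ⟨X', hX'⟩ := Q''.M.exists_isBase
  lift X' to Finset α using Q''.M.ground_finite.subset hX'.subset_ground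
  have hX : Q'.M.IsBase ((X' ∪ C : Finset α) : Set α) := by
    rw [Finset.coe_union]; exact hQ'.isBase_union hX'
  obtain ⟨Y, hYE⟩ : ∃ Y : Finset α, (Y : Set α) = Q'.M.E \ (X' ∪ C : Finset α) :=
    (Q'.M.ground_finite.subset sdiff_subset).exists_finset_coe
  obtain ⟨Y', hYE'⟩ : ∃ Y' : Finset α, (Y' : Set α) = Q''.M.E \ X' :=
    (Q''.M.ground_finite.subset sdiff_subset).exists_finset_coe
  have hd := hQ'.disj
  have hC : (((X' ∪ C : Finset α) : Set α) \ X') = C := by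
    rw [Finset.coe_union, union_sdiff_left]
    exact (hd.mono_right hX'.subset_ground).sdiff_eq_left
  have hXX : X' ⊆ X' ∪ C := Finset.subset_union_left
  have hYY : Y' ⊆ Y := by
    rw [← Finset.coe_subset, hYE, hYE', Finset.coe_union]
    rintro z ⟨hz, hzX⟩
    refine ⟨hQ'.ground hz, ?_⟩
    rintro (hz' | hz')
    · exact hzX hz'
    · exact disjoint_left.1 hd hz' hz
  have hXY : Disjoint (X' ∪ C) Y := by
    rw [← Finset.disjoint_coe, hYE]; exact disjoint_sdiff_right
  have hXY' : Disjoint X' Y' := by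
    rw [← Finset.disjoint_coe, hYE']; exact disjoint_sdiff_right
  have hE : Q'.M.E = ((X' ∪ C : Finset α) : Set α) ∪ Y := by
    rw [hYE, union_sdiff_cancel hX.subset_ground]
  have hE' : Q''.M.E = (X' : Set α) ∪ Y' := by
    rw [hYE', union_sdiff_cancel hX'.subset_ground]
  obtain ⟨d₁, d₂, hp, n₁, n₂⟩ := h.exists_minor hQ hX
  obtain ⟨e₁, e₂, hp', m₁, m₂, hde⟩ := hp.minor n₁ n₂ hXX hX' (hC.symm ▸ hQ')
  refine hbad ((hp.good_iff n₁ n₂ hX hXY hE).2 ?_)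
  refine hst Q''.M (WeightedMatroid.IsMinor.isMinor ⟨_, hQ'⟩) hN _ Y X' Y' hXX hYY hXY hE hX hE' hX'
    ?_ _ _ (hp.left.isPMatrix n₁) (hp.right.isPMatrix n₂) (hp.left.isMatroidOf n₁ hE)
    (hp.right.isMatroidOf n₂ hE) ?_
  · rw [hC]
    refine hQ'.eq_contract_delete ?_
    ext z
    have h1 := @hYY z
    have h2 : z ∈ Q''.M.E ↔ z ∈ X' ∨ z ∈ Y' := by rw [hE']; rfl
    have h3 : z ∈ Q'.M.E ↔ z ∈ X' ∪ C ∨ z ∈ Y := by rw [hE]; rfl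
    have h4 : z ∈ X' ∪ C → z ∉ Y := fun h => Finset.disjoint_left.1 hXY h
    have h5 : z ∈ C → z ∉ Q''.M.E := fun h => disjoint_left.1 hd h
    simp only [mem_sdiff, Finset.mem_coe, Finset.mem_union] at *
    tauto
  · obtain ⟨r, s, hrs⟩ := (hp'.good_iff m₁ m₂ hX' hXY' hE').1 hgood
    refine ⟨r, s, fun x y => ?_⟩
    have hy : (y : α) ∈ Q''.M.E := by rw [hE']; exact .inr y.2
    have := hrs x y
    rw [Matrix.of_apply, Matrix.of_apply, (hde y hy x).1, (hde y hy x).2] at this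
    exact this

/-- If `N` does not stabilize `M`, then the obstruction found in a weighted matroid is a minor of
`M` that `N` does not stabilize. -/
lemma exists_minor_of_not_stabilizes [N.Finite] [M.Finite] (hN : N.IsKConnected 3)
    (hNnontriv : N.E.Nontrivial) (hM : M.IsKConnected 3) (hst : ¬ Stabilizes P N M) :
    ∃ M' : Matroid α, M' ≤m M ∧ M'.IsKConnected 3 ∧ ¬ Stabilizes P N M' ∧
      ((∃ x ∈ M'.E, N.IsIsomorphic (M' ／ {x})) ∨
       (∃ y ∈ M'.E, N.IsIsomorphic (M' ＼ {y})) ∨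
       (∃ x ∈ M'.E, ∃ y ∈ M'.E, x ≠ y ∧ N.IsIsomorphic (M' ／ {x} ＼ {y}) ∧
          ((M' ／ {x}).IsKConnected 3 ∨ (M' ＼ {y}).IsKConnected 3))) := by
  obtain ⟨Q, X, c₁, c₂, rfl, hp, hbad, hcopy⟩ := exists_not_good_of_not_stabilizes hst
  have h2 : 2 ≤ N.E.ncard := by
    have := (one_lt_ncard N.ground_finite).2 hNnontriv
    lia
  obtain ⟨Q', hQ, hc3, hbad', hcase⟩ := WeightedMatroid.hasSmallObstruction h2
    (isKConnected_three_iff.1 hN) (isKConnected_three_iff.1 hM) hbad hcopy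
  have hcard : ∀ x ∈ Q'.M.E, (Q'.M.E \ {x}).ncard + 1 = Q'.M.E.ncard := fun x hx =>
    ncard_sdiff_singleton_add_one hx Q'.M.ground_finite
  have hconn := fun x (hx : x ∈ Q'.M.E) (h : 2 ≤ Q'.M.E.ncard) => hc3.1.nonColoop_of_two_le h hx
  refine ⟨Q'.M, hQ.isMinor, isKConnected_three_iff.2 hc3, ?_, ?_⟩
  · rcases hcase with ⟨x, hx, hiso, hg⟩ | ⟨y, hy, hiso, hg⟩ | ⟨x, hx, y, hy, hxy, hiso, hg, -⟩
    · have := hiso.ncard_eq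
      rw [contract_ground] at this
      have := hcard x hx
      exact hp.not_stabilizes hQ hbad' (.contract (hconn x hx (by lia)).2) hg hiso
    · have := hiso.ncard_eq
      rw [delete_ground] at this
      have := hcard y hy
      exact hp.not_stabilizes hQ hbad' (.delete (hconn y hy (by lia)).1) hg hiso
    · have h1 := hiso.ncard_eq
      rw [delete_ground, contract_ground] at h1
      have h3 := hcard x hx
      have hyx : y ∈ (Q'.M ／ {x}).E := ⟨hy, hxy.symm⟩
      have h4 := ncard_sdiff_singleton_add_one hyx (Q'.M ／ {x}).ground_finite
      rw [contract_ground] at h4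
      have hx' := (hconn x hx (by lia)).2
      have hy' : (Q'.con x).M.NonColoop y :=
        ((hc3.conn_contract (by lia) hx).nonColoop_of_two_le
          (by rw [contract_ground]; lia) hyx).1
      exact hp.not_stabilizes hQ hbad'
        ((WeightedMatroid.IsMinorVia.delete (Q := Q'.con x) hy').trans (.contract hx')) hg hiso
  · rcases hcase with ⟨x, hx, hiso, -⟩ | ⟨y, hy, hiso, -⟩ | ⟨x, hx, y, hy, hxy, hiso, -, h⟩
    · exact .inl ⟨x, hx, hiso⟩
    · exact .inr (.inl ⟨y, hy, hiso⟩)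
    · exact .inr (.inr ⟨x, hx, y, hy, hxy, hiso,
        h.imp isKConnected_three_iff.2 isKConnected_three_iff.2⟩)

end Stabilizers

theorem theorem3p8 {R : Type*} [CommRing R] (P : PartialField R) {α β : Type*}
    (N : Matroid β) (M : Matroid α) [N.Finite] [M.Finite]
    (hN : N.IsKConnected 3) (hNnontriv : N.E.Nontrivial) (hNrep : N.IsPRepresentable P)
    (hM : M.IsKConnected 3) (hMrep : M.IsPRepresentable P)
    (hNM : M.HasMinorIso N) :
    Matroid.Stabilizes P N M ∨
    ∃ M' : Matroid α, M' ≤m M ∧ M'.IsKConnected 3 ∧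
      ¬ Matroid.Stabilizes P N M' ∧
      ((∃ x ∈ M'.E, N.IsIsomorphic (M' ／ {x})) ∨
       (∃ y ∈ M'.E, N.IsIsomorphic (M' ＼ {y})) ∨
       (∃ x ∈ M'.E, ∃ y ∈ M'.E, x ≠ y ∧ N.IsIsomorphic (M' ／ {x} ＼ {y}) ∧
          ((M' ／ {x}).IsKConnected 3 ∨ (M' ＼ {y}).IsKConnected 3))) := by
  classical
  by_cases hst : Matroid.Stabilizes P N M
  · exact .inl hst
  · exact .inr (exists_minor_of_not_stabilizes hN hNnontriv hM hst)
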